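/- Let $G=(V,E)$ be a finite simple undirected graph with $n$ vertices and $m$ edges. For $k\ge 1$, a *$k$-graphlet* of $G$ is a set $S\subseteq V$ of $k$ vertices whose induced subgraph $G[S]$ is connected. For $In\subseteq V$ let $N(In)$ be the set of vertices outside $In$ that have a neighbour in $In$. If $G[In]$ is connected and $In\ne\emptyset$, a vertex $w\notin In$ is *mandatory* for $G, In, k$ if the connected component of $G-w$ that contains $In$ has at most $k-1$ vertices. Consider the following recursive procedures. ENUM-V$(G,In,k)$: (1) While $|In|\ne k-1$ and $N(In)$ has exactly one vertex, add this vertex to $In$. (2) If $|In|=k-1$, output $In\cup\{u\}$ for every $u\in N(In)$ and return. (3) Otherwise let $x\neq y$ be two vertices of $N(In)$. If one of them is not mandatory for $G,In,k$, let $z\in\{x,y\}$ be a non-mandatory one, and call ENUM-V$(G,In\cup\{z\},k)$ and then ENUM-V$(G-z,In,k)$. If both are mandatory, call LIN-ENUM-V$(G,In,k)$. LIN-ENUM-V$(G,In,k)$: (1) While $|In|<k$ and $N(In)$ has a mandatory vertex $u$, add $u$ to $In$. (2) If $|In|=k$, output $In$ and return. (3) Otherwise let $v$ be a vertex of $N(In)$,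 and call LIN-ENUM-V$(G,In\cup\{v\},k)$ and then LIN-ENUM-V$(G-v,In,k)$. They are implemented on a random access machine with unit-cost steps. The graph is given in memory by doubly linked adjacency lists (in any order) in which each arc has a pointer to the opposite arc, so that a vertex can be deleted and restored in time proportional to its current degree; the remaining memory is initially zero. There is a single copy of the graph and of the set $In$, which is edited and restored during the recursion. Whether one of $x,y$ is mandatory is decided by a breadth-first search from $In$ that stops once it has found $k$ vertices; the mandatory vertices in LIN-ENUM-V are found by a depth-first search with low-points. Time is the number of machine steps, and space is the largest number of memory words in use at any moment, including the input graph and the recursion stack but not the write-only output. **Theorem.** There is an absolute constant $C$ such that the following holds for every $G$, every stored form of $G$ as above, every vertex $v_i$ of $G$ and every integer $k\ge 2$ such that the connected component of $v_i$ has at least $k$ vertices (for instance, $G$ connected and $n\ge k$). Let $N_i$ be the number of $k$-graphlets of $G$ that contain $v_i$. Then ENUM-V$(G,\{v_i\},k)$ outputs each of these $k$-graphlets exactly once and no other set, halts after at most $C\,N_i\,k^2$ steps, and uses at most $C\,(n+m)$ words of space. That is, it runs in $O(N_i\cdot k^2)$ time and $O(n+m)$ space. -/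

import Mathlib

/-!
Enumeration of the `k`-graphlets of a graph that contain a given vertex: the recursive algorithm
ENUM-V, written as a program of a random access machine, whose time is the number of machine steps
and whose space is the number of memory words.
-/

namespace Graphlet

/-! ### Graphlets -/

/-- A `k`-graphlet of `G`, given by its vertex set: `k` vertices that induce a connected
subgraph. -/
def IsGraphlet {n : ℕ} (G : SimpleGraph (Fin n)) (k : ℕ) (S : Finset (Fin n)) : Prop :=
  S.card = k ∧ (G.induce (S : Set (Fin n))).Connected

/-- The set of the `k`-graphlets of `G` that contain the vertex `v`. -/
def graphletsAt {n : ℕ} (G : SimpleGraph (Fin n)) (k : ℕ) (v : Fin n) :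
    Set (Finset (Fin n)) :=
  {S | IsGraphlet G k S ∧ v ∈ S}

/-! ### The machine

A machine has finitely many registers, finitely many arrays of words of fixed lengths, a stack of
saved registers for recursive procedures and a write-only output tape. -/

/-- The registers. A procedure starts with the registers of its caller. On return the registers of
the caller are restored, except for `res`, which keeps the value that the procedure has left. -/
inductive Var
  | k | s | s₀ | x | y | z | u | w | a | b | i | j | p | q | cnt | res | comp
  deriving DecidableEq

instance : Fintype Var where
  elems := {.k, .s, .s₀, .x, .y, .z, .u, .w, .a, .b, .i, .j, .p, .q, .cnt, .res, .comp}
  complete r := by cases r <;> decide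

/-- The arrays. `nxt`, `prv`, `dst`, `twin` hold the graph, `ins` the current set `In`
as a list whose length is in the register `s`, and `isIn` its characteristic function. The others
are work space for graph searches: `queue` and `seen` for breadth-first searches, and
`disc`, `low`, `cut` (with `queue`) for depth-first searches. -/
inductive Arr
  | nxt | prv | dst | twin | ins | isIn | queue | seen | disc | low | cut
  deriving DecidableEq

instance : Fintype Arr where
  elems := {.nxt, .prv, .dst, .twin, .ins, .isIn, .queue, .seen, .disc, .low, .cut}
  complete t := by cases t <;> decide

/-- The recursive procedures. -/
inductive Proc
  | enumV | linEnumV | dfs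

/-- Expressions (of a size fixed by the program text). Subtraction is truncated at zero. -/
inductive Expr
  | lit (c : ℕ)
  | var (r : Var)
  | load (t : Arr) (e : Expr)
  | add (e f : Expr)
  | sub (e f : Expr)

instance : Coe Var Expr := ⟨Expr.var⟩

instance (c : ℕ) : OfNat Expr c := ⟨Expr.lit c⟩

/-- Tests. -/
inductive Test
  | lt (e f : Expr)
  | eq (e f : Expr)
  | not (b : Test)
  | and (b c : Test)

/-- Commands. Programs are lists of commands. -/
inductive Cmd
  | assign (r : Var) (e : Expr)
  | store (t : Arr) (e f : Expr)
  | branch (b : Test) (yes no : List Cmd)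
  | loop (b : Test) (body : List Cmd)
  | call (f : Proc)
  | emit (e : Expr)

/-- A configuration of the machine: the commands that the current procedure has still to execute,
the registers, the stack of suspended procedures with their saved registers, the arrays, and the
output written so far. -/
structure Config where
  code : List Cmd
  reg : Var → ℕ
  stack : List (List Cmd × (Var → ℕ))
  mem : Arr → ℕ → ℕ
  out : List ℕ

/-- Values of expressions; `len` gives the lengths of the arrays. There is nothing to be read beyond
the end of an array. -/
def Expr.eval (len : Arr → ℕ) (reg : Var → ℕ) (mem : Arr → ℕ → ℕ) : Expr → ℕ
  | .lit c => c
  | .var r => reg r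
  | .load t e =>
      let i := e.eval len reg mem
      if i < len t then mem t i else 0
  | .add e f => e.eval len reg mem + f.eval len reg mem
  | .sub e f => e.eval len reg mem - f.eval len reg mem

def Test.eval (len : Arr → ℕ) (reg : Var → ℕ) (mem : Arr → ℕ → ℕ) : Test → Bool
  | .lt e f => decide (e.eval len reg mem < f.eval len reg mem)
  | .eq e f => decide (e.eval len reg mem = f.eval len reg mem)
  | .not b => !(b.eval len reg mem)
  | .and b c => b.eval len reg mem && c.eval len reg mem

/-- One step of the machine, where `body` gives the programs of the procedures.
A halted machine does not change any more. -/
def step (len : Arr → ℕ) (body : Proc → List Cmd) (c : Config) : Config :=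
  match c.code with
  | [] =>
    match c.stack with
    | [] => c
    | (rest, saved) :: st =>
        { c with code := rest, reg := Function.update saved .res (c.reg .res), stack := st }
  | .assign r e :: rest =>
      { c with code := rest, reg := Function.update c.reg r (e.eval len c.reg c.mem) }
  | .store t e f :: rest =>
      let i := e.eval len c.reg c.mem
      if i < len t then
        { c with
          code := rest
          mem := Function.update c.mem t
            (Function.update (c.mem t) i (f.eval len c.reg c.mem)) }
      else { c with code := rest }
  | .branch b yes no :: rest =>
      { c with code := (if b.eval len c.reg c.mem then yes else no) ++ rest }
  | .loop b cs :: rest =>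
      if b.eval len c.reg c.mem then { c with code := cs ++ .loop b cs :: rest }
      else { c with code := rest }
  | .call f :: rest =>
      { c with code := body f, stack := (rest, c.reg) :: c.stack }
  | .emit e :: rest =>
      { c with code := rest, out := c.out ++ [e.eval len c.reg c.mem] }

/-- The machine has halted. -/
def Config.Halted (c : Config) : Prop := c.code = [] ∧ c.stack = []

/-- The number of words in use: all array cells, and for every active procedure its registers
and its return address. The write-only output tape is not counted. -/
def Config.space (len : Arr → ℕ) (c : Config) : ℕ :=
  (∑ t : Arr, len t) + (c.stack.length + 1) * (Fintype.card Var + 1)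

/-! ### The program -/

section Program

open Var Arr Proc Cmd

/-- Add the vertex `e` to `In`. -/
def push (e : Expr) : List Cmd :=
  [.store ins s e, .store isIn e 1, .assign s (.add s 1)]

/-- Remove from `In` the vertices that were added last, until it has `s₀` vertices. -/
def popTo : List Cmd :=
  [.loop (.lt s₀ s)
    [.assign s (.sub s 1),
     .store isIn (.load ins s) 0]]

/-- Run `visit` for all arcs `a` leaving the vertex `u`, as long as `go` holds. The arcs leaving
`u` form a circular list in which the cell `u` is the anchor. -/
def forArcs (go : Test) (visit : List Cmd) : List Cmd :=
  [.assign a (.load nxt u),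
   .loop (.and (.not (.eq a u)) go)
    (.assign w (.load dst a) :: visit ++ [.assign a (.load nxt a)])]

/-- The test that always holds. -/
def always : Test := .eq 0 0

/-- Look for vertices outside `In` among the neighbours of `ins[i], …, ins[s-1]`,
up to two distinct ones, called `x` and `y`; their number is `cnt`. -/
def findTwo : List Cmd :=
  [.assign cnt 0,
   .loop (.and (.lt i s) (.lt cnt 2))
    (.assign u (.load ins i) ::
     forArcs (.lt cnt 2)
      [.branch (.eq (.load isIn w) 0)
        [.branch (.eq cnt 0)
          [.assign x w, .assign cnt 1]
          [.branch (.eq w x) [] [.assign y w, .assign cnt 2]]]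
        []] ++
     [.assign i (.add i 1)])]

/-- Output the vertices of `In`. -/
def emitIn : List Cmd :=
  [.assign j 0,
   .loop (.lt j s) [.emit (.load ins j), .assign j (.add j 1)]]

/-- Reset `seen` on the first `q` vertices of `queue`. -/
def clearSeen : List Cmd :=
  [.loop (.lt 0 q)
    [.assign q (.sub q 1),
     .store seen (.load queue q) 0]]

/-- For each `w ∈ N(In)` output `In ∪ {w}`. -/
def emitExtensions : List Cmd :=
  [.assign q 0,
   .assign i 0,
   .loop (.lt i s)
    (.assign u (.load ins i) ::
     forArcs always
      [.branch (.and (.eq (.load isIn w) 0) (.eq (.load seen w) 0))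
        ([.store seen w 1, .store queue q w, .assign q (.add q 1)] ++
          emitIn ++ [.emit w])
        []] ++
     [.assign i (.add i 1)])] ++
  clearSeen

/-- Decide by a breadth-first search from `In` that avoids `z` and that stops as soon as it
has found `k` vertices whether `z` is mandatory: `res = 1` if it is, and `res = 0` if it is not. -/
def testMandatory : List Cmd :=
  [.assign q 0,
   .loop (.lt q s)
    [.store queue q (.load ins q),
     .store seen (.load ins q) 1,
     .assign q (.add q 1)],
   .assign p 0,
   .loop (.and (.lt p q) (.lt q k))
    (.assign u (.load queue p) ::
     forArcs (.lt q k)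
      [.branch (.and (.not (.eq w z)) (.eq (.load seen w) 0))
        [.store seen w 1, .store queue q w, .assign q (.add q 1)]
        []] ++
     [.assign p (.add p 1)]),
   .branch (.lt q k) [.assign res 1] [.assign res 0]] ++
  clearSeen

/-- Run `f` for all arcs `b` that enter the vertex `z`. -/
def forTwins (f : List Cmd) : List Cmd :=
  [.assign a (.load nxt z),
   .loop (.not (.eq a z))
    (.assign b (.load twin a) :: f ++ [.assign a (.load nxt a)])]

/-- Delete the vertex `z` from the graph: unlink all arcs that enter `z`. -/
def deleteVertex : List Cmd :=
  forTwins
    [.store nxt (.load prv b) (.load nxt b),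
     .store prv (.load nxt b) (.load prv b)]

/-- Undo the deletion of the vertex `z`. -/
def restoreVertex : List Cmd :=
  forTwins
    [.store nxt (.load prv b) b,
     .store prv (.load nxt b) b]

/-- The two recursive calls with pivot `z`: first with `z` added to `In`, then with `z`
deleted from the graph. -/
def branchOn (f : Proc) : List Cmd :=
  push z ++
  [.call f,
   .assign s (.sub s 1),
   .store isIn z 0] ++
  deleteVertex ++
  [.call f] ++
  restoreVertex

/-- The procedure `ENUM-V`. -/
def enumVBody : List Cmd :=
  [.assign s₀ s, .assign i 0] ++
  findTwo ++
  -- follow the chain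
  [.loop (.and (.eq cnt 1) (.lt (.add s 1) k))
    (.assign i s :: push x ++ findTwo),
   .branch (.eq (.add s 1) k)
    emitExtensions
    (.assign z x :: testMandatory ++
     [.branch (.eq res 1) (.assign z y :: testMandatory) [],
      .branch (.eq res 0)
        (branchOn enumV)
        [.call linEnumV]])] ++
  popTo

/-- Depth-first search from the vertex `w`, with the usual low-point computation. On return `res` is
the number of vertices visited so far, and for a vertex `u` other than the root `cut[u]` is the
number of vertices that cannot be reached from the root without passing through `u` (including
`u` itself). -/
def dfsBody : List Cmd :=
  [.assign u w,
   .store queue res u,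
   .assign res (.add res 1),
   .store disc u res,
   .store low u res,
   .store cut u 1] ++
  forArcs always
    [.branch (.eq (.load disc w) 0)
      [.assign b res,
       .call dfs,
       .branch (.lt (.load low w) (.load low u)) [.store low u (.load low w)] [],
       .branch (.lt (.load low w) (.load disc u)) []
        [.store cut u (.add (.load cut u) (.sub res b))]]
      [.branch (.lt (.load disc w) (.load low u)) [.store low u (.load disc w)] []]]

/-- Compute `cut` and the number `comp` of vertices of the connected component of `In`. A vertex `w`
outside `In` is then mandatory if and only if `comp < cut[w] + k`. -/
def findMandatory : List Cmd :=
  [.assign res 0,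
   .assign w (.load ins 0),
   .call dfs,
   .assign comp res,
   .loop (.lt 0 res)
    [.assign res (.sub res 1),
     .store disc (.load queue res) 0]]

/-- While `N(In)` has a mandatory vertex and `In` has less than `k` vertices, add such a vertex
to `In`. -/
def addMandatory : List Cmd :=
  [.assign i 0,
   .loop (.and (.lt i s) (.lt s k))
    (.assign u (.load ins i) ::
     forArcs (.lt s k)
      [.branch (.and (.eq (.load isIn w) 0) (.lt comp (.add (.load cut w) k)))
        (push w)
        []] ++
     [.assign i (.add i 1)])]

/-- The procedure `LIN-ENUM-V`. -/
def linEnumVBody : List Cmd :=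
  [.branch (.eq s k)
    emitIn
    ([.assign s₀ s] ++
     findMandatory ++
     addMandatory ++
     [.branch (.eq s k)
       emitIn
       (.assign i 0 :: findTwo ++ .assign z x :: branchOn linEnumV)] ++
     popTo)]

/-- The programs of the procedures. -/
def body : Proc → List Cmd
  | .enumV => enumVBody
  | .linEnumV => linEnumVBody
  | .dfs => dfsBody

/-- The main program calls `ENUM-V` with `In = {w}`, where the vertex `w` and the number `k` are
given in registers. -/
def main : List Cmd :=
  [.assign s 0] ++ push w ++ [.call enumV]

end Program

/-! ### The input -/

/-- The number of edges. -/
noncomputable def numEdges {n : ℕ} (G : SimpleGraph (Fin n)) : ℕ := G.edgeSet.ncard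

/-- A graph with `n` vertices and `m` edges in memory, stored by doubly linked adjacency lists in
which the neighbours of a vertex are listed in any order. The cells `0, …, n-1` are the anchors of
the lists of the vertices; the other `2 m` cells are the arcs (edges with a direction) in
any order. The list of a vertex is circular and starts with its anchor. -/
structure AdjLists {n : ℕ} (G : SimpleGraph (Fin n)) where
  /-- The neighbours of a vertex, in the order of its list. -/
  nbrs : Fin n → List (Fin n)
  nodup_nbrs : ∀ u, (nbrs u).Nodup
  mem_nbrs : ∀ u v, v ∈ nbrs u ↔ G.Adj u v
  /-- The cell of the arc from `u` to `v`. -/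
  cell : Fin n → Fin n → ℕ
  le_cell : ∀ u v, G.Adj u v → n ≤ cell u v
  cell_lt : ∀ u v, G.Adj u v → cell u v < n + 2 * numEdges G
  cell_inj : ∀ u v u' v', G.Adj u v → G.Adj u' v' → cell u v = cell u' v' → u = u' ∧ v = v'
  /-- The next cell in the circular list. -/
  nxt : ℕ → ℕ
  /-- The previous cell in the circular list. -/
  prv : ℕ → ℕ
  /-- The end vertex of an arc. -/
  dst : ℕ → ℕ
  /-- The arc in the other direction. -/
  twin : ℕ → ℕ
  nxt_eq : ∀ (u : Fin n) (c : ℕ) (h : c ∈ (u : ℕ) :: (nbrs u).map (cell u)),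
    nxt c = ((u : ℕ) :: (nbrs u).map (cell u)).next c h
  prv_eq : ∀ (u : Fin n) (c : ℕ) (h : c ∈ (u : ℕ) :: (nbrs u).map (cell u)),
    prv c = ((u : ℕ) :: (nbrs u).map (cell u)).prev c h
  dst_eq : ∀ u v, G.Adj u v → dst (cell u v) = v
  twin_eq : ∀ u v, G.Adj u v → twin (cell u v) = cell v u

/-- Every graph can be stored in this way. -/
theorem AdjLists.nonempty {n : ℕ} (G : SimpleGraph (Fin n)) : Nonempty (AdjLists G) := by
  classical
  have hc : Fintype.card G.Dart = 2 * numEdges G := by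
    rw [G.dart_card_eq_twice_card_edges, numEdges, ← SimpleGraph.coe_edgeFinset,
      Set.ncard_coe_finset]
  let e : G.Dart ≃ Fin (2 * numEdges G) := Fintype.equivFinOfCardEq hc
  let cell : Fin n → Fin n → ℕ := fun u v => if h : G.Adj u v then n + e ⟨(u, v), h⟩ else 0
  have hcell : ∀ u v (h : G.Adj u v), cell u v = n + e ⟨(u, v), h⟩ := fun u v h => dif_pos h
  have hinj : ∀ u v u' v', G.Adj u v → G.Adj u' v' → cell u v = cell u' v' →
      u = u' ∧ v = v' := by
    intro u v u' v' h h' hh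
    rw [hcell u v h, hcell u' v' h'] at hh
    have := e.injective (Fin.ext (Nat.add_left_cancel hh))
    simpa using this
  let nbrs : Fin n → List (Fin n) := fun u => (G.neighborFinset u).toList
  have hmem : ∀ u v, v ∈ nbrs u ↔ G.Adj u v := by simp [nbrs]
  let ring : Fin n → List ℕ := fun u => (u : ℕ) :: (nbrs u).map (cell u)
  have hring : ∀ u u' c, c ∈ ring u → c ∈ ring u' → u = u' := by
    intro u u' c h h'
    simp only [ring, List.mem_cons, List.mem_map, hmem] at h h'
    rcases h with h | ⟨v, h, hv⟩ <;> rcases h' with h' | ⟨v', h', hv'⟩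
    · exact Fin.ext (h.symm.trans h')
    · rw [hcell _ _ h'] at hv'; omega
    · rw [hcell _ _ h] at hv; omega
    · exact (hinj _ _ _ _ h h' (hv.trans hv'.symm)).1
  have key : ∀ F : (l : List ℕ) → (c : ℕ) → c ∈ l → ℕ, ∃ f : ℕ → ℕ,
      ∀ (u : Fin n) (c : ℕ) (h : c ∈ ring u), f c = F (ring u) c h := by
    intro F
    refine ⟨fun c => if h : ∃ u, c ∈ ring u then F (ring h.choose) c h.choose_spec else 0, ?_⟩
    intro u c h
    have hex : ∃ u, c ∈ ring u := ⟨u, h⟩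
    have hu : u = hex.choose := hring _ _ _ h hex.choose_spec
    simp only [dif_pos hex]
    congr 1
    rw [← hu]
  have key2 : ∀ g : Fin n → Fin n → ℕ, ∃ f : ℕ → ℕ, ∀ u v, G.Adj u v → f (cell u v) = g u v := by
    intro g
    refine ⟨fun c => if h : ∃ d : G.Dart, cell d.fst d.snd = c then
      g h.choose.fst h.choose.snd else 0, ?_⟩
    intro u v h
    have hex : ∃ d : G.Dart, cell d.fst d.snd = cell u v := ⟨⟨(u, v), h⟩, rfl⟩
    obtain ⟨h1, h2⟩ := hinj _ _ _ _ hex.choose.adj h hex.choose_spec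
    simp only [dif_pos hex]
    rw [h1, h2]
  obtain ⟨nxt, hnxt⟩ := key fun l c h => l.next c h
  obtain ⟨prv, hprv⟩ := key fun l c h => l.prev c h
  obtain ⟨dst, hdst⟩ := key2 fun _ v => v
  obtain ⟨twin, htwin⟩ := key2 fun u v => cell v u
  exact ⟨{
    nbrs, nodup_nbrs := fun u => Finset.nodup_toList _, mem_nbrs := hmem, cell
    le_cell := fun u v h => by rw [hcell u v h]; omega
    cell_lt := fun u v h => by rw [hcell u v h]; omega
    cell_inj := hinj, nxt, prv, dst, twin
    nxt_eq := hnxt, prv_eq := hprv, dst_eq := hdst, twin_eq := htwin }⟩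

/-- The lengths of the arrays for a graph with `n` vertices and `m` edges. -/
def arrLen (n m : ℕ) : Arr → ℕ
  | .nxt | .prv | .dst | .twin => n + 2 * m
  | _ => n

/-- The initial configuration for the input `G`, `v`, `k`: the graph is in memory, `v` and `k` are
in registers, and everything else is zero. -/
def start {n : ℕ} {G : SimpleGraph (Fin n)} (A : AdjLists G) (v : Fin n) (k : ℕ) : Config where
  code := main
  reg
    | .k => k
    | .w => v
    | _ => 0
  stack := []
  mem
    | .nxt => A.nxt
    | .prv => A.prv
    | .dst => A.dst
    | .twin => A.twin
    | _ => fun _ => 0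
  out := []

/-- The configuration after `t` steps of the computation `ENUM-V(G, {v}, k)`. -/
noncomputable def run {n : ℕ} {G : SimpleGraph (Fin n)} (A : AdjLists G) (v : Fin n) (k t : ℕ) :
    Config :=
  (step (arrLen n (numEdges G)) body)^[t] (start A v k)

/-- The output `out` consists of the members of `𝓕`, each of them written exactly once, as a list
of its elements without repetition. -/
def Lists {n : ℕ} (out : List ℕ) (𝓕 : Set (Finset (Fin n))) : Prop :=
  ∃ L : List (List (Fin n)),
    out = L.flatten.map Fin.val ∧
    (∀ l ∈ L, l.Nodup) ∧
    (L.map List.toFinset).Nodup ∧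
    ∀ S, S ∈ L.map List.toFinset ↔ S ∈ 𝓕

end Graphlet

namespace Graphlet

/-! ### Connected sets of vertices -/

set_option linter.unusedSectionVars false

section Combinatorics

variable {V : Type*} [DecidableEq V] {G : SimpleGraph V}

/-! The alive part of the graph is always induced by a vertex set `X`, and a call with current list
`I` has to output `fam G k X I`, the connected `k`-sets between `I` and `X`. Correctness is a
statement about this family. A pivot `z` splits it into the members containing `z` and those
avoiding it (`fam_split`, `fam_disjoint`). Adding an only neighbour or a mandatory vertex does not
change it (`fam_insert_of_unique`, `fam_insert_of_mandatory`).

For the time, `Rich G k X I` says that the component of `I` in `X` has at least `k` vertices, so `z`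
is mandatory exactly when `Rich G k (X.erase z) I` fails. Every call is made in a rich situation,
hence has something to output (`fam_nonempty`). The recursion branches in two ways into nonempty
families, so `N` graphlets allow at most `N - 1` branchings, and it remains to charge `O(k²)` steps
to each of them.

Searches stop early: a scan that looks for two neighbours, or for `k` vertices, reads only `O(k)`
arcs of each list. LIN-ENUM-V is entered only if two neighbours are mandatory, and then the whole
component has at most `2k` vertices (`exists_small_closed`), so that a depth-first search costs
`O(k²)`. In ENUM-V the deletion of the pivot `z` costs its degree, which may be large. Each
neighbour of `z` lies in `I` or in a graphlet containing `I` and `z`, so the degree is at most `k +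
k p`, where `p` counts these graphlets (`card_adj_le`). Thus each graphlet below the first branch
pays `O(k)`. Such a payment occurs at most `k` times per graphlet, since every first branch enlarges
`In` (`enumVTime_split`).

The program is verified with a weakest-precondition calculus `wp` that records steps and stack
depth. Its main uses are `wp_dfs` (low-points count separated vertices), `wp_linEnumV` and
`wp_enumV`. The recursion enlarges `In` or shrinks `X`, so its depth, including the searches, is
linear in `n`. -/

/-- A nonempty set that cannot be cut into two parts without an edge between them. -/
def Conn (G : SimpleGraph V) (S : Finset V) : Prop :=
  S.Nonempty ∧ ∀ T ⊆ S, T.Nonempty → T ≠ S → ∃ a ∈ T, ∃ b ∈ S, b ∉ T ∧ G.Adj a b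

/-- No edge leaves `C` inside `X`. -/
def Closed (G : SimpleGraph V) (X C : Finset V) : Prop :=
  ∀ a ∈ C, ∀ b ∈ X, G.Adj a b → b ∈ C

theorem conn_singleton (v : V) : Conn G {v} := by
  refine ⟨by simp, fun T hT hne hne' => ?_⟩
  rcases Finset.subset_singleton_iff.1 hT with h | h
  · simp [h] at hne
  · exact absurd h hne'

/-- The defining cut property applied to `T ∩ S`, for a set `T` that need not lie in `S`. All later
connectivity arguments go through this trichotomy. -/
theorem Conn.inter_cases {S : Finset V} (hS : Conn G S) (T : Finset V) :
    (∃ a ∈ T, ∃ b ∈ S, b ∉ T ∧ G.Adj a b) ∨ (∀ v ∈ S, v ∉ T) ∨ S ⊆ T := by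
  by_cases h1 : (T ∩ S).Nonempty
  · by_cases h2 : T ∩ S = S
    · exact .inr (.inr (Finset.inter_eq_right.1 h2))
    · obtain ⟨a, ha, b, hb, hbT, hab⟩ := hS.2 (T ∩ S) Finset.inter_subset_right h1 h2
      refine .inl ⟨a, (Finset.mem_inter.1 ha).1, b, hb, fun h => hbT ?_, hab⟩
      exact Finset.mem_inter.2 ⟨h, hb⟩
  · refine .inr (.inl fun v hv hvT => h1 ⟨v, Finset.mem_inter.2 ⟨hvT, hv⟩⟩)

theorem Conn.union_adj {S T : Finset V} (hS : Conn G S) (hT : Conn G T) {a b : V} (ha : a ∈ S)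
    (hb : b ∈ T) (hab : G.Adj a b) : Conn G (S ∪ T) := by
  refine ⟨⟨a, Finset.mem_union_left _ ha⟩, fun U hU hne hne' => ?_⟩
  rcases hS.inter_cases U with ⟨c, hc, d, hd, hdU, hcd⟩ | h1 | h1
  · exact ⟨c, hc, d, Finset.mem_union_left _ hd, hdU, hcd⟩
  · rcases hT.inter_cases U with ⟨c, hc, d, hd, hdU, hcd⟩ | h2 | h2
    · exact ⟨c, hc, d, Finset.mem_union_right _ hd, hdU, hcd⟩
    · obtain ⟨u, hu⟩ := hne
      rcases Finset.mem_union.1 (hU hu) with h | h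
      · exact absurd hu (h1 u h)
      · exact absurd hu (h2 u h)
    · exact ⟨b, h2 hb, a, Finset.mem_union_left _ ha, h1 a ha, hab.symm⟩
  · rcases hT.inter_cases U with ⟨c, hc, d, hd, hdU, hcd⟩ | h2 | h2
    · exact ⟨c, hc, d, Finset.mem_union_right _ hd, hdU, hcd⟩
    · exact ⟨a, h1 ha, b, Finset.mem_union_right _ hb, h2 b hb, hab⟩
    · exact absurd (Finset.Subset.antisymm hU (Finset.union_subset h1 h2)) hne'

theorem Conn.union {S T : Finset V} (hS : Conn G S) (hT : Conn G T) {a : V} (ha : a ∈ S)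
    (hb : a ∈ T) : Conn G (S ∪ T) := by
  refine ⟨⟨a, Finset.mem_union_left _ ha⟩, fun U hU hne hne' => ?_⟩
  rcases hS.inter_cases U with ⟨c, hc, d, hd, hdU, hcd⟩ | h1 | h1
  · exact ⟨c, hc, d, Finset.mem_union_left _ hd, hdU, hcd⟩
  all_goals rcases hT.inter_cases U with ⟨c, hc, d, hd, hdU, hcd⟩ | h2 | h2
  · exact ⟨c, hc, d, Finset.mem_union_right _ hd, hdU, hcd⟩
  · obtain ⟨u, hu⟩ := hne
    rcases Finset.mem_union.1 (hU hu) with h | h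
    · exact absurd hu (h1 u h)
    · exact absurd hu (h2 u h)
  · exact absurd (h2 hb) (h1 a ha)
  · exact ⟨c, hc, d, Finset.mem_union_right _ hd, hdU, hcd⟩
  · exact absurd (h1 ha) (h2 a hb)
  · exact absurd (Finset.Subset.antisymm hU (Finset.union_subset h1 h2)) hne'

theorem Conn.insert_adj {S : Finset V} (hS : Conn G S) {a b : V} (ha : a ∈ S)
    (hab : G.Adj a b) : Conn G (insert b S) := by
  have := hS.union_adj (conn_singleton b) ha (Finset.mem_singleton_self b) hab
  rwa [Finset.union_comm, ← Finset.insert_eq] at this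

/-- A connected set that is strictly larger than `I` has a vertex next to `I`. -/
theorem Conn.exists_adj {I S : Finset V} (hS : Conn G S) (hI : I.Nonempty) (hIS : I ⊆ S)
    (hcard : I.card < S.card) : ∃ a ∈ I, ∃ b ∈ S, b ∉ I ∧ G.Adj a b :=
  hS.2 I hIS hI fun h => by simp [h] at hcard

/-- A connected set meeting `C` could leave it only along an edge, which closedness forbids. Hence a
closed connected set plays the role of a component. -/
theorem Closed.subset {X C I S : Finset V} (hC : Closed G X C) (hI : I.Nonempty) (hIC : I ⊆ C)
    (hS : Conn G S) (hIS : I ⊆ S) (hSX : S ⊆ X) : S ⊆ C := by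
  rcases hS.inter_cases C with ⟨c, hc, d, hd, hdU, hcd⟩ | h | h
  · exact absurd (hC c hc d (hSX hd) hcd) hdU
  · obtain ⟨u, hu⟩ := hI
    exact absurd (hIC hu) (h u (hIS hu))
  · exact h

/-- Inside `X` the connected set `I` lies in a connected set with at least `k` vertices. -/
def Rich (G : SimpleGraph V) (k : ℕ) (X I : Finset V) : Prop :=
  ∃ C, I ⊆ C ∧ C ⊆ X ∧ Conn G C ∧ k ≤ C.card

theorem Rich.of_superset {k : ℕ} {X I J : Finset V} (h : Rich G k X J) (hIJ : I ⊆ J) :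
    Rich G k X I := by
  obtain ⟨C, h1, h2, h3, h4⟩ := h
  exact ⟨C, hIJ.trans h1, h2, h3, h4⟩

/-- Together with `Rich.of_superset` this shows that being mandatory does not depend on how far `In`
has grown. One depth-first search therefore serves a whole round of LIN-ENUM-V. -/
theorem Rich.superset {k : ℕ} {X I J : Finset V} (h : Rich G k X I) (hI : I.Nonempty)
    (hIJ : I ⊆ J) (hJ : Conn G J) (hJX : J ⊆ X) : Rich G k X J := by
  obtain ⟨C, h1, h2, h3, h4⟩ := h
  obtain ⟨u, hu⟩ := hI
  exact ⟨C ∪ J, Finset.subset_union_right, Finset.union_subset h2 hJX,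
    h3.union hJ (h1 hu) (hIJ hu), h4.trans (Finset.card_le_card Finset.subset_union_left)⟩

/-- Links `Rich` with the component: if `C` is the component of `I` in `X`, every connected superset
of `I` inside `X` lies in `C`. -/
theorem rich_iff {k : ℕ} {X I C : Finset V} (hI : I.Nonempty) (hIC : I ⊆ C) (hCX : C ⊆ X)
    (hC : Conn G C) (hcl : Closed G X C) : Rich G k X I ↔ k ≤ C.card := by
  constructor
  · rintro ⟨S, h1, h2, h3, h4⟩
    exact h4.trans (Finset.card_le_card (hcl.subset hI hIC h3 h1 h2))
  · exact fun h => ⟨C, hIC, hCX, hC, h⟩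

/-- A connected set between `I` and `X` of maximal size is closed, since an outgoing edge would
enlarge it. -/
theorem exists_closed {X I : Finset V} (hI : Conn G I) (hIX : I ⊆ X) :
    ∃ C, I ⊆ C ∧ C ⊆ X ∧ Conn G C ∧ Closed G X C := by
  classical
  obtain ⟨C, hC, hmax⟩ := Finset.exists_max_image
    (X.powerset.filter fun C => I ⊆ C ∧ Conn G C) Finset.card
    ⟨I, by simp [hIX, hI]⟩
  simp only [Finset.mem_filter, Finset.mem_powerset] at hC hmax
  refine ⟨C, hC.2.1, hC.1, hC.2.2, fun a ha b hb hab => ?_⟩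
  by_contra hbC
  have := hmax (insert b C) ⟨Finset.insert_subset hb hC.1,
    hC.2.1.trans (Finset.subset_insert _ _), hC.2.2.insert_adj ha hab⟩
  rw [Finset.card_insert_of_notMem hbC] at this
  omega

/-- If two neighbours of `I` are both mandatory, then the component of `I` is small. -/
theorem exists_small_closed {k : ℕ} {X I : Finset V} (hI : Conn G I) (hIX : I ⊆ X) {x y : V}
    (hxy : x ≠ y) (hxI : x ∉ I) (hyI : y ∉ I) (hxX : x ∈ X) (hyX : y ∈ X)
    (hx : ∃ a ∈ I, G.Adj a x) (hy : ∃ a ∈ I, G.Adj a y)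
    (hxm : ¬ Rich G k (X.erase x) I) (hym : ¬ Rich G k (X.erase y) I) :
    ∃ C, I ⊆ C ∧ C ⊆ X ∧ Closed G X C ∧ C.card ≤ 2 * k := by
  have hne := hI.1
  have h1 : I ⊆ X.erase x := fun v hv =>
    Finset.mem_erase.2 ⟨fun h => hxI (h ▸ hv), hIX hv⟩
  have h2 : I ⊆ X.erase y := fun v hv =>
    Finset.mem_erase.2 ⟨fun h => hyI (h ▸ hv), hIX hv⟩
  obtain ⟨C, a1, a2, a3, a4⟩ := exists_closed hI h1
  obtain ⟨D, b1, b2, b3, b4⟩ := exists_closed hI h2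
  rw [rich_iff hne a1 a2 a3 a4] at hxm
  rw [rich_iff hne b1 b2 b3 b4] at hym
  -- The only exit from `C` is `x`, and the only exit from `D` is `y`. As `y ∈ C` and `x ∈ D`, the
  -- union has no exit at all.
  have hyC : y ∈ C := by
    obtain ⟨a, ha, hay⟩ := hy
    exact a4 a (a1 ha) y (Finset.mem_erase.2 ⟨hxy.symm, hyX⟩) hay
  have hxD : x ∈ D := by
    obtain ⟨a, ha, hax⟩ := hx
    exact b4 a (b1 ha) x (Finset.mem_erase.2 ⟨hxy, hxX⟩) hax
  refine ⟨C ∪ D, a1.trans Finset.subset_union_left, Finset.union_subset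
    (a2.trans (Finset.erase_subset _ _)) (b2.trans (Finset.erase_subset _ _)), ?_, ?_⟩
  · intro a ha b hb hab
    rcases Finset.mem_union.1 ha with h | h
    · by_cases hbx : b = x
      · exact Finset.mem_union_right _ (hbx ▸ hxD)
      · exact Finset.mem_union_left _ (a4 a h b (Finset.mem_erase.2 ⟨hbx, hb⟩) hab)
    · by_cases hby : b = y
      · exact Finset.mem_union_left _ (hby ▸ hyC)
      · exact Finset.mem_union_right _ (b4 a h b (Finset.mem_erase.2 ⟨hby, hb⟩) hab)
  · have := Finset.card_union_le C D
    omega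

/-! ### The family of graphlets that extend `I` inside `X` -/

open scoped Classical in
/-- The connected `k`-sets between `I` and `X`. -/
noncomputable def fam (G : SimpleGraph V) (k : ℕ) (X I : Finset V) : Finset (Finset V) :=
  X.powerset.filter fun S => I ⊆ S ∧ S.card = k ∧ Conn G S

theorem mem_fam {k : ℕ} {X I S : Finset V} :
    S ∈ fam G k X I ↔ S ⊆ X ∧ I ⊆ S ∧ S.card = k ∧ Conn G S := by
  simp [fam]

/-- Inside the large connected set, `I` can be enlarged by one adjacent vertex at a time until it
has `k` vertices. This is why no call is fruitless. -/
theorem fam_nonempty {k : ℕ} {X I : Finset V} (hI : Conn G I) (hk : I.card ≤ k)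
    (h : Rich G k X I) : (fam G k X I).Nonempty := by
  obtain ⟨C, h1, h2, h3, h4⟩ := h
  obtain ⟨j, hj⟩ := Nat.exists_eq_add_of_le hk
  induction j generalizing I with
  | zero => exact ⟨I, mem_fam.2 ⟨h1.trans h2, Finset.Subset.refl _, by omega, hI⟩⟩
  | succ j ih =>
    obtain ⟨a, ha, b, hb, hbI, hab⟩ := h3.exists_adj hI.1 h1 (by omega)
    have hc := Finset.card_insert_of_notMem hbI
    obtain ⟨S, hS⟩ := ih (hI.insert_adj ha hab) (by omega)
      (Finset.insert_subset hb h1) (by omega)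
    rw [mem_fam] at hS
    exact ⟨S, mem_fam.2 ⟨hS.1, (Finset.subset_insert _ _).trans hS.2.1, hS.2.2⟩⟩

/-- The combinatorial content of the two recursive calls: a member contains the pivot or survives
its deletion. -/
theorem fam_split {k : ℕ} {X I : Finset V} {z : V} :
    fam G k X I = fam G k X (insert z I) ∪ fam G k (X.erase z) I := by
  ext S
  simp only [Finset.mem_union, mem_fam, Finset.insert_subset_iff, Finset.subset_erase]
  tauto

theorem fam_disjoint {k : ℕ} {X I : Finset V} {z : V} :
    Disjoint (fam G k X (insert z I)) (fam G k (X.erase z) I) := by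
  rw [Finset.disjoint_left]
  intro S
  simp only [mem_fam, Finset.insert_subset_iff, Finset.subset_erase]
  tauto

theorem fam_insert_of_forall {k : ℕ} {X I : Finset V} {z : V}
    (h : ∀ S ∈ fam G k X I, z ∈ S) : fam G k X (insert z I) = fam G k X I := by
  ext S
  constructor
  · simp only [mem_fam, Finset.insert_subset_iff]; tauto
  · intro hS
    have := h S hS
    revert hS
    simp only [mem_fam, Finset.insert_subset_iff]; tauto

/-- A connected set larger than `I` must leave `I` through its only neighbour. This justifies
following the chain in ENUM-V. -/
theorem fam_insert_of_unique {k : ℕ} {X I : Finset V} {z : V} (hI : I.Nonempty) (hk : I.card < k)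
    (h : ∀ a ∈ I, ∀ b ∈ X, b ∉ I → G.Adj a b → b = z) :
    fam G k X (insert z I) = fam G k X I := by
  refine fam_insert_of_forall fun S hS => ?_
  rw [mem_fam] at hS
  obtain ⟨a, ha, b, hb, hbI, hab⟩ := hS.2.2.2.exists_adj hI hS.2.1 (by omega)
  exact h a ha b (hS.1 hb) hbI hab ▸ hb

/-- A member avoiding `z` would itself witness richness after the deletion of `z`. -/
theorem fam_insert_of_mandatory {k : ℕ} {X I : Finset V} {z : V}
    (h : ¬ Rich G k (X.erase z) I) :
    fam G k X (insert z I) = fam G k X I := by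
  refine fam_insert_of_forall fun S hS => ?_
  by_contra hz
  rw [mem_fam] at hS
  exact h ⟨S, hS.2.1, Finset.subset_erase.2 ⟨hS.1, hz⟩, hS.2.2.2, hS.2.2.1.ge⟩

theorem fam_of_card_eq {k : ℕ} {X I : Finset V} (hI : Conn G I) (hIX : I ⊆ X) (hk : I.card = k) :
    fam G k X I = {I} := by
  ext S
  rw [mem_fam, Finset.mem_singleton]
  constructor
  · rintro ⟨-, h2, h3, -⟩
    exact (Finset.eq_of_subset_of_card_le h2 (by omega)).symm
  · rintro rfl
    exact ⟨hIX, Finset.Subset.refl _, hk, hI⟩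

theorem mem_fam_of_card_succ {k : ℕ} {X I S : Finset V} (hI : Conn G I) (hIX : I ⊆ X)
    (hk : I.card + 1 = k) :
    S ∈ fam G k X I ↔ ∃ b ∈ X, b ∉ I ∧ (∃ a ∈ I, G.Adj a b) ∧ insert b I = S := by
  rw [mem_fam]
  constructor
  · rintro ⟨h1, h2, h3, h4⟩
    obtain ⟨a, ha, b, hb, hbI, hab⟩ := h4.exists_adj hI.1 h2 (by omega)
    refine ⟨b, h1 hb, hbI, ⟨a, ha, hab⟩, ?_⟩
    refine Finset.eq_of_subset_of_card_le (Finset.insert_subset hb h2) ?_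
    rw [Finset.card_insert_of_notMem hbI]; omega
  · rintro ⟨b, hb, hbI, ⟨a, ha, hab⟩, rfl⟩
    exact ⟨Finset.insert_subset hb hIX, Finset.subset_insert _ _, by
      rw [Finset.card_insert_of_notMem hbI]; omega, hI.insert_adj ha hab⟩

/-- A vertex of `I` of large degree forces many graphlets. -/
theorem card_adj_le {k : ℕ} {X I D : Finset V} {z : V} (hz : z ∈ I) (hI : Conn G I)
    (hIX : I ⊆ X) (hk : I.card < k) (h : Rich G k X I) (hD : ∀ w ∈ D, w ∈ X ∧ G.Adj z w) :
    D.card ≤ k + k * (fam G k X I).card := by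
  -- A neighbour `w` of `z` outside `I` gives the connected set `insert w I`, which extends to a
  -- member of the family. Each member covers only `k` vertices, so many neighbours need many
  -- members.
  have hsub : D ⊆ I ∪ (fam G k X I).biUnion id := by
    intro w hw
    by_cases hwI : w ∈ I
    · exact Finset.mem_union_left _ hwI
    · refine Finset.mem_union_right _ (Finset.mem_biUnion.2 ?_)
      have hc := hI.insert_adj hz (hD w hw).2
      have hs : insert w I ⊆ X := Finset.insert_subset (hD w hw).1 hIX
      obtain ⟨S, hS⟩ := fam_nonempty (k := k) hc
        (by rw [Finset.card_insert_of_notMem hwI]; omega)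
        (h.superset ⟨z, hz⟩ (Finset.subset_insert _ _) hc hs)
      rw [mem_fam] at hS
      exact ⟨S, mem_fam.2 ⟨hS.1, (Finset.subset_insert _ _).trans hS.2.1, hS.2.2⟩,
        hS.2.1 (Finset.mem_insert_self _ _)⟩
  have h1 := Finset.card_le_card hsub
  have h2 := Finset.card_union_le I ((fam G k X I).biUnion id)
  have h3 : ((fam G k X I).biUnion id).card ≤ (fam G k X I).card * k :=
    Finset.card_biUnion_le_card_mul _ _ _ fun S hS => (mem_fam.1 hS).2.2.1.le
  rw [Nat.mul_comm] at h3
  omega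

end Combinatorics

/-! ### Comparison with connectedness and components in Mathlib. -/

/-- If no cut is empty, the set reached from a base point must be everything. Conversely, a walk
from inside `T` to outside crosses its boundary. -/
theorem conn_iff_connected {n : ℕ} {G : SimpleGraph (Fin n)} {S : Finset (Fin n)} :
    Conn G S ↔ (G.induce (S : Set (Fin n))).Connected := by
  constructor
  · intro h
    obtain ⟨r, hr⟩ := h.1
    rw [SimpleGraph.connected_iff_exists_forall_reachable]
    refine ⟨⟨r, hr⟩, ?_⟩
    classical
    let T : Finset (Fin n) := S.filter fun v =>
      ∃ hv : v ∈ S, (G.induce (S : Set (Fin n))).Reachable ⟨r, hr⟩ ⟨v, hv⟩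
    have hrT : r ∈ T := Finset.mem_filter.2 ⟨hr, hr, SimpleGraph.Reachable.refl _⟩
    by_cases hT : T = S
    · rintro ⟨v, hv⟩
      have hvT : v ∈ T := by rw [hT]; exact hv
      exact (Finset.mem_filter.1 hvT).2.2
    · obtain ⟨a, ha, b, hb, hbT, hab⟩ := h.2 T (Finset.filter_subset _ _) ⟨r, hrT⟩ hT
      obtain ⟨haS, ha', hreach⟩ := Finset.mem_filter.1 ha
      refine absurd (Finset.mem_filter.2 ⟨hb, hb, hreach.trans ?_⟩) hbT
      exact SimpleGraph.Adj.reachable (by simpa using hab)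
  · intro h
    obtain ⟨⟨r, hr⟩⟩ := h.nonempty
    refine ⟨⟨r, hr⟩, fun T hT hne hne' => ?_⟩
    obtain ⟨t, ht⟩ := hne
    obtain ⟨b, hb, hbT⟩ : ∃ b ∈ S, b ∉ T := by
      by_contra hcon
      push Not at hcon
      exact hne' (Finset.Subset.antisymm hT hcon)
    obtain ⟨p⟩ := h.preconnected ⟨t, hT ht⟩ ⟨b, hb⟩
    obtain ⟨d, -, hd1, hd2⟩ := p.exists_boundary_dart {v | (v : Fin n) ∈ T} ht hbT
    exact ⟨d.fst, hd1, d.snd, d.snd.2, hd2, by simpa using d.adj⟩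

theorem graphletsAt_eq_fam {n : ℕ} (G : SimpleGraph (Fin n)) (k : ℕ) (v : Fin n) :
    graphletsAt G k v = (fam G k Finset.univ {v} : Set (Finset (Fin n))) := by
  ext S
  simp only [graphletsAt, IsGraphlet, Set.mem_ofPred_eq, Finset.mem_coe, mem_fam,
    ← conn_iff_connected, Finset.singleton_subset_iff, Finset.subset_univ, true_and]
  tauto

theorem rich_of_le_component {n : ℕ} {G : SimpleGraph (Fin n)} {k : ℕ} {v : Fin n}
    (h : k ≤ (G.connectedComponentMk v).supp.ncard) : Rich G k Finset.univ {v} := by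
  classical
  let C := G.connectedComponentMk v
  refine ⟨C.supp.toFinset, by simp [C], Finset.subset_univ _, ?_, ?_⟩
  · rw [conn_iff_connected, Set.coe_toFinset]
    exact C.connected_toSimpleGraph
  · rwa [Set.ncard_eq_toFinset_card'] at h

end Graphlet


namespace Graphlet

/-! ### A program logic with time and stack depth -/

/-- The part of a configuration that the code of a procedure can see, with a clock. -/
structure St where
  reg : Var → ℕ
  mem : Arr → ℕ → ℕ
  out : List ℕ
  time : ℕ

namespace St

def set (σ : St) (r : Var) (v : ℕ) : St :=
  ⟨Function.update σ.reg r v, σ.mem, σ.out, σ.time + 1⟩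

def put (σ : St) (t : Arr) (i v : ℕ) : St :=
  ⟨σ.reg, Function.update σ.mem t (Function.update (σ.mem t) i v), σ.out, σ.time + 1⟩

def tick (σ : St) : St := ⟨σ.reg, σ.mem, σ.out, σ.time + 1⟩

def print (σ : St) (v : ℕ) : St := ⟨σ.reg, σ.mem, σ.out ++ [v], σ.time + 1⟩

/-- The state after the return from a procedure called in the state `σ` and left in `τ`. -/
def ret (σ τ : St) : St := ⟨Function.update σ.reg .res (τ.reg .res), τ.mem, τ.out, τ.time + 1⟩

variable (σ τ : St) (r r' : Var) (t t' : Arr) (i j v : ℕ)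

@[simp] theorem set_reg : (σ.set r v).reg r' = if r' = r then v else σ.reg r' := by
  simp [set, Function.update_apply]
@[simp] theorem set_mem : (σ.set r v).mem = σ.mem := rfl
@[simp] theorem set_out : (σ.set r v).out = σ.out := rfl
@[simp] theorem set_time : (σ.set r v).time = σ.time + 1 := rfl
@[simp] theorem put_reg : (σ.put t i v).reg = σ.reg := rfl
@[simp] theorem put_mem : (σ.put t i v).mem t' =
    if t' = t then Function.update (σ.mem t) i v else σ.mem t' := by
  simp [put, Function.update_apply]
@[simp] theorem put_out : (σ.put t i v).out = σ.out := rfl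
@[simp] theorem put_time : (σ.put t i v).time = σ.time + 1 := rfl
@[simp] theorem tick_reg : σ.tick.reg = σ.reg := rfl
@[simp] theorem tick_mem : σ.tick.mem = σ.mem := rfl
@[simp] theorem tick_out : σ.tick.out = σ.out := rfl
@[simp] theorem tick_time : σ.tick.time = σ.time + 1 := rfl
@[simp] theorem print_reg : (σ.print v).reg = σ.reg := rfl
@[simp] theorem print_mem : (σ.print v).mem = σ.mem := rfl
@[simp] theorem print_out : (σ.print v).out = σ.out ++ [v] := rfl
@[simp] theorem print_time : (σ.print v).time = σ.time + 1 := rfl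
@[simp] theorem ret_reg : (σ.ret τ).reg r = if r = .res then τ.reg .res else σ.reg r := by
  simp [ret, Function.update_apply]
@[simp] theorem ret_mem : (σ.ret τ).mem = τ.mem := rfl
@[simp] theorem ret_out : (σ.ret τ).out = τ.out := rfl
@[simp] theorem ret_time : (σ.ret τ).time = τ.time + 1 := rfl

/-- The configuration with the given code and stack. -/
def toConfig (σ : St) (cs : List Cmd) (st : List (List Cmd × (Var → ℕ))) : Config :=
  ⟨cs, σ.reg, st, σ.mem, σ.out⟩

end St

section Logic

variable {len : Arr → ℕ}

/-- Started in the state `σ`, the commands `cs` terminate in a state with the property `Q`, and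
meanwhile the stack grows by at most `D` entries. -/
def wp (len : Arr → ℕ) (D : ℕ) (cs : List Cmd) (Q : St → Prop) (σ : St) : Prop :=
  ∃ τ t, Q τ ∧ τ.time = σ.time + t ∧ ∀ rest st,
    (step len body)^[t] (σ.toConfig (cs ++ rest) st) = τ.toConfig rest st ∧
    ∀ t' ≤ t, ((step len body)^[t'] (σ.toConfig (cs ++ rest) st)).stack.length ≤ st.length + D

theorem wp_nil {D : ℕ} {Q : St → Prop} {σ : St} (h : Q σ) : wp len D [] Q σ :=
  ⟨σ, 0, h, rfl, fun rest st => ⟨rfl, fun t' ht' => by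
    obtain rfl : t' = 0 := by omega
    simp [St.toConfig]⟩⟩

/-- The forward direction makes this an equivalence by which `simp` can finish a symbolic execution.
It holds because the run in `wp` may not depend on the continuation. -/
theorem wp_nil_iff {D : ℕ} {Q : St → Prop} {σ : St} : wp len D [] Q σ ↔ Q σ := by
  refine ⟨?_, wp_nil⟩
  rintro ⟨τ, t, hQ, ht, h⟩
  have h1 := (h [] []).1
  have hfix : ∀ t, (step len body)^[t] (σ.toConfig [] []) = σ.toConfig [] [] := by
    intro t
    exact Function.iterate_fixed rfl t
  -- With an empty continuation the machine is stuck, which identifies the two states but not the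
  -- clocks. A continuation that makes a step forces `t = 0`.
  have h2 := (h [.emit 0] []).1
  rw [List.append_nil, hfix] at h1
  rcases t with _ | _ | t
  · obtain ⟨r, m, o, tm⟩ := τ
    obtain ⟨r', m', o', tm'⟩ := σ
    simp only [St.toConfig, Config.mk.injEq] at h1
    simp only [Nat.add_zero] at ht
    obtain ⟨-, rfl, -, rfl, rfl⟩ := h1
    subst ht
    exact hQ
  · have := congrArg Config.code h2
    simp [St.toConfig, step] at this
  · have h3 : (step len body)^[t + 1 + 1] (σ.toConfig ([] ++ [.emit 0]) []) =
        (σ.print 0).toConfig [] [] := by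
      rw [Function.iterate_succ_apply]
      exact Function.iterate_fixed rfl _
    have := congrArg Config.code (h3.symm.trans h2)
    simp [St.toConfig] at this

theorem wp_mono {D D' : ℕ} {cs : List Cmd} {Q Q' : St → Prop} {σ : St} (h : wp len D cs Q σ)
    (hQ : ∀ τ, Q τ → Q' τ) (hD : D ≤ D') : wp len D' cs Q' σ := by
  obtain ⟨τ, t, hτ, ht, h⟩ := h
  exact ⟨τ, t, hQ τ hτ, ht, fun rest st =>
    ⟨(h rest st).1, fun t' ht' => ((h rest st).2 t' ht').trans (by omega)⟩⟩

theorem wp_post {D : ℕ} {cs : List Cmd} {Q Q' : St → Prop} {σ : St} (h : wp len D cs Q σ)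
    (hQ : ∀ τ, Q τ → Q' τ) : wp len D cs Q' σ := wp_mono h hQ le_rfl

theorem wp_append {D : ℕ} {cs cs' : List Cmd} {Q : St → Prop} {σ : St}
    (h : wp len D cs (wp len D cs' Q) σ) : wp len D (cs ++ cs') Q σ := by
  obtain ⟨τ, t, ⟨τ', u, hQ, hu, h'⟩, ht, h⟩ := h
  refine ⟨τ', t + u, hQ, by omega, fun rest st => ?_⟩
  obtain ⟨h1, h2⟩ := h (cs' ++ rest) st
  obtain ⟨h3, h4⟩ := h' rest st
  rw [List.append_assoc]
  refine ⟨by rw [Nat.add_comm, Function.iterate_add_apply, h1, h3], fun t' ht' => ?_⟩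
  rcases Nat.le_total t' t with hle | hle
  · exact h2 t' hle
  · obtain ⟨s, rfl⟩ := Nat.exists_eq_add_of_le hle
    rw [Nat.add_comm, Function.iterate_add_apply, h1]
    exact h4 s (by omega)

/-- The rule of the sequence: the first part has the postcondition `P`. -/
theorem wp_seq {D : ℕ} {cs cs' : List Cmd} {P Q : St → Prop} {σ : St} (h : wp len D cs P σ)
    (hQ : ∀ τ, P τ → wp len D cs' Q τ) : wp len D (cs ++ cs') Q σ :=
  wp_append (wp_post h hQ)

/-- Source of the rules for single commands. In the forward direction a run of zero steps is
impossible, as it would leave the command `c` in the code. -/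
theorem wp_step {D : ℕ} {c : Cmd} {cs cs' : List Cmd} {Q : St → Prop} {σ σ' : St}
    (htime : σ'.time = σ.time + 1)
    (hstep : ∀ rest st, step len body (σ.toConfig (c :: cs ++ rest) st) =
      σ'.toConfig (cs' ++ rest) st) :
    wp len D (c :: cs) Q σ ↔ wp len D cs' Q σ' := by
  constructor
  · rintro ⟨τ, t, hQ, ht, h⟩
    obtain _ | t := t
    · have := congrArg Config.code (h [] []).1
      simp [St.toConfig] at this
    · refine ⟨τ, t, hQ, by omega, fun rest st => ?_⟩
      obtain ⟨h1, h2⟩ := h rest st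
      rw [Function.iterate_succ_apply, hstep] at h1
      refine ⟨h1, fun t' ht' => ?_⟩
      have := h2 (t' + 1) (by omega)
      rwa [Function.iterate_succ_apply, hstep] at this
  · rintro ⟨τ, t, hQ, ht, h⟩
    refine ⟨τ, t + 1, hQ, by omega, fun rest st => ?_⟩
    obtain ⟨h1, h2⟩ := h rest st
    refine ⟨by rw [Function.iterate_succ_apply, hstep, h1], fun t' ht' => ?_⟩
    obtain _ | t' := t'
    · simp [St.toConfig]
    · rw [Function.iterate_succ_apply, hstep]
      exact h2 t' (by omega)

/-- The value of an expression in a state. -/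
def St.val (σ : St) (len : Arr → ℕ) (e : Expr) : ℕ := e.eval len σ.reg σ.mem

/-- The value of a test in a state. -/
def St.test (σ : St) (len : Arr → ℕ) (b : Test) : Bool := b.eval len σ.reg σ.mem

/-! ### Symbolic evaluation of expressions and tests. -/

section Eval

variable (σ : St)

@[simp] theorem val_lit (c : ℕ) : σ.val len (.lit c) = c := rfl
@[simp] theorem val_zero : σ.val len (0 : Expr) = 0 := rfl
@[simp] theorem val_one : σ.val len (1 : Expr) = 1 := rfl
@[simp] theorem val_two : σ.val len (2 : Expr) = 2 := rfl
@[simp] theorem val_var (r : Var) : σ.val len (.var r) = σ.reg r := rfl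
@[simp] theorem val_load (t : Arr) (e : Expr) : σ.val len (.load t e) =
    if σ.val len e < len t then σ.mem t (σ.val len e) else 0 := rfl
@[simp] theorem val_add (e f : Expr) : σ.val len (.add e f) = σ.val len e + σ.val len f := rfl
@[simp] theorem val_sub (e f : Expr) : σ.val len (.sub e f) = σ.val len e - σ.val len f := rfl
@[simp] theorem test_lt (e f : Expr) :
    σ.test len (.lt e f) = true ↔ σ.val len e < σ.val len f := by
  simp [St.test, Test.eval, St.val]
@[simp] theorem test_eq (e f : Expr) :
    σ.test len (.eq e f) = true ↔ σ.val len e = σ.val len f := by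
  simp [St.test, Test.eval, St.val]
@[simp] theorem test_not (b : Test) : σ.test len (.not b) = true ↔ ¬ σ.test len b = true := by
  simp [St.test, Test.eval]
@[simp] theorem test_and (b c : Test) :
    σ.test len (.and b c) = true ↔ σ.test len b = true ∧ σ.test len c = true := by
  simp [St.test, Test.eval]
@[simp] theorem test_always : σ.test len always = true := by
  simp [always]

end Eval

/-! ### Rules for the commands. -/

variable {D : ℕ} {cs yes no : List Cmd} {Q : St → Prop} {σ : St}

@[simp] theorem wp_assign {r : Var} {e : Expr} :
    wp len D (.assign r e :: cs) Q σ ↔ wp len D cs Q (σ.set r (σ.val len e)) :=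
  wp_step rfl fun _ _ => rfl

@[simp] theorem wp_store {t : Arr} {e f : Expr} :
    wp len D (.store t e f :: cs) Q σ ↔
      wp len D cs Q (if σ.val len e < len t then σ.put t (σ.val len e) (σ.val len f)
        else σ.tick) := by
  refine wp_step ?_ fun rest st => ?_
  · split_ifs <;> rfl
  · by_cases h : e.eval len σ.reg σ.mem < len t <;>
      simp [St.toConfig, step, St.val, h, St.put, St.tick]

@[simp] theorem wp_branch {b : Test} :
    wp len D (.branch b yes no :: cs) Q σ ↔
      wp len D ((if σ.test len b = true then yes else no) ++ cs) Q σ.tick := by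
  refine wp_step rfl fun rest st => ?_
  by_cases h : b.eval len σ.reg σ.mem = true <;> simp [St.toConfig, step, St.test, h, St.tick]

/-- Unlike the other command rules this is no `simp` lemma, since rewriting with it would unroll
loops without end. -/
theorem wp_loop_iff {b : Test} {bd : List Cmd} :
    wp len D (.loop b bd :: cs) Q σ ↔
      wp len D (if σ.test len b = true then bd ++ .loop b bd :: cs else cs) Q σ.tick := by
  refine wp_step rfl fun rest st => ?_
  by_cases h : b.eval len σ.reg σ.mem = true <;> simp [St.toConfig, step, St.test, h, St.tick]

@[simp] theorem wp_emit {e : Expr} :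
    wp len D (.emit e :: cs) Q σ ↔ wp len D cs Q (σ.print (σ.val len e)) :=
  wp_step rfl fun _ _ => rfl

/-- The body is run with an empty continuation on top of the pushed frame. The frame accounts for
the `1` in `D + 1`, and the call and the return take one step each (`tick` and `ret`). -/
theorem wp_call {f : Proc} {P : St → Prop} (h : wp len D (body f) P σ.tick)
    (hQ : ∀ τ, P τ → wp len (D + 1) cs Q (σ.ret τ)) :
    wp len (D + 1) (.call f :: cs) Q σ := by
  obtain ⟨τ, t, hP, ht, h⟩ := h
  obtain ⟨τ', u, hQ, hu, h'⟩ := hQ τ hP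
  simp only [St.tick_time, St.ret_time] at ht hu
  refine ⟨τ', u + 1 + (t + 1), hQ, by omega, fun rest st => ?_⟩
  obtain ⟨h1, h2⟩ := h [] ((cs ++ rest, σ.reg) :: st)
  obtain ⟨h3, h4⟩ := h' rest st
  rw [List.append_nil] at h1 h2
  have e1 : step len body (σ.toConfig (.call f :: cs ++ rest) st) =
    σ.tick.toConfig (body f) ((cs ++ rest, σ.reg) :: st) := rfl
  have e2 : step len body (τ.toConfig [] ((cs ++ rest, σ.reg) :: st)) =
    (σ.ret τ).toConfig (cs ++ rest) st := rfl
  refine ⟨?_, fun t' ht' => ?_⟩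
  · rw [Function.iterate_add_apply, Function.iterate_succ_apply _ t, e1, h1,
      Function.iterate_succ_apply, e2, h3]
  · obtain _ | t' := t'
    · simp [St.toConfig]
    · rw [Function.iterate_succ_apply, e1]
      rcases Nat.le_total t' t with hle | hle
      · have := h2 t' hle
        simp only [List.length_cons] at this
        omega
      · obtain ⟨s, rfl⟩ := Nat.exists_eq_add_of_le hle
        rw [Nat.add_comm, Function.iterate_add_apply, h1]
        obtain _ | s := s
        · simp [St.toConfig]
        · rw [Function.iterate_succ_apply, e2]
          exact h4 s (by omega)

/-- The rule of the loop, with an invariant and a variant. -/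
theorem wp_loop {b : Test} {bd : List Cmd} (Inv : ℕ → St → Prop) {m : ℕ} (h0 : Inv m σ)
    (hstep : ∀ m τ, Inv m τ → τ.test len b = true →
      wp len D bd (fun τ' => ∃ m' < m, Inv m' τ') τ.tick)
    (hexit : ∀ m τ, Inv m τ → ¬ τ.test len b = true → wp len D cs Q τ.tick) :
    wp len D (.loop b bd :: cs) Q σ := by
  induction m using Nat.strong_induction_on generalizing σ with
  | _ m ih =>
    rw [wp_loop_iff]
    split_ifs with hb
    · exact wp_seq (hstep m σ h0 hb) fun τ ⟨m', hm, hτ⟩ => ih m' hm hτ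
    · exact hexit m σ h0 hb

end Logic

end Graphlet


namespace Graphlet

/-! ### Adjacency lists of the alive part of the graph -/

section Arcs

variable {n : ℕ} {G : SimpleGraph (Fin n)}

/-- The neighbours of `u` in `X`, in the order of its adjacency list. -/
def arcs (A : AdjLists G) (X : Finset (Fin n)) (u : Fin n) : List (Fin n) :=
  (A.nbrs u).filter (· ∈ X)

theorem nodup_arcs (A : AdjLists G) (X : Finset (Fin n)) (u : Fin n) : (arcs A X u).Nodup :=
  (A.nodup_nbrs u).filter _

theorem mem_arcs {A : AdjLists G} {X : Finset (Fin n)} {u v : Fin n} :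
    v ∈ arcs A X u ↔ v ∈ X ∧ G.Adj u v := by
  simp [arcs, A.mem_nbrs, and_comm]

/-- The circular list of the cells of `u` in the graph induced by `X`. -/
def ring (A : AdjLists G) (X : Finset (Fin n)) (u : Fin n) : List ℕ :=
  (u : ℕ) :: (arcs A X u).map (A.cell u)

theorem mem_ring {A : AdjLists G} {X : Finset (Fin n)} {u : Fin n} {c : ℕ} :
    c ∈ ring A X u ↔ c = u ∨ ∃ v ∈ X, G.Adj u v ∧ A.cell u v = c := by
  simp [ring, mem_arcs, and_assoc]

/-- Anchors are below `n`, arc cells are not, and an arc cell determines its source. So a cell lies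
in one list only, and edits of different lists do not interfere. -/
theorem ring_inj {A : AdjLists G} {X : Finset (Fin n)} {u w : Fin n} {c : ℕ}
    (hu : c ∈ ring A X u) (hw : c ∈ ring A X w) : u = w := by
  rw [mem_ring] at hu hw
  rcases hu with hu | ⟨v, -, hv, hu⟩ <;> rcases hw with hw | ⟨v', -, hv', hw⟩
  · exact Fin.ext (hu.symm.trans hw)
  · have := A.le_cell _ _ hv'
    omega
  · have := A.le_cell _ _ hv
    omega
  · exact (A.cell_inj _ _ _ _ hv hv' (hu.trans hw.symm)).1

theorem nodup_ring (A : AdjLists G) (X : Finset (Fin n)) (u : Fin n) : (ring A X u).Nodup := by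
  rw [ring, List.nodup_cons]
  constructor
  · simp only [List.mem_map, mem_arcs, not_exists, not_and]
    intro v hv h
    have := A.le_cell _ _ hv.2
    omega
  · refine List.Nodup.map_on (fun v hv w hw h => ?_) (nodup_arcs A X u)
    exact (A.cell_inj _ _ _ _ (mem_arcs.1 hv).2 (mem_arcs.1 hw).2 h).2

theorem ring_lt {A : AdjLists G} {X : Finset (Fin n)} {u : Fin n} {c : ℕ} (h : c ∈ ring A X u) :
    c < n + 2 * numEdges G := by
  rcases mem_ring.1 h with h | ⟨v, -, hv, h⟩
  · omega
  · exact h ▸ A.cell_lt _ _ hv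

/-- `nx` and `pv` link the circular lists of the vertices of the graph induced by `X`. -/
def Linked (A : AdjLists G) (X : Finset (Fin n)) (nx pv : ℕ → ℕ) : Prop :=
  ∀ u ∈ X, List.IsChain (fun c d => nx c = d ∧ pv d = c) (ring A X u ++ [(u : ℕ)])

/-- Turns the cyclic `List.next` and `List.prev` of the input format into a linear chain that
repeats the anchor at its end. Lists without repetition make `prev` a left inverse of `next`. -/
theorem isChain_of_next_prev {x : ℕ} {xs : List ℕ} {nx pv : ℕ → ℕ} (hnd : (x :: xs).Nodup)
    (hn : ∀ c (h : c ∈ x :: xs), nx c = (x :: xs).next c h)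
    (hp : ∀ c (h : c ∈ x :: xs), pv c = (x :: xs).prev c h) :
    List.IsChain (fun c d => nx c = d ∧ pv d = c) (x :: xs ++ [x]) := by
  have key : ∀ c (h : c ∈ x :: xs), pv (nx c) = c := by
    intro c h
    rw [hn c h, hp _ (List.next_mem _ _ _), List.prev_next _ hnd]
  have hnext : ∀ i (hi : i < (x :: xs ++ [x]).length - 1),
      nx ((x :: xs ++ [x])[i]) = (x :: xs ++ [x])[i + 1] := by
    intro i hi
    have hi' : i < (x :: xs).length := by simpa using hi
    rw [List.getElem_append_left hi', hn _ (List.getElem_mem _), List.next_getElem _ hnd]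
    rcases Nat.lt_or_ge (i + 1) (x :: xs).length with h | h
    · rw [List.getElem_append_left h]
      congr 1
      exact Nat.mod_eq_of_lt h
    · rw [List.getElem_append_right h]
      have : (i + 1) % (x :: xs).length = 0 := by
        rw [show i + 1 = (x :: xs).length by omega, Nat.mod_self]
      simp only [List.length_cons] at this
      simp [this]
  rw [List.isChain_iff_getElem]
  intro i hi
  have h1 := hnext i (by omega)
  refine ⟨h1, ?_⟩
  rw [← h1]
  refine key _ ?_
  have hi' : i < (x :: xs).length := by simpa using hi
  rw [List.getElem_append_left hi']
  exact List.getElem_mem _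

theorem linked_univ (A : AdjLists G) : Linked A Finset.univ A.nxt A.prv := by
  intro u _
  have h : arcs A Finset.univ u = A.nbrs u := by simp [arcs]
  have hnd := nodup_ring A Finset.univ u
  rw [ring, h] at hnd ⊢
  exact isChain_of_next_prev hnd (fun c hc => A.nxt_eq u c hc) (fun c hc => A.prv_eq u c hc)

/-- Splitting the chain at the cell exposes the link before it and the link after it. These are the
facts that unlinking needs. -/
theorem Linked.cell {A : AdjLists G} {X : Finset (Fin n)} {nx pv : ℕ → ℕ} (h : Linked A X nx pv)
    {u v : Fin n} (hu : u ∈ X) (hv : v ∈ arcs A X u) :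
    nx (A.cell u v) ∈ ring A X u ∧ pv (A.cell u v) ∈ ring A X u ∧
    nx (pv (A.cell u v)) = A.cell u v ∧ pv (nx (A.cell u v)) = A.cell u v := by
  obtain ⟨l1, l2, hl⟩ := List.append_of_mem hv
  have hc := h u hu
  have hring : ring A X u = ((u : ℕ) :: l1.map (A.cell u)) ++ A.cell u v :: l2.map (A.cell u) := by
    simp [ring, hl]
  rw [hring, List.append_assoc, List.cons_append (a := A.cell u v), List.isChain_split,
    List.isChain_append] at hc
  obtain ⟨⟨-, -, h1⟩, h2⟩ := hc
  have hlast : ((u : ℕ) :: l1.map (A.cell u)).getLast (by simp) ∈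
    ((u : ℕ) :: l1.map (A.cell u)).getLast? := List.getLast?_eq_getLast_of_ne_nil (List.cons_ne_nil _ _)
  obtain ⟨h3, h4⟩ := h1 _ hlast (A.cell u v) (by simp)
  have hmem1 : ((u : ℕ) :: l1.map (A.cell u)).getLast (by simp) ∈ ring A X u := by
    rw [hring]
    exact List.mem_append_left _ (List.getLast_mem _)
  rw [← h4] at hmem1 h3
  rcases l2 with _ | ⟨w, l2⟩
  · simp only [List.map_nil, List.nil_append, List.isChain_pair] at h2
    refine ⟨?_, hmem1, h3, by rw [h2.1, h2.2]⟩
    rw [h2.1]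
    simp [ring]
  · simp only [List.map_cons, List.cons_append, List.isChain_cons_cons] at h2
    refine ⟨?_, hmem1, h3, by rw [h2.1.1, h2.1.2]⟩
    rw [h2.1.1, hring]
    simp

/-- The cell at which the remaining part `l` of the list of `u` starts. -/
def cur (A : AdjLists G) (u : Fin n) : List (Fin n) → ℕ
  | [] => u
  | v :: _ => A.cell u v

/-- Following `nx` one traverses the list of `u`. -/
def Trav (A : AdjLists G) (X : Finset (Fin n)) (nx : ℕ → ℕ) (u : Fin n) : Prop :=
  nx u = cur A u (arcs A X u) ∧
  ∀ l v l', arcs A X u = l ++ v :: l' → nx (A.cell u v) = cur A u l'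

theorem Linked.trav {A : AdjLists G} {X : Finset (Fin n)} {nx pv : ℕ → ℕ} (h : Linked A X nx pv)
    {u : Fin n} (hu : u ∈ X) : Trav A X nx u := by
  have hc := h u hu
  constructor
  · rcases hl : arcs A X u with _ | ⟨v, l⟩
    · simp only [ring, hl, List.map_nil, List.cons_append, List.nil_append,
        List.isChain_pair] at hc
      exact hc.1
    · simp only [ring, hl, List.map_cons, List.cons_append, List.isChain_cons_cons] at hc
      exact hc.1.1
  · intro l v l' hl
    rw [ring, hl, List.map_append, List.map_cons, ← List.cons_append, List.append_assoc,
      List.cons_append (a := A.cell u v), List.isChain_split] at hc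
    rcases l' with _ | ⟨w, l'⟩
    · simp only [List.map_nil, List.nil_append, List.isChain_pair] at hc
      exact hc.2.1
    · simp only [List.map_cons, List.cons_append, List.isChain_cons_cons] at hc
      exact hc.2.1.1

theorem Trav.congr {A : AdjLists G} {X : Finset (Fin n)} {nx nx' : ℕ → ℕ} {u : Fin n}
    (h : Trav A X nx u) (hn : ∀ c ∈ ring A X u, nx' c = nx c) : Trav A X nx' u := by
  constructor
  · rw [hn _ (by simp [ring])]
    exact h.1
  · intro l v l' hl
    rw [hn _ (by simp [ring, hl])]
    exact h.2 l v l' hl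

/-! ### Loops over an adjacency list. -/

section Loops

variable {A : AdjLists G} {X : Finset (Fin n)} {u : Fin n} {D : ℕ} {σ : St} {Q : St → Prop}

@[simp] theorem arrLen_nxt (m : ℕ) : arrLen n m .nxt = n + 2 * m := rfl
@[simp] theorem arrLen_prv (m : ℕ) : arrLen n m .prv = n + 2 * m := rfl
@[simp] theorem arrLen_dst (m : ℕ) : arrLen n m .dst = n + 2 * m := rfl
@[simp] theorem arrLen_twin (m : ℕ) : arrLen n m .twin = n + 2 * m := rfl
@[simp] theorem arrLen_ins (m : ℕ) : arrLen n m .ins = n := rfl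
@[simp] theorem arrLen_isIn (m : ℕ) : arrLen n m .isIn = n := rfl
@[simp] theorem arrLen_queue (m : ℕ) : arrLen n m .queue = n := rfl
@[simp] theorem arrLen_seen (m : ℕ) : arrLen n m .seen = n := rfl
@[simp] theorem arrLen_disc (m : ℕ) : arrLen n m .disc = n := rfl
@[simp] theorem arrLen_low (m : ℕ) : arrLen n m .low = n := rfl
@[simp] theorem arrLen_cut (m : ℕ) : arrLen n m .cut = n := rfl

/-- The rule for a loop over the arcs that leave `u`. -/
theorem wp_arcLoop {r r' : Var} (hr : r ≠ .a) {t : Arr}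
    {tv : ℕ → ℕ} (ht : arrLen n (numEdges G) t = n + 2 * numEdges G)
    {f : Fin n → ℕ} (hf : ∀ v ∈ arcs A X u, tv (A.cell u v) = f v)
    {b : Test} {go : St → Prop} (hb : ∀ τ : St, τ.test (arrLen n (numEdges G)) b = true ↔
      τ.reg .a ≠ τ.reg r ∧ go τ)
    (hu : σ.reg r = u) (hnx : Trav A X (σ.mem .nxt) u) (htv : σ.mem t = tv)
    {visit : List Cmd} (Inv : List (Fin n) → St → Prop)
    (h0 : Inv [] (σ.set .a (cur A u (arcs A X u))))
    (hstep : ∀ l v l' τ, arcs A X u = l ++ v :: l' → Inv l τ → go τ → τ.reg r = u →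
      τ.reg .a = A.cell u v → Trav A X (τ.mem .nxt) u →
      wp (arrLen n (numEdges G)) D visit (fun τ' => τ'.reg r = u ∧ τ'.reg .a = A.cell u v ∧
        Trav A X (τ'.mem .nxt) u ∧ τ'.mem t = tv ∧ Inv (l ++ [v]) (τ'.set .a (cur A u l')))
        (τ.tick.set r' (f v)))
    (hexit : ∀ l l' τ, arcs A X u = l ++ l' → Inv l τ → (l' = [] ∨ ¬ go τ) → τ.reg r = u →
      Q τ.tick) :
    wp (arrLen n (numEdges G)) D [.assign .a (.load .nxt r),
      .loop b (.assign r' (.load t (.var .a)) :: visit ++ [.assign .a (.load .nxt (.var .a))])]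
      Q σ := by
  have hun : (u : ℕ) < n + 2 * numEdges G := by omega
  simp only [wp_assign, val_load, val_var, hu, arrLen_nxt, hun, if_true, hnx.1]
  refine wp_loop (fun m τ => ∃ l l', arcs A X u = l ++ l' ∧ l'.length = m ∧ τ.reg r = u ∧
    τ.reg .a = cur A u l' ∧ Trav A X (τ.mem .nxt) u ∧ τ.mem t = tv ∧ Inv l τ)
    (m := (arcs A X u).length) ⟨[], arcs A X u, rfl, rfl, by simp [hr, hu], by simp, hnx, htv, h0⟩ ?_ ?_
  · rintro m τ ⟨l, l', hl, rfl, h1, h2, h3, h4, h5⟩ htest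
    rw [hb, h1, h2] at htest
    obtain _ | ⟨v, l'⟩ := l'
    · exact absurd rfl htest.1
    · have hv : v ∈ arcs A X u := by simp [hl]
      have hlt := A.cell_lt _ _ (mem_arcs.1 hv).2
      simp only [cur] at h2
      simp only [List.cons_append, wp_assign, val_load, val_var, St.tick_reg, h2, ht, hlt, if_true,
        St.tick_mem, h4, hf v hv]
      refine wp_seq (hstep l v l' τ hl h5 htest.2 h1 h2 h3) ?_
      rintro τ' ⟨g1, g2, g3, g4, g5⟩
      simp only [wp_assign, val_load, val_var, g2, arrLen_nxt, hlt, if_true, g3.2 l v l' hl,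
        wp_nil_iff]
      exact ⟨l'.length, by simp, l ++ [v], l', by simp [hl], rfl, by simp [hr, g1], by simp,
        g3, g4, g5⟩
  · rintro m τ ⟨l, l', hl, rfl, h1, h2, h3, h4, h5⟩ htest
    rw [wp_nil_iff]
    refine hexit l l' τ hl h5 ?_ h1
    rw [hb, h1, h2] at htest
    obtain _ | ⟨v, l'⟩ := l'
    · exact .inl rfl
    · right
      intro hgo
      have hv : v ∈ arcs A X u := by simp [hl]
      -- An unfinished list is at an arc cell, whose number is at least `n`, so it cannot be
      -- mistaken for the anchor `u`.
      have hle := A.le_cell _ _ (mem_arcs.1 hv).2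
      refine htest ⟨?_, hgo⟩
      simp only [cur]
      omega

theorem wp_forArcs {go : Test} {visit : List Cmd} (hlink : Linked A X (σ.mem .nxt) (σ.mem .prv))
    (hdst : σ.mem .dst = A.dst) (huX : u ∈ X) (hu : σ.reg .u = u)
    (Inv : List (Fin n) → St → Prop)
    (h0 : Inv [] (σ.set .a (cur A u (arcs A X u))))
    (hstep : ∀ l v l' τ, arcs A X u = l ++ v :: l' → Inv l τ →
      τ.test (arrLen n (numEdges G)) go = true → τ.reg .u = u →
      wp (arrLen n (numEdges G)) D visit (fun τ' => τ'.reg .u = u ∧ τ'.reg .a = τ.reg .a ∧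
        τ'.mem .nxt = τ.mem .nxt ∧ τ'.mem .dst = A.dst ∧ Inv (l ++ [v]) (τ'.set .a (cur A u l')))
        (τ.tick.set .w v))
    (hexit : ∀ l l' τ, arcs A X u = l ++ l' → Inv l τ →
      (l' = [] ∨ ¬ τ.test (arrLen n (numEdges G)) go = true) → τ.reg .u = u → Q τ.tick) :
    wp (arrLen n (numEdges G)) D (forArcs go visit) Q σ := by
  refine wp_arcLoop (go := fun τ => τ.test (arrLen n (numEdges G)) go = true) (f := Fin.val)
    (by simp) rfl (fun v hv => A.dst_eq _ _ (mem_arcs.1 hv).2) (fun τ => ?_)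
    hu (hlink.trav huX) hdst Inv h0 (fun l v l' τ hl hI hgo hu' ha htr => ?_) hexit
  · simp
  · refine wp_post (hstep l v l' τ hl hI hgo hu') ?_
    rintro τ' ⟨g1, g2, g3, g4, g5⟩
    exact ⟨g1, g2.trans ha, g3 ▸ htr, g4, g5⟩

end Loops

/-! ### Deletion and restoration of a vertex -/

/-- `nx'`, `pv'` arise from `nx`, `pv` by unlinking the cells in `B`. -/
structure Unlinked (nx pv : ℕ → ℕ) (B : List ℕ) (nx' pv' : ℕ → ℕ) : Prop where
  nxt_of : ∀ b ∈ B, nx' (pv b) = nx b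
  prv_of : ∀ b ∈ B, pv' (nx b) = pv b
  nxt_ne : ∀ c, (∀ b ∈ B, c ≠ pv b) → nx' c = nx c
  prv_ne : ∀ c, (∀ b ∈ B, c ≠ nx b) → pv' c = pv c

/-- The cells in `B` are inner cells of different lists. -/
structure Separated (nx pv : ℕ → ℕ) (B : List ℕ) : Prop where
  nodup : B.Nodup
  nxt_prv : ∀ b ∈ B, nx (pv b) = b
  prv_nxt : ∀ b ∈ B, pv (nx b) = b
  ne_nxt : ∀ b ∈ B, ∀ b' ∈ B, b ≠ nx b'
  ne_prv : ∀ b ∈ B, ∀ b' ∈ B, b ≠ pv b'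

theorem Unlinked.nil (nx pv : ℕ → ℕ) : Unlinked nx pv [] nx pv := by
  constructor <;> simp

theorem Unlinked.eq_of_nil {nx pv nx' pv' : ℕ → ℕ} (h : Unlinked nx pv [] nx' pv') :
    nx' = nx ∧ pv' = pv :=
  ⟨funext fun c => h.nxt_ne c (by simp), funext fun c => h.prv_ne c (by simp)⟩

/-- Since the cells lie in different lists, the earlier edits have not changed the two links of `b`
itself. The program thus reads the original neighbours of `b`. -/
theorem Unlinked.unlink {nx pv nx' pv' : ℕ → ℕ} {B B' : List ℕ} {b : ℕ}
    (h : Unlinked nx pv B nx' pv') (hs : Separated nx pv (B ++ b :: B')) :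
    nx' b = nx b ∧ pv' b = pv b ∧ Function.update nx' (pv b) (nx b) b = nx b ∧
    Unlinked nx pv (B ++ [b]) (Function.update nx' (pv b) (nx b))
      (Function.update pv' (nx b) (pv b)) := by
  have hb : b ∈ B ++ b :: B' := by simp
  have hB : ∀ c ∈ B, c ∈ B ++ b :: B' := fun c hc => by simp [hc]
  have hbB : ∀ c ∈ B, c ≠ b := by
    rintro c hc rfl
    exact (List.nodup_append.1 hs.nodup).2.2 c hc c (by simp) rfl
  have e1 : nx' b = nx b := h.nxt_ne b fun c hc => hs.ne_prv b hb c (hB c hc)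
  have e2 : pv' b = pv b := h.prv_ne b fun c hc => hs.ne_nxt b hb c (hB c hc)
  refine ⟨e1, e2, ?_, ⟨?_, ?_, ?_, ?_⟩⟩
  · rw [Function.update_of_ne (hs.ne_prv b hb b hb), e1]
  · intro c hc
    rcases List.mem_append.1 hc with hc | hc
    · rw [Function.update_of_ne, h.nxt_of c hc]
      intro he
      apply hbB c hc
      rw [← hs.nxt_prv c (hB c hc), he, hs.nxt_prv b hb]
    · rw [List.mem_singleton.1 hc, Function.update_self]
  · intro c hc
    rcases List.mem_append.1 hc with hc | hc
    · rw [Function.update_of_ne, h.prv_of c hc]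
      intro he
      apply hbB c hc
      rw [← hs.prv_nxt c (hB c hc), he, hs.prv_nxt b hb]
    · rw [List.mem_singleton.1 hc, Function.update_self]
  · intro c hc
    rw [Function.update_of_ne (hc b (by simp)), h.nxt_ne c fun d hd => hc d (by simp [hd])]
  · intro c hc
    rw [Function.update_of_ne (hc b (by simp)), h.prv_ne c fun d hd => hc d (by simp [hd])]

/-- An unlinked cell keeps its own two links, from which it can be put back. The cells lie in
different lists, so they may be put back in the order of their removal instead of the reverse order.
-/
theorem Unlinked.relink {nx pv nx' pv' : ℕ → ℕ} {B B' : List ℕ} {b : ℕ}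
    (h : Unlinked nx pv (b :: B) nx' pv') (hs : Separated nx pv (B' ++ b :: B)) :
    nx' b = nx b ∧ pv' b = pv b ∧ Function.update nx' (pv b) b b = nx b ∧
    Unlinked nx pv B (Function.update nx' (pv b) b) (Function.update pv' (nx b) b) := by
  have hb : b ∈ B' ++ b :: B := by simp
  have hB : ∀ c ∈ b :: B, c ∈ B' ++ b :: B := fun c hc => by
    rw [List.mem_append]; exact .inr hc
  have hbB : ∀ c ∈ B, c ≠ b := by
    rintro c hc rfl
    exact (List.nodup_cons.1 (List.nodup_append.1 hs.nodup).2.1).1 hc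
  have e1 : nx' b = nx b := h.nxt_ne b fun c hc => hs.ne_prv b hb c (hB c hc)
  have e2 : pv' b = pv b := h.prv_ne b fun c hc => hs.ne_nxt b hb c (hB c hc)
  refine ⟨e1, e2, ?_, ⟨?_, ?_, ?_, ?_⟩⟩
  · rw [Function.update_of_ne (hs.ne_prv b hb b hb), e1]
  · intro c hc
    rw [Function.update_of_ne, h.nxt_of c (by simp [hc])]
    intro he
    apply hbB c hc
    rw [← hs.nxt_prv c (hB c (by simp [hc])), he, hs.nxt_prv b hb]
  · intro c hc
    rw [Function.update_of_ne, h.prv_of c (by simp [hc])]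
    intro he
    apply hbB c hc
    rw [← hs.prv_nxt c (hB c (by simp [hc])), he, hs.prv_nxt b hb]
  · intro c hc
    by_cases hcb : c = pv b
    · rw [hcb, Function.update_self, hs.nxt_prv b hb]
    · rw [Function.update_of_ne hcb, h.nxt_ne c]
      simpa [hcb] using hc
  · intro c hc
    by_cases hcb : c = nx b
    · rw [hcb, Function.update_self, hs.prv_nxt b hb]
    · rw [Function.update_of_ne hcb, h.prv_ne c]
      simpa [hcb] using hc

variable {A : AdjLists G} {X : Finset (Fin n)} {z : Fin n} {nx pv : ℕ → ℕ}

/-- The cells of the arcs from `X` to `z`. -/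
def entering (A : AdjLists G) (X : Finset (Fin n)) (z : Fin n) : List ℕ :=
  (arcs A X z).map fun w => A.cell w z

theorem mem_arcs_comm {w : Fin n} (hz : z ∈ X) (hw : w ∈ arcs A X z) :
    w ∈ X ∧ z ∈ arcs A X w := by
  rw [mem_arcs] at hw
  exact ⟨hw.1, mem_arcs.2 ⟨hz, hw.2.symm⟩⟩

theorem cell_mem_ring {u v : Fin n} (h : v ∈ arcs A X u) : A.cell u v ∈ ring A X u :=
  mem_ring.2 (.inr ⟨v, (mem_arcs.1 h).1, (mem_arcs.1 h).2, rfl⟩)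

/-- The anchor is in every list, so the list of an arc cell has at least two cells. -/
theorem Linked.ne_nxt (h : Linked A X nx pv) {u v : Fin n} (hu : u ∈ X) (hv : v ∈ arcs A X u) :
    A.cell u v ≠ nx (A.cell u v) ∧ A.cell u v ≠ pv (A.cell u v) := by
  suffices h' : A.cell u v ≠ nx (A.cell u v) by
    refine ⟨h', fun h2 => h' ?_⟩
    conv_lhs => rw [← (h.cell hu hv).2.2.1, ← h2]
  intro h'
  obtain ⟨l1, l2, hl⟩ := List.append_of_mem hv
  have h1 := (h.trav hu).2 l1 v l2 hl
  rw [← h'] at h1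
  have hnd := nodup_ring A X u
  rw [ring, hl] at hnd
  rcases l2 with _ | ⟨w, l2⟩
  · have := A.le_cell _ _ (mem_arcs.1 hv).2
    simp only [cur] at h1
    omega
  · simp only [cur] at h1
    simp [h1, List.nodup_append] at hnd

/-- Each vertex has at most one arc to `z`, so the entering cells and their neighbouring cells
belong to distinct rings. -/
theorem Linked.separated (h : Linked A X nx pv) (hz : z ∈ X) :
    Separated nx pv (entering A X z) := by
  constructor
  · refine List.Nodup.map_on (fun v hv w hw hvw => ?_) (nodup_arcs A X z)
    exact (A.cell_inj _ _ _ _ (mem_arcs.1 hv).2.symm (mem_arcs.1 hw).2.symm hvw).1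
  all_goals simp only [entering, List.forall_mem_map]
  · intro w hw
    obtain ⟨h1, h2⟩ := mem_arcs_comm hz hw
    exact (h.cell h1 h2).2.2.1
  · intro w hw
    obtain ⟨h1, h2⟩ := mem_arcs_comm hz hw
    exact (h.cell h1 h2).2.2.2
  · intro w hw w' hw' he
    obtain ⟨h1, h2⟩ := mem_arcs_comm hz hw
    obtain ⟨h1', h2'⟩ := mem_arcs_comm hz hw'
    have := ring_inj (cell_mem_ring h2) (he ▸ (h.cell h1' h2').1)
    subst this
    exact (h.ne_nxt h1 h2).1 he
  · intro w hw w' hw' he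
    obtain ⟨h1, h2⟩ := mem_arcs_comm hz hw
    obtain ⟨h1', h2'⟩ := mem_arcs_comm hz hw'
    have := ring_inj (cell_mem_ring h2) (he ▸ (h.cell h1' h2').2.1)
    subst this
    exact (h.ne_nxt h1 h2).2 he

/-- Deleting `z` edits only the lists of its neighbours. Its own list stays traversable, and by it
the arcs are found again for the restoration. -/
theorem Linked.trav_of_unlinked (h : Linked A X nx pv) (hz : z ∈ X) {B : List ℕ}
    (hB : B ⊆ entering A X z) {nx' pv' : ℕ → ℕ} (hU : Unlinked nx pv B nx' pv') :
    Trav A X nx' z := by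
  refine (h.trav hz).congr fun c hc => hU.nxt_ne c fun b hb he => ?_
  obtain ⟨w, hw, rfl⟩ := List.mem_map.1 (hB hb)
  obtain ⟨h1, h2⟩ := mem_arcs_comm hz hw
  have := ring_inj hc (he ▸ (h.cell h1 h2).2.1)
  subst this
  exact (mem_arcs.1 hw).2.ne rfl

/-- In the list of a neighbour of `z` one cell disappears, and its two outer neighbours become
linked. All other links survive. Nothing is required of the list of `z`, which is no longer in
`X.erase z`. -/
theorem Linked.erase (h : Linked A X nx pv) (hz : z ∈ X) {nx' pv' : ℕ → ℕ}
    (hU : Unlinked nx pv (entering A X z) nx' pv') : Linked A (X.erase z) nx' pv' := by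
  intro u hu
  obtain ⟨huz, huX⟩ := Finset.mem_erase.1 hu
  have hc := h u huX
  have hfilter : arcs A (X.erase z) u = (arcs A X u).filter (· ≠ z) := by
    rw [arcs, arcs, List.filter_filter]
    refine List.filter_congr fun v _ => ?_
    simp [Finset.mem_erase]
  -- links that do not involve an unlinked cell survive
  have key : ∀ c ∈ ring A X u ++ [(u : ℕ)], ∀ d ∈ ring A X u ++ [(u : ℕ)],
      (z ∈ arcs A X u → c ≠ A.cell u z ∧ d ≠ A.cell u z) → nx c = d ∧ pv d = c →
      nx' c = d ∧ pv' d = c := by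
    intro c hc d hd hcd ⟨h1, h2⟩
    have hur : ∀ e ∈ ring A X u ++ [(u : ℕ)], e ∈ ring A X u := by
      intro e he
      rcases List.mem_append.1 he with he | he
      · exact he
      · rw [List.mem_singleton.1 he]
        simp [ring]
    constructor
    · rw [hU.nxt_ne c, h1]
      intro b hb he
      obtain ⟨w, hw, rfl⟩ := List.mem_map.1 hb
      obtain ⟨g1, g2⟩ := mem_arcs_comm hz hw
      have := ring_inj (hur c hc) (he ▸ (h.cell g1 g2).2.1)
      subst this
      refine (hcd g2).2 ?_
      rw [← h1, he, (h.cell g1 g2).2.2.1]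
    · rw [hU.prv_ne d, h2]
      intro b hb he
      obtain ⟨w, hw, rfl⟩ := List.mem_map.1 hb
      obtain ⟨g1, g2⟩ := mem_arcs_comm hz hw
      have := ring_inj (hur d hd) (he ▸ (h.cell g1 g2).1)
      subst this
      refine (hcd g2).1 ?_
      rw [← h2, he, (h.cell g1 g2).2.2.2]
  by_cases hzu : z ∈ arcs A X u
  · obtain ⟨l1, l2, hl⟩ := List.append_of_mem hzu
    have hnd := nodup_arcs A X u
    have hndr := nodup_ring A X u
    have hl' : arcs A (X.erase z) u = l1 ++ l2 := by
      rw [hfilter, hl]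
      rw [hl] at hnd
      obtain ⟨-, hnd2, hnd3⟩ := List.nodup_append.1 hnd
      rw [List.filter_append, List.filter_cons_of_neg (by simp), List.filter_eq_self.2,
        List.filter_eq_self.2]
      · intro v hv
        simp only [decide_eq_true_eq]
        rintro rfl
        exact (List.nodup_cons.1 hnd2).1 hv
      · intro v hv
        simpa using hnd3 v hv z (by simp)
    have hring : ring A X u = ((u : ℕ) :: l1.map (A.cell u)) ++ A.cell u z :: l2.map (A.cell u) := by
      simp [ring, hl]
    have hring' : ring A (X.erase z) u ++ [(u : ℕ)] =
        ((u : ℕ) :: l1.map (A.cell u)) ++ (l2.map (A.cell u) ++ [(u : ℕ)]) := by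
      simp [ring, hl']
    have hsub : ∀ c, c ∈ ((u : ℕ) :: l1.map (A.cell u)) ∨ c ∈ (l2.map (A.cell u) ++ [(u : ℕ)]) →
        c ∈ ring A X u ++ [(u : ℕ)] ∧ c ≠ A.cell u z := by
      intro c hc
      constructor
      · rw [hring]
        rcases hc with hc | hc
        · simp only [List.append_assoc, List.mem_append]
          exact .inl hc
        · simp only [List.append_assoc, List.mem_append, List.mem_cons] at hc ⊢
          tauto
      · rintro rfl
        have hle := A.le_cell _ _ (mem_arcs.1 hzu).2
        rw [hring] at hndr
        obtain ⟨-, hnd2, hnd3⟩ := List.nodup_append.1 hndr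
        rcases hc with hc | hc
        · exact hnd3 _ hc _ (by simp) rfl
        · rcases List.mem_append.1 hc with hc | hc
          · exact (List.nodup_cons.1 hnd2).1 hc
          · have := List.mem_singleton.1 hc
            omega
    have hR : ∀ c d, (c ∈ ((u : ℕ) :: l1.map (A.cell u)) ∨
        c ∈ (l2.map (A.cell u) ++ [(u : ℕ)])) → (d ∈ ((u : ℕ) :: l1.map (A.cell u)) ∨
        d ∈ (l2.map (A.cell u) ++ [(u : ℕ)])) → nx c = d ∧ pv d = c → nx' c = d ∧ pv' d = c :=
      fun c d hc hd => key c (hsub c hc).1 d (hsub d hd).1 fun _ => ⟨(hsub c hc).2, (hsub d hd).2⟩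
    rw [hring, List.append_assoc, List.cons_append (a := A.cell u z), List.isChain_split,
      List.isChain_append] at hc
    obtain ⟨⟨hc1, -, hc2⟩, hc3⟩ := hc
    rw [hring', List.isChain_append]
    refine ⟨hc1.imp_of_mem_imp fun c d hc hd => hR c d (.inl hc) (.inl hd),
      hc3.tail.imp_of_mem_imp fun c d hc hd => hR c d (.inr hc) (.inr hd), fun c hc d hd => ?_⟩
    have h1 := hc2 c hc (A.cell u z) (by simp)
    have h2 : nx (A.cell u z) = d ∧ pv d = A.cell u z := by
      rcases hl2 : l2.map (A.cell u) ++ [(u : ℕ)] with _ | ⟨e, l3⟩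
      · simp at hl2
      · rw [hl2] at hc3 hd
        simp only [List.head?_cons, Option.mem_def, Option.some.injEq] at hd
        subst hd
        exact (List.isChain_cons_cons.1 hc3).1
    have hb : A.cell u z ∈ entering A X z :=
      List.mem_map.2 ⟨u, mem_arcs.2 ⟨huX, (mem_arcs.1 hzu).2.symm⟩, rfl⟩
    have h3 := hU.nxt_of _ hb
    have h4 := hU.prv_of _ hb
    rw [h1.2, h2.1] at h3
    rw [h1.2, h2.1] at h4
    exact ⟨h3, h4⟩
  · have hl' : arcs A (X.erase z) u = arcs A X u := by
      rw [hfilter, List.filter_eq_self]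
      intro v hv
      simp only [decide_eq_true_eq]
      rintro rfl
      exact hzu hv
    rw [ring, hl', ← ring]
    exact hc.imp_of_mem_imp fun c d hc hd => key c hc d hd fun h => absurd h hzu

section DeleteRestore

variable {D : ℕ} {σ : St}

/-- The state after an edit of the links of the graph. -/
structure LinkEdit (σ τ : St) : Prop where
  reg : ∀ r, r ≠ .a → r ≠ .b → τ.reg r = σ.reg r
  mem : ∀ t, t ≠ .nxt → t ≠ .prv → τ.mem t = σ.mem t
  out : τ.out = σ.out

theorem wp_deleteVertex (hL : Linked A X (σ.mem .nxt) (σ.mem .prv)) (hz : z ∈ X)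
    (htw : σ.mem .twin = A.twin) (hrz : σ.reg .z = z) :
    wp (arrLen n (numEdges G)) D deleteVertex (fun τ => LinkEdit σ τ ∧
      Unlinked (σ.mem .nxt) (σ.mem .prv) (entering A X z) (τ.mem .nxt) (τ.mem .prv) ∧
      τ.time ≤ σ.time + 5 * (arcs A X z).length + 2) σ := by
  have hsep := hL.separated hz
  refine wp_arcLoop (A := A) (X := X) (u := z) (go := fun _ => True) (tv := A.twin)
    (f := fun w => A.cell w z) (by simp) rfl
    (fun v hv => A.twin_eq _ _ (mem_arcs.1 hv).2) (fun τ => by simp) hrz (hL.trav hz) htw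
    (fun l τ => LinkEdit σ τ ∧
      Unlinked (σ.mem .nxt) (σ.mem .prv) (l.map fun w => A.cell w z) (τ.mem .nxt) (τ.mem .prv) ∧
      τ.time ≤ σ.time + 5 * l.length + 1) ?_ ?_ ?_
  · exact ⟨⟨fun r h1 _ => by simp [h1], fun _ _ _ => rfl, rfl⟩, Unlinked.nil _ _, by simp⟩
  · rintro l v l' τ hl ⟨hE, hU, ht⟩ - h1 h2 h3
    have hent : entering A X z = (l.map fun w => A.cell w z) ++ A.cell v z ::
        l'.map fun w => A.cell w z := by simp [entering, hl]
    have hv : v ∈ arcs A X z := by simp [hl]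
    obtain ⟨g1, g2⟩ := mem_arcs_comm hz hv
    have hb : A.cell v z < n + 2 * numEdges G := A.cell_lt _ _ (mem_arcs.1 g2).2
    obtain ⟨p1, p2, -, -⟩ := hL.cell g1 g2
    have p1 := ring_lt p1
    have p2 := ring_lt p2
    rw [hent] at hsep
    obtain ⟨e1, e2, e3, e4⟩ := hU.unlink hsep
    have hUE : LinkEdit σ ((((τ.tick.set .b (A.cell v z)).put .nxt (σ.mem .prv (A.cell v z))
        (σ.mem .nxt (A.cell v z))).put .prv (σ.mem .nxt (A.cell v z))
        (σ.mem .prv (A.cell v z))).set .a (cur A z l')) := by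
      refine ⟨fun r h1 h2 => ?_, fun t h1 h2 => ?_, ?_⟩
      · simp [h1, h2, hE.reg r h1 h2]
      · simp [h1, h2, hE.mem t h1 h2]
      · simp [hE.out]
    simp only [wp_store, val_load, val_var, St.set_reg, St.set_mem, St.tick_mem, hb, arrLen_nxt,
      arrLen_prv, if_true, e1, e2, p1, p2, St.put_reg, St.put_mem, reduceCtorEq, if_false, e3,
      wp_nil_iff]
    refine ⟨by simp [h1], by simp [h2], ?_, ?_, hUE, ?_, ?_⟩
    · refine hL.trav_of_unlinked hz ?_ e4
      rw [hent]
      simp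
    · rw [hE.mem .twin (by simp) (by simp), htw]
    · simpa using e4
    · simp
      omega
  · rintro l l' τ hl ⟨hE, hU, ht⟩ hhalt -
    have : l' = [] := by simpa using hhalt
    subst this
    rw [List.append_nil] at hl
    refine ⟨⟨hE.reg, hE.mem, hE.out⟩, by simpa [entering, hl] using hU, ?_⟩
    simp only [St.tick_time, hl]
    omega

/-- The link tables are recovered exactly, not merely up to being `Linked`. An enclosing deletion
compares the tables with those it has left, so it relies on this. -/
theorem wp_restoreVertex (hL : Linked A X nx pv) (hz : z ∈ X)
    (hU : Unlinked nx pv (entering A X z) (σ.mem .nxt) (σ.mem .prv))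
    (htw : σ.mem .twin = A.twin) (hrz : σ.reg .z = z) :
    wp (arrLen n (numEdges G)) D restoreVertex (fun τ => LinkEdit σ τ ∧
      τ.mem .nxt = nx ∧ τ.mem .prv = pv ∧
      τ.time ≤ σ.time + 5 * (arcs A X z).length + 2) σ := by
  have hsep := hL.separated hz
  refine wp_arcLoop (A := A) (X := X) (u := z) (go := fun _ => True) (tv := A.twin)
    (f := fun w => A.cell w z) (by simp) rfl
    (fun v hv => A.twin_eq _ _ (mem_arcs.1 hv).2) (fun τ => by simp) hrz
    (hL.trav_of_unlinked hz (List.Subset.refl _) hU) htw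
    (fun l τ => LinkEdit σ τ ∧ (∀ l', arcs A X z = l ++ l' →
      Unlinked nx pv (l'.map fun w => A.cell w z) (τ.mem .nxt) (τ.mem .prv)) ∧
      τ.time ≤ σ.time + 5 * l.length + 1) ?_ ?_ ?_
  · refine ⟨⟨fun r h1 _ => by simp [h1], fun _ _ _ => rfl, rfl⟩, ?_, by simp⟩
    rintro l' hl'
    rw [entering, hl'] at hU
    simpa using hU
  · rintro l v l' τ hl ⟨hE, hU, ht⟩ - h1 h2 h3
    have hent : entering A X z = (l.map fun w => A.cell w z) ++ A.cell v z ::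
        l'.map fun w => A.cell w z := by simp [entering, hl]
    have hv : v ∈ arcs A X z := by simp [hl]
    obtain ⟨g1, g2⟩ := mem_arcs_comm hz hv
    have hb : A.cell v z < n + 2 * numEdges G := A.cell_lt _ _ (mem_arcs.1 g2).2
    obtain ⟨p1, p2, -, -⟩ := hL.cell g1 g2
    have p1 := ring_lt p1
    have p2 := ring_lt p2
    rw [hent] at hsep
    have hU := hU _ hl
    rw [List.map_cons] at hU
    obtain ⟨e1, e2, e3, e4⟩ := hU.relink hsep
    have hUE : LinkEdit σ ((((τ.tick.set .b (A.cell v z)).put .nxt (pv (A.cell v z))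
        (A.cell v z)).put .prv (nx (A.cell v z)) (A.cell v z)).set .a (cur A z l')) := by
      refine ⟨fun r h1 h2 => ?_, fun t h1 h2 => ?_, ?_⟩
      · simp [h1, h2, hE.reg r h1 h2]
      · simp [h1, h2, hE.mem t h1 h2]
      · simp [hE.out]
    simp only [wp_store, val_load, val_var, St.set_reg, St.set_mem, St.tick_mem, hb, arrLen_nxt,
      arrLen_prv, if_true, e2, p1, p2, St.put_reg, St.put_mem, reduceCtorEq, if_false, e3,
      wp_nil_iff]
    refine ⟨by simp [h1], by simp [h2], ?_, ?_, hUE, ?_, ?_⟩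
    · refine hL.trav_of_unlinked hz ?_ e4
      rw [hent]
      intro c hc
      simp [List.mem_append, List.mem_cons]
      right; right
      simpa using hc
    · rw [hE.mem .twin (by simp) (by simp), htw]
    · intro l'' hl''
      rw [hl, List.append_assoc] at hl''
      have := List.append_cancel_left hl''
      simp only [List.singleton_append, List.cons.injEq, true_and] at this
      subst this
      simpa using e4
    · simp
      omega
  · rintro l l' τ hl ⟨hE, hU, ht⟩ hhalt -
    have : l' = [] := by simpa using hhalt
    subst this
    obtain ⟨h1, h2⟩ := (hU [] hl).eq_of_nil
    rw [List.append_nil] at hl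
    refine ⟨⟨hE.reg, hE.mem, hE.out⟩, h1, h2, ?_⟩
    simp only [St.tick_time, hl]
    omega

end DeleteRestore

end Arcs

end Graphlet


namespace Graphlet

set_option linter.unusedSimpArgs false

section Blocks

variable {n : ℕ} {G : SimpleGraph (Fin n)} {A : AdjLists G} {X : Finset (Fin n)}
  {I : List (Fin n)} {D k : ℕ} {σ : St}

local notation "wpG" => wp (arrLen n (numEdges G))

/-! ### Representation of `In` and of the alive part of the graph -/

/-- The memory represents the graph induced by `X` and the list `I`, and the work space for searches
has been cleaned up. -/
structure MRep (A : AdjLists G) (X : Finset (Fin n)) (I : List (Fin n))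
    (mem : Arr → ℕ → ℕ) : Prop where
  ins : ∀ i (h : i < I.length), mem .ins i = I[i]
  isIn : ∀ v : Fin n, mem .isIn v = if v ∈ I then 1 else 0
  seen : ∀ v : Fin n, mem .seen v = 0
  disc : ∀ v : Fin n, mem .disc v = 0
  dst : mem .dst = A.dst
  twin : mem .twin = A.twin
  linked : Linked A X (mem .nxt) (mem .prv)

/-- Only the registers in `rs` may have changed. -/
def Keep (rs : List Var) (σ τ : St) : Prop := ∀ r, r ∉ rs → τ.reg r = σ.reg r

/-- `w` is a vertex of `N(I)` in the graph induced by `X`. -/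
def IsNbr (G : SimpleGraph (Fin n)) (X : Finset (Fin n)) (I : List (Fin n)) (w : Fin n) : Prop :=
  w ∈ X ∧ w ∉ I ∧ ∃ a ∈ I, G.Adj a w

theorem length_le_of_subset {α : Type*} {l l' : List α} (h : l.Nodup) (hs : l ⊆ l') :
    l.length ≤ l'.length := (List.subperm_of_subset h hs).length_le

theorem length_le_of_nodup {l : List (Fin n)} (h : l.Nodup) : l.length ≤ n := by
  simpa using h.length_le_card

theorem append_nodup_left {α : Type*} {l l' l'' : List α} (h : l.Nodup) (he : l = l' ++ l'') :
    l'.Nodup := (List.nodup_append.1 (he ▸ h)).1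

/-! ### Search for two neighbours -/

/-- The vertices found so far. -/
def Found (τ : St) (F : List (Fin n)) : Prop :=
  (F = [] ∧ τ.reg .cnt = 0) ∨ (∃ x, F = [x] ∧ τ.reg .cnt = 1 ∧ τ.reg .x = x) ∨
  ∃ x y, x ≠ y ∧ F = [x, y] ∧ τ.reg .cnt = 2 ∧ τ.reg .x = x ∧ τ.reg .y = y

theorem Found.length {τ : St} {F : List (Fin n)} (h : Found τ F) :
    τ.reg .cnt = F.length ∧ F.length ≤ 2 := by
  rcases h with ⟨rfl, h⟩ | ⟨x, rfl, h, -⟩ | ⟨x, y, -, rfl, h, -⟩ <;> simp [h]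

theorem Found.congr {τ τ' : St} {F : List (Fin n)} (h : Found τ F)
    (h1 : τ'.reg .cnt = τ.reg .cnt) (h2 : τ'.reg .x = τ.reg .x) (h3 : τ'.reg .y = τ.reg .y) :
    Found τ' F := by
  simpa only [Found, h1, h2, h3] using h

/-- The outcome of the search for two neighbours. -/
def FoundTwo (G : SimpleGraph (Fin n)) (X : Finset (Fin n)) (I : List (Fin n)) (τ : St) : Prop :=
  (τ.reg .cnt = 0 ∧ ∀ w, ¬ IsNbr G X I w) ∨
  (∃ x : Fin n, τ.reg .cnt = 1 ∧ τ.reg .x = x ∧ IsNbr G X I x ∧ ∀ w, IsNbr G X I w → w = x) ∨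
  ∃ x y : Fin n, x ≠ y ∧ τ.reg .cnt = 2 ∧ τ.reg .x = x ∧ τ.reg .y = y ∧
    IsNbr G X I x ∧ IsNbr G X I y

/-- The hypothesis `hold` allows the search to start at position `i₀`: the earlier vertices of `In`
have no neighbours outside. The factor `I.length - i₀` in the time makes following a whole chain
cost `O(k²)` and not `O(k³)`. -/
theorem wp_findTwo {i₀ : ℕ} (hM : MRep A X I σ.mem) (hnd : I.Nodup) (hIX : ∀ v ∈ I, v ∈ X)
    (hs : σ.reg .s = I.length) (hi : σ.reg .i = i₀) (hi₀ : i₀ ≤ I.length)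
    (hold : ∀ j (h : j < I.length), j < i₀ → ∀ w ∈ arcs A X I[j], w ∈ I) :
    wpG D findTwo (fun τ => Keep [.cnt, .i, .u, .a, .w, .x, .y] σ τ ∧ τ.mem = σ.mem ∧
      τ.out = σ.out ∧ FoundTwo G X I τ ∧
      τ.time ≤ σ.time + (I.length - i₀) * (8 * I.length + 21) + 2) σ := by
  have hn := length_le_of_nodup hnd
  obtain ⟨B, hB⟩ : ∃ B, B = 8 * I.length + 21 := ⟨_, rfl⟩
  rw [← hB]
  simp only [findTwo, wp_assign, val_zero, val_one, val_two]
  refine wp_loop (fun m τ => ∃ d F, m + (i₀ + d) = I.length ∧ τ.reg .i = i₀ + d ∧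
    Keep [.cnt, .i, .u, .a, .w, .x, .y] σ τ ∧ τ.mem = σ.mem ∧ τ.out = σ.out ∧ Found τ F ∧
    (∀ f ∈ F, IsNbr G X I f) ∧ (F.length < 2 → ∀ j (h : j < I.length), j < i₀ + d →
      ∀ w ∈ arcs A X I[j], w ∈ I ∨ w ∈ F) ∧ τ.time ≤ σ.time + d * B + 1)
    (m := I.length - i₀) ?_ ?_ ?_
  · refine ⟨0, [], by omega, by simp [hi], fun r hr => ?_, rfl, rfl, .inl ⟨rfl, by simp⟩,
      by simp, ?_, by simp⟩
    · simp only [List.mem_cons, not_or] at hr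
      simp [hr.1]
    · intro _ j h hj w hw
      exact .inl (hold j h hj w hw)
  · rintro m τ ⟨d, F, hm, h1, h2, h3, h4, h5, h6, h7, h8⟩ htest
    have hcnt := h5.length
    have hsτ : τ.reg .s = I.length := by rw [h2 _ (by simp), hs]
    simp only [test_and, test_lt, val_var, val_zero, val_one, val_two, h1, hsτ, hcnt.1] at htest
    obtain ⟨hlt, hF2⟩ := htest
    obtain ⟨u, hu⟩ : ∃ u, u = I[i₀ + d] := ⟨_, rfl⟩
    have huX : u ∈ X := hIX u (hu ▸ List.getElem_mem _)
    have huI : u ∈ I := hu ▸ List.getElem_mem _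
    have hin : i₀ + d < n := by omega
    have hload : τ.mem .ins (i₀ + d) = u := by rw [h3, hM.ins _ hlt, hu]
    simp only [List.cons_append, wp_assign, val_load, val_var, St.tick_reg, h1, arrLen_ins, hin,
      if_true, St.tick_mem, hload]
    refine wp_seq (P := fun τ' => ∃ F, τ'.reg .i = i₀ + d ∧
      Keep [.cnt, .i, .u, .a, .w, .x, .y] σ τ' ∧ τ'.mem = σ.mem ∧ τ'.out = σ.out ∧ Found τ' F ∧
      (∀ f ∈ F, IsNbr G X I f) ∧ (F.length < 2 → ∀ j (h : j < I.length), j < i₀ + d + 1 →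
      ∀ w ∈ arcs A X I[j], w ∈ I ∨ w ∈ F) ∧ τ'.time ≤ τ.time + 8 * (I.length + 2) + 4)
      (wp_forArcs (A := A) (X := X) (u := u) (by simpa [h3] using hM.linked)
        (by simpa [h3] using hM.dst) huX (by simp)
        (fun l τ' => ∃ F', F ⊆ F' ∧ τ'.reg .i = i₀ + d ∧
          Keep [.cnt, .i, .u, .a, .w, .x, .y] σ τ' ∧ τ'.mem = σ.mem ∧ τ'.out = σ.out ∧
          Found τ' F' ∧ (∀ f ∈ F', IsNbr G X I f) ∧ (∀ w ∈ l, w ∈ I ∨ w ∈ F') ∧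
          τ'.time ≤ τ.time + 8 * l.length + 3) ?_ ?_ ?_) ?_
    · refine ⟨F, List.Subset.refl _, by simp [h1], fun r hr => ?_, h3, h4,
        h5.congr (by simp) (by simp) (by simp), h6, by simp, by simp⟩
      have := h2 r hr
      simp only [List.mem_cons, not_or] at hr
      simp [hr, this]
    · rintro l v l' τ' hl ⟨F', g0, g1, g2, g3, g4, g5, g6, g7, g8⟩ hgo hu'
      have hv : v ∈ arcs A X u := by simp [hl]
      have hv' := mem_arcs.1 hv
      have hcnt' := g5.length
      simp only [test_lt, val_var, val_zero, val_one, val_two, hcnt'.1] at hgo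
      have hisIn : τ'.mem .isIn v = if v ∈ I then 1 else 0 := by rw [g3, hM.isIn]
      have hkeep : ∀ r, r ∉ [Var.cnt, .i, .u, .a, .w, .x, .y] → ∀ ρ : St,
          ρ.reg r = τ'.reg r → ρ.reg r = σ.reg r := fun r hr ρ h => h.trans (g2 r hr)
      simp only [wp_branch, test_eq, val_load, val_var, val_zero, val_one, val_two, St.set_reg, St.set_mem,
        St.tick_mem, St.tick_reg, if_true, arrLen_isIn, v.isLt, hisIn]
      by_cases hvI : v ∈ I
      · simp only [hvI, if_true, one_ne_zero, if_false, List.nil_append, wp_nil_iff]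
        refine ⟨by simp [hu'], by simp, rfl, by simpa [g3] using hM.dst, F', g0, by simp [g1], ?_,
          g3, g4, g5.congr (by simp) (by simp) (by simp), g6, ?_, by simp; omega⟩
        · intro r hr
          refine hkeep r hr _ ?_
          simp only [List.mem_cons, not_or] at hr
          simp [hr]
        · intro w hw
          rcases List.mem_append.1 hw with hw | hw
          · exact g7 w hw
          · exact .inl (List.mem_singleton.1 hw ▸ hvI)
      · have hvN : IsNbr G X I v := ⟨hv'.1, hvI, u, huI, hv'.2⟩
        simp only [hvI, if_true, if_false, List.cons_append, List.nil_append, wp_branch, test_eq,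
          val_var, val_zero, val_one, val_two, St.set_reg, St.tick_reg, reduceCtorEq]
        rcases g5 with ⟨rfl, hc⟩ | ⟨x, rfl, hc, hx⟩ | ⟨x, y, -, rfl, -⟩
        · simp only [hc, if_true, List.cons_append, List.nil_append, wp_assign, wp_nil_iff,
            val_var, val_zero, val_one, val_two]
          refine ⟨by simp [hu'], by simp, rfl, by simpa [g3] using hM.dst, [v],
            fun w hw => absurd (g0 hw) (by simp),
            by simp [g1], ?_, g3, g4, .inr (.inl ⟨v, rfl, by simp, by simp⟩), by simpa using hvN,
            ?_, by simp; omega⟩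
          · intro r hr
            refine hkeep r hr _ ?_
            simp only [List.mem_cons, not_or] at hr
            simp [hr]
          · intro w hw
            rcases List.mem_append.1 hw with hw | hw
            · exact (g7 w hw).imp id (by simp)
            · exact .inr hw
        · simp only [hc, one_ne_zero, if_false, List.cons_append, List.nil_append, wp_branch,
            test_eq, val_var, St.tick_reg, St.set_reg, if_true, reduceCtorEq, hx]
          by_cases hvx : v = x
          · simp only [hvx, if_true, List.nil_append, wp_nil_iff]
            refine ⟨by simp [hu'], by simp, rfl, by simpa [g3] using hM.dst, [x], g0,
              by simp [g1], ?_, g3, g4, .inr (.inl ⟨x, rfl, by simp [hc], by simp [hx]⟩), g6,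
              ?_, by simp; omega⟩
            · intro r hr
              refine hkeep r hr _ ?_
              simp only [List.mem_cons, not_or] at hr
              simp [hr]
            · intro w hw
              rcases List.mem_append.1 hw with hw | hw
              · exact g7 w hw
              · exact .inr hw
          · have hvx' : ¬ (v : ℕ) = x := fun h => hvx (Fin.ext h)
            simp only [hvx', if_false, List.cons_append, List.nil_append, wp_assign, wp_nil_iff,
              val_var, val_zero, val_one, val_two]
            refine ⟨by simp [hu'], by simp, rfl, by simpa [g3] using hM.dst, [x, v],
              fun w hw => by simp [List.mem_singleton.1 (g0 hw)],
              by simp [g1], ?_, g3, g4, .inr (.inr ⟨x, v, Ne.symm hvx, rfl, by simp, by simp [hx],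
              by simp⟩), by simpa using ⟨g6 x (by simp), hvN⟩, ?_, by simp; omega⟩
            · intro r hr
              refine hkeep r hr _ ?_
              simp only [List.mem_cons, not_or] at hr
              simp [hr]
            · intro w hw
              rcases List.mem_append.1 hw with hw | hw
              · exact (g7 w hw).imp id fun h => by simp [List.mem_singleton.1 h]
              · exact .inr (by simp [List.mem_singleton.1 hw])
        · simp at hgo
    · rintro l l' τ' hl ⟨F', g0, g1, g2, g3, g4, g5, g6, g7, g8⟩ hhalt -
      have hcnt' := g5.length
      -- Every scanned arc ends in `I` or at one of the at most two vertices found, however long the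
      -- adjacency list is.
      have hlen : l.length ≤ I.length + 2 := by
        have h := length_le_of_subset (l' := I ++ F') (append_nodup_left (nodup_arcs A X u) hl)
          fun w hw => List.mem_append.2 (g7 w hw)
        rw [List.length_append] at h
        omega
      refine ⟨F', g1, g2, g3, g4, g5.congr rfl rfl rfl, g6, fun hF' j h hj w hw => ?_, ?_⟩
      · rcases Nat.lt_succ_iff_lt_or_eq.1 hj with hj | rfl
        · exact (h7 hF2 j h hj w hw).imp id fun h => g0 h
        · rcases hhalt with rfl | hhalt
          · rw [← hu, hl, List.append_nil] at hw
            exact g7 w hw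
          · simp only [test_lt, val_var, val_zero, val_one, val_two, hcnt'.1] at hhalt
            omega
      · simp only [St.tick_time]
        omega
    · rintro τ' ⟨F', g1, g2, g3, g4, g5, g6, g7, g8⟩
      simp only [wp_assign, val_add, val_var, val_zero, val_one, val_two, wp_nil_iff]
      refine ⟨m - 1, by omega, d + 1, F', by omega, by simp [g1, Nat.add_assoc], ?_, g3, g4,
        g5.congr (by simp) (by simp) (by simp), g6, g7, ?_⟩
      · intro r hr
        have := g2 r hr
        simp only [List.mem_cons, not_or] at hr
        simp [hr, this]
      · rw [Nat.succ_mul]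
        simp only [St.set_time]
        omega
  · rintro m τ ⟨d, F, hm, h1, h2, h3, h4, h5, h6, h7, h8⟩ htest
    have hcnt := h5.length
    have hsτ : τ.reg .s = I.length := by rw [h2 _ (by simp), hs]
    simp only [test_and, test_lt, val_var, val_zero, val_one, val_two, h1, hsτ, hcnt.1] at htest
    rw [wp_nil_iff]
    refine ⟨h2, h3, h4, ?_, ?_⟩
    · have hall : F.length < 2 → ∀ w, IsNbr G X I w → w ∈ F := by
        rintro hF w ⟨hw1, hw2, a, ha, haw⟩
        obtain ⟨j, hj, rfl⟩ := List.getElem_of_mem ha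
        exact (h7 hF j hj (by omega) w (mem_arcs.2 ⟨hw1, haw⟩)).resolve_left hw2
      rcases h5 with ⟨rfl, hc⟩ | ⟨x, rfl, hc, hx⟩ | ⟨x, y, hxy, rfl, hc, hx, hy⟩
      · exact .inl ⟨hc, fun w hw => by simpa using hall (by simp) w hw⟩
      · exact .inr (.inl ⟨x, hc, hx, h6 x (by simp), fun w hw => by
          simpa using hall (by simp) w hw⟩)
      · exact .inr (.inr ⟨x, y, hxy, hc, hx, hy, h6 x (by simp), h6 y (by simp)⟩)
    · have : d * B ≤ (I.length - i₀) * B := Nat.mul_le_mul_right _ (by omega)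
      simp only [St.tick_time]
      omega

end Blocks

end Graphlet


namespace Graphlet

set_option linter.unusedSimpArgs false

section Searches

variable {n : ℕ} {G : SimpleGraph (Fin n)} {A : AdjLists G} {X : Finset (Fin n)}
  {I : List (Fin n)} {D k : ℕ} {σ τ : St}

local notation "wpG" => wp (arrLen n (numEdges G))

/-- Only the arrays in `ts` may have changed. -/
def KeepMem (ts : List Arr) (σ τ : St) : Prop := ∀ t, t ∉ ts → τ.mem t = σ.mem t

/-! ### Frame conditions for registers and arrays. -/

section Keep

variable {rs : List Var} {ts : List Arr} {r : Var} {t : Arr} {i v : ℕ}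

theorem Keep.refl : Keep rs σ σ := fun _ _ => rfl

theorem Keep.trans {ρ : St} (h : Keep rs σ τ) (h' : Keep rs τ ρ) : Keep rs σ ρ :=
  fun r hr => (h' r hr).trans (h r hr)

theorem Keep.mono {rs' : List Var} (h : Keep rs σ τ) (hs : rs ⊆ rs') : Keep rs' σ τ :=
  fun r hr => h r fun hr' => hr (hs hr')

@[simp] theorem keep_set (h : r ∈ rs) : Keep rs σ (τ.set r v) ↔ Keep rs σ τ := by
  refine forall₂_congr fun r' hr' => ?_
  have : r' ≠ r := fun e => hr' (e ▸ h)
  simp [this]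

@[simp] theorem keep_put : Keep rs σ (τ.put t i v) ↔ Keep rs σ τ := Iff.rfl
@[simp] theorem keep_tick : Keep rs σ τ.tick ↔ Keep rs σ τ := Iff.rfl
@[simp] theorem keep_print : Keep rs σ (τ.print v) ↔ Keep rs σ τ := Iff.rfl

theorem KeepMem.refl : KeepMem ts σ σ := fun _ _ => rfl

theorem KeepMem.trans {ρ : St} (h : KeepMem ts σ τ) (h' : KeepMem ts τ ρ) : KeepMem ts σ ρ :=
  fun r hr => (h' r hr).trans (h r hr)

theorem KeepMem.mono {ts' : List Arr} (h : KeepMem ts σ τ) (hs : ts ⊆ ts') : KeepMem ts' σ τ :=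
  fun r hr => h r fun hr' => hr (hs hr')

@[simp] theorem keepMem_put (h : t ∈ ts) : KeepMem ts σ (τ.put t i v) ↔ KeepMem ts σ τ := by
  refine forall₂_congr fun t' ht' => ?_
  have : t' ≠ t := fun e => ht' (e ▸ h)
  simp [this]

@[simp] theorem keepMem_set : KeepMem ts σ (τ.set r v) ↔ KeepMem ts σ τ := Iff.rfl
@[simp] theorem keepMem_tick : KeepMem ts σ τ.tick ↔ KeepMem ts σ τ := Iff.rfl
@[simp] theorem keepMem_print : KeepMem ts σ (τ.print v) ↔ KeepMem ts σ τ := Iff.rfl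

end Keep

theorem MRep.of_keepMem (hM : MRep A X I σ.mem)
    (h : KeepMem [.seen, .queue, .disc, .low, .cut] σ τ)
    (hseen : ∀ v : Fin n, τ.mem .seen v = 0) (hdisc : ∀ v : Fin n, τ.mem .disc v = 0) :
    MRep A X I τ.mem where
  ins := by rw [h .ins (by simp)]; exact hM.ins
  isIn := by rw [h .isIn (by simp)]; exact hM.isIn
  seen := hseen
  disc := hdisc
  dst := by rw [h .dst (by simp)]; exact hM.dst
  twin := by rw [h .twin (by simp)]; exact hM.twin
  linked := by rw [h .nxt (by simp), h .prv (by simp)]; exact hM.linked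

/-! ### Output of `In` -/

theorem wp_emitIn (hins : ∀ i (h : i < I.length), σ.mem .ins i = I[i]) (hn : I.length ≤ n)
    (hs : σ.reg .s = I.length) :
    wpG D emitIn (fun τ => Keep [.j] σ τ ∧ τ.mem = σ.mem ∧ τ.out = σ.out ++ I.map Fin.val ∧
      τ.time ≤ σ.time + 3 * I.length + 2) σ := by
  simp only [emitIn, wp_assign, val_zero]
  refine wp_loop (fun m τ => ∃ d, m + d = I.length ∧ τ.reg .j = d ∧ Keep [.j] σ τ ∧
    τ.mem = σ.mem ∧ τ.out = σ.out ++ (I.take d).map Fin.val ∧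
    τ.time ≤ σ.time + 3 * d + 1) (m := I.length) ?_ ?_ ?_
  · exact ⟨0, by simp, by simp, by simp [Keep.refl], rfl, by simp, by simp⟩
  · rintro m τ ⟨d, hm, h1, h2, h3, h4, h5⟩ htest
    have hsτ : τ.reg .s = I.length := by rw [h2 _ (by simp), hs]
    simp only [test_lt, val_var, h1, hsτ] at htest
    have hdn : d < n := by omega
    have hload : τ.mem .ins d = I[d] := by rw [h3, hins _ htest]
    simp only [wp_emit, wp_assign, wp_nil_iff, val_load, val_var, val_add, val_one, St.tick_reg,
      St.tick_mem, h1, arrLen_ins, hdn, if_true, hload, St.print_reg]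
    refine ⟨m - 1, by omega, d + 1, by omega, by simp, by simpa using h2, by simpa using h3,
      ?_, by simp; omega⟩
    rw [St.set_out, St.print_out, St.tick_out, h4, List.take_add_one, List.getElem?_eq_getElem htest,
      List.map_append, List.append_assoc]
    rfl
  · rintro m τ ⟨d, hm, h1, h2, h3, h4, h5⟩ htest
    have hsτ : τ.reg .s = I.length := by rw [h2 _ (by simp), hs]
    simp only [test_lt, val_var, h1, hsτ] at htest
    rw [wp_nil_iff]
    refine ⟨by simpa using h2, h3, ?_, by simp; omega⟩
    simp [h4, List.take_of_length_le (by omega : I.length ≤ d)]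

/-! ### Marked vertices -/

/-- The vertices in `Q` are marked in `seen` and listed in `queue`. -/
structure Marked (Q : List (Fin n)) (σ τ : St) : Prop where
  keep : KeepMem [.seen, .queue] σ τ
  seen : ∀ v : Fin n, τ.mem .seen v = if v ∈ Q then 1 else 0
  queue : ∀ i (h : i < Q.length), τ.mem .queue i = Q[i]
  q : τ.reg .q = Q.length

theorem Marked.congr {Q : List (Fin n)} {τ' : St} (h : Marked Q σ τ) (hm : τ'.mem = τ.mem)
    (hq : τ'.reg .q = τ.reg .q) : Marked Q σ τ' where
  keep := fun t ht => hm ▸ h.keep t ht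
  seen := hm ▸ h.seen
  queue := hm ▸ h.queue
  q := hq.trans h.q

theorem Marked.snoc {Q : List (Fin n)} {τ' : St} {v : Fin n} (h : Marked Q σ τ)
    (hm1 : τ'.mem .seen = Function.update (τ.mem .seen) v 1)
    (hm2 : τ'.mem .queue = Function.update (τ.mem .queue) Q.length v)
    (hm : KeepMem [.seen, .queue] τ τ') (hq : τ'.reg .q = Q.length + 1) :
    Marked (Q ++ [v]) σ τ' where
  keep := h.keep.trans hm
  seen := fun w => by
    rw [hm1, Function.update_apply, h.seen]
    by_cases hw : w = v
    · simp [hw]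
    · have : (w : ℕ) ≠ v := fun e => hw (Fin.ext e)
      simp [hw, this]
  queue := fun i hi => by
    rw [hm2, Function.update_apply]
    simp only [List.length_append, List.length_singleton] at hi
    split_ifs with hi'
    · simp [hi']
    · rw [h.queue i (by omega), List.getElem_append_left]
  q := by simp [hq]

theorem wp_clearSeen {Q : List (Fin n)} (h : Marked Q σ τ) (hnd : Q.Nodup) :
    wpG D clearSeen (fun ρ => Keep [.q] τ ρ ∧ KeepMem [.seen, .queue] σ ρ ∧
      (∀ v : Fin n, ρ.mem .seen v = 0) ∧ ρ.out = τ.out ∧ ρ.time ≤ τ.time + 3 * Q.length + 1) τ := by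
  have hn := length_le_of_nodup hnd
  refine wp_loop (fun m ρ => ∃ Q', Q'.length = m ∧ Q'.Nodup ∧ m ≤ Q.length ∧ Marked Q' σ ρ ∧
    Keep [.q] τ ρ ∧ ρ.out = τ.out ∧ ρ.time + 3 * m ≤ τ.time + 3 * Q.length)
    (m := Q.length) ⟨Q, rfl, hnd, le_rfl, h, Keep.refl, rfl, le_rfl⟩ ?_ ?_
  · rintro m ρ ⟨Q', rfl, h1, h2, h3, h4, h5, h6⟩ htest
    simp only [test_lt, val_var, val_zero, h3.q] at htest
    rcases List.eq_nil_or_concat Q' with rfl | ⟨Q'', v, rfl⟩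
    · simp at htest
    · rw [List.concat_eq_append] at *
      have hq := h3.q
      have hqu := h3.queue Q''.length (by simp)
      simp only [List.length_append, List.length_singleton] at hq h2 h6 ⊢
      have hvn : v ∉ Q'' := fun hv => (List.nodup_append.1 h1).2.2 v hv v (by simp) rfl
      have hlt : Q''.length < n := by omega
      simp only [List.getElem_concat_length] at hqu
      simp only [wp_assign, wp_store, val_sub, val_load, val_var, val_one, val_zero, St.tick_reg,
        hq, Nat.add_sub_cancel, St.set_reg, if_true, St.set_mem, St.tick_mem, arrLen_queue,
        arrLen_seen, hqu, hlt, v.isLt, wp_nil_iff]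
      refine ⟨Q''.length, by omega, Q'', rfl, (List.nodup_append.1 h1).1, by omega,
        ⟨by simpa using h3.keep, fun w => ?_, fun i hi => ?_, by simp⟩, by simpa using h4,
        by simpa using h5, by simp; omega⟩
      · have := h3.seen w
        by_cases hw : w = v
        · simp [hw, hvn]
        · have hw' : (w : ℕ) ≠ v := fun e => hw (Fin.ext e)
          simpa [hw, hw', Function.update_apply] using this
      · have := h3.queue i (by simp; omega)
        simpa [List.getElem_append_left, hi] using this
  · rintro m ρ ⟨Q', rfl, h1, h2, h3, h4, h5, h6⟩ htest
    simp only [test_lt, val_var, val_zero, h3.q] at htest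
    have : Q' = [] := List.eq_nil_of_length_eq_zero (by omega)
    subst this
    rw [wp_nil_iff]
    exact ⟨by simpa using h4, by simpa using h3.keep, fun v => by simpa using h3.seen v, h5,
      by simp; simp at h6; omega⟩

/-! ### Output of the extensions of `In` by one vertex -/

/-- Here the lists are read to their ends. This is affordable because each end vertex outside `I` is
one graphlet: a list has at most `I.length + Q.length` arcs, and each output costs `O(k)`. -/
theorem wp_emitExtensions (hM : MRep A X I σ.mem) (hnd : I.Nodup) (hIX : ∀ v ∈ I, v ∈ X)
    (hs : σ.reg .s = I.length) :
    wpG D emitExtensions (fun τ => Keep [.q, .i, .u, .a, .w, .j] σ τ ∧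
      KeepMem [.seen, .queue] σ τ ∧ (∀ v : Fin n, τ.mem .seen v = 0) ∧
      ∃ Q : List (Fin n), Q.Nodup ∧ (∀ w, w ∈ Q ↔ IsNbr G X I w) ∧
        τ.out = σ.out ++ (Q.map fun w => I ++ [w]).flatten.map Fin.val ∧
        τ.time ≤ σ.time + I.length * (4 * (I.length + Q.length) + 5) +
          Q.length * (3 * I.length + 9) + 4) σ := by
  classical
  have hn := length_le_of_nodup hnd
  -- `P` is not computed by the program. It fixes in advance the number of outputs, so that the cost
  -- `B` of a list does not depend on the progress of the loop.
  let P : List (Fin n) := (Finset.univ.filter fun w => IsNbr G X I w).toList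
  have hP : ∀ w, w ∈ P ↔ IsNbr G X I w := by simp [P]
  have hPnd : P.Nodup := Finset.nodup_toList _
  obtain ⟨B, hB⟩ : ∃ B, B = 4 * (I.length + P.length) + 5 := ⟨_, rfl⟩
  obtain ⟨C, hC⟩ : ∃ C, C = 3 * I.length + 6 := ⟨_, rfl⟩
  let S : St → List (Fin n) → Prop := fun τ Q =>
    Keep [.q, .i, .u, .a, .w, .j] σ τ ∧ Marked Q σ τ ∧ Q.Nodup ∧ (∀ w ∈ Q, IsNbr G X I w) ∧
    τ.out = σ.out ++ (Q.map fun w => I ++ [w]).flatten.map Fin.val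
  have hS : ∀ τ Q r v, r ∈ [Var.i, .u, .a, .w] → S τ Q → S (τ.set r v) Q := by
    rintro τ Q r v hr ⟨h1, h2, h3, h4, h5⟩
    have hr' : Var.q ≠ r := by rintro rfl; simp at hr
    refine ⟨?_, h2.congr rfl (by simp [hr']), h3, h4, h5⟩
    rw [keep_set]
    · exact h1
    · simp only [List.mem_cons, List.not_mem_nil] at hr ⊢
      tauto
  have hSt : ∀ τ Q, S τ Q → S τ.tick Q := fun τ Q ⟨h1, h2, h3, h4, h5⟩ =>
    ⟨by simpa using h1, h2.congr rfl rfl, h3, h4, h5⟩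
  refine wp_seq (P := fun τ => ∃ Q, S τ Q ∧ (∀ w, IsNbr G X I w → w ∈ Q) ∧
    τ.time ≤ σ.time + I.length * B + Q.length * C + 3) ?_ ?_
  · simp only [List.cons_append, List.nil_append, wp_assign, val_zero]
    refine wp_loop (fun m τ => ∃ d Q, m + d = I.length ∧ τ.reg .i = d ∧ S τ Q ∧
      (∀ j (h : j < I.length), j < d → ∀ w ∈ arcs A X I[j], w ∈ I ∨ w ∈ Q) ∧
      τ.time ≤ σ.time + d * B + Q.length * C + 2) (m := I.length) ?_ ?_ ?_
    · refine ⟨0, [], by simp, by simp, hS _ _ _ _ (by simp) ⟨by simp [Keep.refl], ⟨?_, ?_, ?_, ?_⟩,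
        by simp, by simp, by simp⟩, by simp, by simp⟩
      · exact KeepMem.refl
      · simpa using hM.seen
      · simp
      · simp
    · rintro m τ ⟨d, Q, hm, h1, h2, h3, h4⟩ htest
      have hsτ : τ.reg .s = I.length := by rw [h2.1 _ (by simp), hs]
      simp only [test_lt, val_var, h1, hsτ] at htest
      obtain ⟨u, hu⟩ : ∃ u, u = I[d] := ⟨_, rfl⟩
      have huI : u ∈ I := hu ▸ List.getElem_mem _
      have hdn : d < n := by omega
      have hload : τ.mem .ins d = u := by rw [h2.2.1.keep .ins (by simp), hM.ins _ htest, hu]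
      simp only [List.cons_append, wp_assign, val_load, val_var, St.tick_reg, h1, arrLen_ins, hdn,
        if_true, St.tick_mem, hload]
      refine wp_seq (P := fun τ' => ∃ Q', Q ⊆ Q' ∧ τ'.reg .i = d ∧ S τ' Q' ∧
        (∀ w ∈ arcs A X u, w ∈ I ∨ w ∈ Q') ∧
        τ'.time ≤ σ.time + d * B + Q'.length * C + 2 + B - 1)
        (wp_forArcs (A := A) (X := X) (u := u)
          (by simpa [h2.2.1.keep .nxt, h2.2.1.keep .prv] using hM.linked)
          (by simpa [h2.2.1.keep .dst] using hM.dst) (hIX u huI) (by simp)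
          (fun l τ' => ∃ Q', Q ⊆ Q' ∧ τ'.reg .i = d ∧ S τ' Q' ∧
            (∀ w ∈ l, w ∈ I ∨ w ∈ Q') ∧
            τ'.time ≤ σ.time + d * B + Q'.length * C + 4 * l.length + 5) ?_ ?_ ?_) ?_
      · refine ⟨Q, List.Subset.refl _, by simp [h1], ?_, by simp, by simp; omega⟩
        exact hS _ _ _ _ (by simp) (hS _ _ _ _ (by simp) (hSt _ _ h2))
      · rintro l v l' τ' hl ⟨Q', g0, g1, g2, g3, g4⟩ - hu'
        have hv : v ∈ arcs A X u := by simp [hl]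
        have hv' := mem_arcs.1 hv
        have hisIn : τ'.mem .isIn v = if v ∈ I then 1 else 0 := by
          rw [g2.2.1.keep .isIn (by simp), hM.isIn]
        have hseen := g2.2.1.seen v
        have hdst : τ'.mem .dst = A.dst := by rw [g2.2.1.keep .dst (by simp), hM.dst]
        simp only [wp_branch, test_and, test_eq, val_load, val_var, val_zero, St.set_reg,
          St.set_mem, St.tick_mem, St.tick_reg, if_true, arrLen_isIn, arrLen_seen, v.isLt, hisIn,
          hseen]
        by_cases hvI : v ∈ I ∨ v ∈ Q'
        · have hcond : ¬ ((if v ∈ I then 1 else 0) = 0 ∧ (if v ∈ Q' then 1 else 0) = 0) := by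
            rcases hvI with h | h <;> simp [h]
          simp only [hcond, if_false, List.nil_append, wp_nil_iff]
          refine ⟨by simp [hu'], by simp, rfl, hdst, Q', g0, by simp [g1], ?_, ?_,
            by simp; omega⟩
          · exact hS _ _ _ _ (by simp) (hSt _ _ (hS _ _ _ _ (by simp) (hSt _ _ g2)))
          · intro w hw
            rcases List.mem_append.1 hw with hw | hw
            · exact g3 w hw
            · exact List.mem_singleton.1 hw ▸ hvI
        · push Not at hvI
          have hvN : IsNbr G X I v := ⟨hv'.1, hvI.1, u, huI, hv'.2⟩
          have hnd' : (Q' ++ [v]).Nodup := by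
            rw [List.nodup_append]
            refine ⟨g2.2.2.1, by simp, fun a ha b hb => ?_⟩
            rintro rfl
            exact hvI.2 (List.mem_singleton.1 hb ▸ ha)
          have hQn := length_le_of_nodup hnd'
          rw [List.length_append, List.length_singleton] at hQn
          have hlt : Q'.length < n := by omega
          have hτs : τ'.reg .s = I.length := by rw [g2.1 _ (by simp), hs]
          simp only [hvI, if_false, and_self, if_true, List.cons_append, List.nil_append,
            List.append_nil, wp_store, wp_assign, val_var, val_one, val_add, arrLen_seen,
            arrLen_queue, St.set_reg, St.tick_reg, v.isLt, St.put_reg, g2.2.1.q, hlt,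
            reduceCtorEq]
          refine wp_seq (wp_emitIn (I := I) (fun i hi => ?_) hn ?_) ?_
          · simp [g2.2.1.keep .ins, hM.ins i hi]
          · simp [hτs]
          · rintro ρ ⟨r1, r2, r3, r4⟩
            have hw : ρ.reg .w = v := by rw [r1 _ (by simp)]; simp
            simp only [wp_emit, wp_nil_iff, val_var, hw]
            refine ⟨?_, ?_, ?_, ?_, Q' ++ [v], fun w hw => by simp [g0 hw], ?_, ?_, ?_, ?_⟩
            · simp [r1 .u, hu']
            · simp [r1 .a]
            · simp [r2]
            · simp [r2, hdst]
            · simp [r1 .i, g1]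
            · refine ⟨?_, ?_, hnd', ?_, ?_⟩
              · have hk : Keep [.q, .i, .u, .a, .w, .j] σ ρ :=
                  Keep.trans (by simpa using g2.1) (r1.mono (by simp))
                simpa using hk
              · refine g2.2.1.snoc (v := v) (by simp [r2]) (by simp [r2]) ?_ ?_
                · intro t ht
                  simp only [List.mem_cons, not_or] at ht
                  simp [r2, ht]
                · simp [r1 .q]
              · intro w hw
                rcases List.mem_append.1 hw with hw | hw
                · exact g2.2.2.2.1 w hw
                · exact List.mem_singleton.1 hw ▸ hvN
              · simp [r3, g2.2.2.2.2]
            · intro w hw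
              rcases List.mem_append.1 hw with hw | hw
              · exact (g3 w hw).imp id fun h => by simp [h]
              · exact .inr (by simp [List.mem_singleton.1 hw])
            · simp only [St.set_time, St.tick_time, St.put_time] at r4
              simp only [St.set_time, St.print_time, List.length_append, List.length_singleton,
                Nat.succ_mul]
              omega
      · rintro l l' τ' hl ⟨Q', g0, g1, g2, g3, g4⟩ hhalt -
        have : l' = [] := by simpa using hhalt
        subst this
        rw [List.append_nil] at hl
        have hlen : l.length ≤ I.length + P.length := by
          have h := length_le_of_subset (l' := I ++ P)
            (hl ▸ nodup_arcs A X u) fun w hw => List.mem_append.2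
              ((g3 w hw).imp id fun h => (hP w).2 (g2.2.2.2.1 w h))
          rwa [List.length_append] at h
        exact ⟨Q', g0, g1, hSt _ _ g2, hl ▸ g3, by simp only [St.tick_time]; omega⟩
      · rintro τ' ⟨Q', g0, g1, g2, g3, g4⟩
        simp only [wp_assign, val_add, val_var, val_one, wp_nil_iff]
        refine ⟨m - 1, by omega, d + 1, Q', by omega, by simp [g1], hS _ _ _ _ (by simp) g2,
          fun j h hj w hw => ?_, ?_⟩
        · rcases Nat.lt_succ_iff_lt_or_eq.1 hj with hj | rfl
          · exact (h3 j h hj w hw).imp id fun h => g0 h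
          · exact g3 w (hu ▸ hw)
        · rw [Nat.succ_mul]
          simp only [St.set_time]
          omega
    · rintro m τ ⟨d, Q, hm, h1, h2, h3, h4⟩ htest
      have hsτ : τ.reg .s = I.length := by rw [h2.1 _ (by simp), hs]
      simp only [test_lt, val_var, h1, hsτ] at htest
      have hd : d = I.length := by omega
      subst hd
      rw [wp_nil_iff]
      refine ⟨Q, hSt _ _ h2, ?_, by simp only [St.tick_time]; omega⟩
      rintro w ⟨hw1, hw2, a, ha, haw⟩
      obtain ⟨j, hj, rfl⟩ := List.getElem_of_mem ha
      exact (h3 j hj hj w (mem_arcs.2 ⟨hw1, haw⟩)).resolve_left hw2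
  · rintro τ ⟨Q, ⟨h1, h2, h3, h4, h5⟩, h6, h7⟩
    refine wp_post (wp_clearSeen h2 h3) ?_
    rintro ρ ⟨r1, r2, r3, r4, r5⟩
    have hQP : Q.length = P.length := le_antisymm
      (length_le_of_subset h3 fun w hw => (hP w).2 (h4 w hw))
      (length_le_of_subset hPnd fun w hw => h6 w ((hP w).1 hw))
    refine ⟨h1.trans (r1.mono (by simp)), r2, r3, Q, h3, fun w => ⟨h4 w, h6 w⟩,
      r4.trans h5, ?_⟩
    rw [hQP, ← hB]
    rw [hQP] at h7 r5
    have e : P.length * (3 * I.length + 9) = P.length * C + P.length * 3 := by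
      rw [hC, ← Nat.mul_add]
    omega

end Searches

end Graphlet


namespace Graphlet

set_option linter.unusedSimpArgs false

section Mandatory

variable {n : ℕ} {G : SimpleGraph (Fin n)} {A : AdjLists G} {X : Finset (Fin n)}
  {I : List (Fin n)} {D k : ℕ} {σ τ : St}

local notation "wpG" => wp (arrLen n (numEdges G))

/-! ### The test whether a vertex is mandatory -/

/-- The set found by the search stays connected and avoids `z`. If it reaches `k` vertices it
witnesses `Rich`; if the queue runs empty before, it is the whole component of `In` without `z`. The
list found is `P ++ R`, of which `P` has been scanned. -/
theorem wp_testMandatory {z : Fin n} (hM : MRep A X I σ.mem) (hnd : I.Nodup)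
    (hIX : ∀ v ∈ I, v ∈ X) (hc : Conn G I.toFinset) (hs : σ.reg .s = I.length)
    (hk : σ.reg .k = k) (hIk : I.length ≤ k) (hkn : k ≤ n) (hz : σ.reg .z = z) (hzI : z ∉ I) :
    wpG D testMandatory (fun τ => Keep [.q, .p, .u, .a, .w, .res] σ τ ∧
      KeepMem [.seen, .queue] σ τ ∧ (∀ v : Fin n, τ.mem .seen v = 0) ∧ τ.out = σ.out ∧
      (τ.reg .res = 0 ∧ Rich G k (X.erase z) I.toFinset ∨
        τ.reg .res = 1 ∧ ¬ Rich G k (X.erase z) I.toFinset) ∧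
      τ.time ≤ σ.time + k * (7 * k + 20) + 9) σ := by
  obtain ⟨B, hB⟩ : ∃ B, B = 7 * (k + 1) + 6 := ⟨_, rfl⟩
  -- what the searches preserve
  let S : St → List (Fin n) → Prop := fun τ Q =>
    Keep [.q, .p, .u, .a, .w, .res] σ τ ∧ Marked Q σ τ ∧ τ.out = σ.out
  have hS : ∀ τ Q r v, r ∈ [Var.p, .u, .a, .w] → S τ Q → S (τ.set r v) Q := by
    rintro τ Q r v hr ⟨h1, h2, h3⟩
    have hr' : Var.q ≠ r := by rintro rfl; simp at hr
    refine ⟨?_, h2.congr rfl (by simp [hr']), h3⟩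
    rw [keep_set]
    · exact h1
    · simp only [List.mem_cons, List.not_mem_nil] at hr ⊢
      tauto
  have hSt : ∀ τ Q, S τ Q → S τ.tick Q := fun τ Q ⟨h1, h2, h3⟩ =>
    ⟨by simpa using h1, h2.congr rfl rfl, h3⟩
  have hInv : ∀ Q : List (Fin n), I ⊆ Q → (∀ v ∈ Q, v ∈ X.erase z) → Q.length = k → Q.Nodup →
      Conn G Q.toFinset → Rich G k (X.erase z) I.toFinset := by
    intro Q h1 h2 h3 h4 h5
    refine ⟨Q.toFinset, fun v hv => ?_, fun v hv => ?_, h5, ?_⟩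
    · exact List.mem_toFinset.2 (h1 (List.mem_toFinset.1 hv))
    · exact h2 v (List.mem_toFinset.1 hv)
    · rw [List.toFinset_card_of_nodup h4, h3]
  simp only [testMandatory, List.cons_append, List.nil_append, wp_assign, val_zero]
  -- mark the vertices of `In`
  refine wp_loop (fun m τ => ∃ d, m + d = I.length ∧ S τ (I.take d) ∧
    τ.time ≤ σ.time + 4 * d + 1) (m := I.length) ?_ ?_ ?_
  · refine ⟨0, by simp, ⟨by simp [Keep.refl], ⟨?_, ?_, ?_, ?_⟩, by simp⟩, by simp⟩
    · exact KeepMem.refl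
    · simpa using hM.seen
    · simp
    · simp
  · rintro m τ ⟨d, hm, h2, h3⟩ htest
    have hsτ : τ.reg .s = I.length := by rw [h2.1 _ (by simp), hs]
    have hq : τ.reg .q = d := by rw [h2.2.1.q, List.length_take]; omega
    simp only [test_lt, val_var, hq, hsτ] at htest
    have hdn : d < n := by omega
    have hload : ∀ ρ : St, ρ.mem .ins = τ.mem .ins → ρ.mem .ins d = I[d] := fun ρ hρ => by
      rw [hρ, h2.2.1.keep .ins (by simp), hM.ins _ htest]
    simp only [wp_store, wp_assign, wp_nil_iff, val_load, val_var, val_add, val_one, St.tick_reg,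
      St.tick_mem, hq, arrLen_ins, arrLen_queue, arrLen_seen, hdn, if_true, St.put_reg,
      St.put_mem, reduceCtorEq, if_false, hload τ rfl, (I[d]).isLt]
    have htake : I.take (d + 1) = I.take d ++ [I[d]] := by
      rw [List.take_add_one, List.getElem?_eq_getElem htest]; rfl
    have hlen : (I.take d).length = d := by rw [List.length_take]; omega
    refine ⟨m - 1, by omega, d + 1, by omega, ⟨by simpa using h2.1, ?_, by simpa using h2.2.2⟩,
      by simp; omega⟩
    rw [htake]
    refine h2.2.1.snoc (by simp) (by simp [hlen]) ?_ (by simp [hlen])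
    intro t ht
    simp only [List.mem_cons, not_or] at ht
    simp [ht]
  · rintro m τ ⟨d, hm, h2, h3⟩ htest
    have hsτ : τ.reg .s = I.length := by rw [h2.1 _ (by simp), hs]
    have hq : τ.reg .q = d := by rw [h2.2.1.q, List.length_take]; omega
    simp only [test_lt, val_var, hq, hsτ] at htest
    have hd : d = I.length := by omega
    subst hd
    rw [List.take_length] at h2
    -- breadth-first search
    simp only [wp_assign, val_zero]
    refine wp_loop (fun m τ => ∃ P R, m + P.length = k ∧ S τ (P ++ R) ∧ τ.reg .p = P.length ∧
      I ⊆ P ++ R ∧ (P ++ R).Nodup ∧ (∀ v ∈ P ++ R, v ∈ X.erase z) ∧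
      Conn G (P ++ R).toFinset ∧ (P ++ R).length ≤ k ∧
      ((P ++ R).length < k → ∀ u ∈ P, ∀ w ∈ arcs A X u, w = z ∨ w ∈ P ++ R) ∧
      τ.time ≤ σ.time + 4 * k + P.length * B + 3) (m := k) ?_ ?_ ?_
    · refine ⟨[], I, by simp, hS _ _ _ _ (by simp) (hSt _ _ h2), by simp, List.Subset.refl _,
        by simpa using hnd, ?_, by simpa using hc, by simpa using hIk, by simp, by simp; omega⟩
      intro v hv
      refine Finset.mem_erase.2 ⟨?_, hIX v hv⟩
      rintro rfl
      exact hzI hv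
    · rintro m τ ⟨P, R, hm, g1, g2, g3, g4, g5, g6, g7, g8, g9⟩ htest
      have hkτ : τ.reg .k = k := by rw [g1.1 _ (by simp), hk]
      have hq := g1.2.1.q
      simp only [test_and, test_lt, val_var, g2, hq, hkτ] at htest
      obtain ⟨hlt, hQk⟩ := htest
      obtain _ | ⟨u, R⟩ := R
      · simp at hlt
      have huX := g5 u (by simp)
      have hPn : P.length < n := by
        simp only [List.length_append, List.length_cons] at g7
        omega
      have hload : τ.mem .queue P.length = u := by
        rw [g1.2.1.queue _ (by simp)]
        simp
      simp only [List.cons_append, wp_assign, val_load, val_var, St.tick_reg, g2, arrLen_queue,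
        hPn, if_true, St.tick_mem, hload]
      refine wp_seq (P := fun τ' => ∃ N, S τ' (P ++ u :: (R ++ N)) ∧ τ'.reg .p = P.length ∧
        (P ++ u :: (R ++ N)).Nodup ∧ (∀ v ∈ P ++ u :: (R ++ N), v ∈ X.erase z) ∧
        Conn G (P ++ u :: (R ++ N)).toFinset ∧ (P ++ u :: (R ++ N)).length ≤ k ∧
        ((P ++ u :: (R ++ N)).length < k → ∀ w ∈ arcs A X u, w = z ∨ w ∈ P ++ u :: (R ++ N)) ∧
        τ'.time ≤ τ.time + B - 1)
        (wp_forArcs (A := A) (X := X) (u := u)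
          (by simpa [g1.2.1.keep .nxt, g1.2.1.keep .prv] using hM.linked)
          (by simpa [g1.2.1.keep .dst] using hM.dst) (Finset.mem_of_mem_erase huX) (by simp)
          (fun l τ' => ∃ N, S τ' (P ++ u :: (R ++ N)) ∧ τ'.reg .p = P.length ∧
            (P ++ u :: (R ++ N)).Nodup ∧ (∀ v ∈ P ++ u :: (R ++ N), v ∈ X.erase z) ∧
            Conn G (P ++ u :: (R ++ N)).toFinset ∧ (P ++ u :: (R ++ N)).length ≤ k ∧
            (∀ w ∈ l, w = z ∨ w ∈ P ++ u :: (R ++ N)) ∧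
            τ'.time ≤ τ.time + 7 * l.length + 3) ?_ ?_ ?_) ?_
      · refine ⟨[], ?_, by simp [g2], by simpa using g4, by simpa using g5, by simpa using g6,
          by simpa using g7, by simp, by simp⟩
        rw [List.append_nil]
        exact hS _ _ _ _ (by simp) (hS _ _ _ _ (by simp) (hSt _ _ g1))
      · rintro l v l' τ' hl ⟨N, e1, e2, e3, e4, e5, e6, e7, e8⟩ hgo hu'
        have hv : v ∈ arcs A X u := by simp [hl]
        have hv' := mem_arcs.1 hv
        have hseen := e1.2.1.seen v
        have hdst : τ'.mem .dst = A.dst := by rw [e1.2.1.keep .dst (by simp), hM.dst]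
        have hzτ : τ'.reg .z = z := by rw [e1.1 _ (by simp), hz]
        have hkτ' : τ'.reg .k = k := by rw [e1.1 _ (by simp), hk]
        simp only [test_lt, val_var, e1.2.1.q, hkτ'] at hgo
        simp only [wp_branch, test_and, test_not, test_eq, val_load, val_var, val_zero,
          St.set_reg, St.set_mem, St.tick_mem, St.tick_reg, if_true, arrLen_seen, v.isLt,
          hseen, reduceCtorEq, if_false, hzτ, Fin.val_inj]
        by_cases hvQ : v = z ∨ v ∈ P ++ u :: (R ++ N)
        · have hcond : ¬ (¬ v = z ∧ (if v ∈ P ++ u :: (R ++ N) then 1 else 0) = 0) := by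
            rcases hvQ with h | h
            · simp [h]
            · simp only [h, if_true]; simp
          simp only [hcond, if_false, List.nil_append, wp_nil_iff]
          refine ⟨by simp [hu'], by simp, rfl, hdst, N, ?_, by simp [e2], e3, e4, e5, e6, ?_,
            by simp; omega⟩
          · exact hS _ _ _ _ (by simp) (hSt _ _ (hS _ _ _ _ (by simp) (hSt _ _ e1)))
          · intro w hw
            rcases List.mem_append.1 hw with hw | hw
            · exact e7 w hw
            · exact List.mem_singleton.1 hw ▸ hvQ
        · push Not at hvQ
          have hass : P ++ u :: (R ++ (N ++ [v])) = P ++ u :: (R ++ N) ++ [v] := by simp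
          have hlt' : (P ++ u :: (R ++ N)).length < n := by omega
          simp only [hvQ.2, if_false, hvQ.1, not_false_eq_true, and_self, if_true,
            List.cons_append, List.nil_append, List.append_nil, wp_store, wp_assign, val_var,
            val_one, val_add, arrLen_seen, arrLen_queue, St.set_reg, St.tick_reg, v.isLt,
            St.put_reg, e1.2.1.q, hlt', reduceCtorEq, wp_nil_iff]
          refine ⟨by simp [hu'], by simp, by simp, by simp [hdst], N ++ [v], ⟨?_, ?_, ?_⟩,
            by simp [e2], ?_, ?_, ?_, ?_, ?_, ?_⟩
          · simpa using e1.1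
          · rw [hass]
            refine e1.2.1.snoc (v := v) (by simp) (by simp) ?_ (by simp)
            intro t ht
            simp only [List.mem_cons, not_or] at ht
            simp [ht]
          · simpa using e1.2.2
          · rw [hass, List.nodup_append]
            refine ⟨e3, by simp, fun a ha b hb => ?_⟩
            rintro rfl
            exact hvQ.2 (List.mem_singleton.1 hb ▸ ha)
          · rw [hass]
            intro w hw
            rcases List.mem_append.1 hw with hw | hw
            · exact e4 w hw
            · rw [List.mem_singleton.1 hw]
              exact Finset.mem_erase.2 ⟨hvQ.1, hv'.1⟩
          · have : (P ++ u :: (R ++ (N ++ [v]))).toFinset =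
                insert v (P ++ u :: (R ++ N)).toFinset := by
              rw [hass, List.toFinset_append, Finset.union_comm]
              rfl
            rw [this]
            exact e5.insert_adj (a := u) (by simp) hv'.2
          · rw [hass, List.length_append, List.length_singleton]
            omega
          · rw [hass]
            intro w hw
            rcases List.mem_append.1 hw with hw | hw
            · exact (e7 w hw).imp id fun h => List.mem_append_left _ h
            · exact .inr (List.mem_append_right _ hw)
          · simp
            omega
      · rintro l l' τ' hl ⟨N, e1, e2, e3, e4, e5, e6, e7, e8⟩ hhalt -
        have hkτ' : τ'.reg .k = k := by rw [e1.1 _ (by simp), hk]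
        -- Scanned arcs end at `z` or at one of the at most `k` vertices found.
        have hlen : l.length ≤ k + 1 := by
          have h := length_le_of_subset (l' := z :: (P ++ u :: (R ++ N)))
            (append_nodup_left (nodup_arcs A X u) hl) fun w hw => List.mem_cons.2 (e7 w hw)
          rw [List.length_cons] at h
          omega
        refine ⟨N, hSt _ _ e1, e2, e3, e4, e5, e6, ?_, by simp only [St.tick_time]; omega⟩
        intro hQk
        rcases hhalt with rfl | hhalt
        · rw [hl, List.append_nil]
          exact e7
        · simp only [test_lt, val_var, e1.2.1.q, hkτ'] at hhalt
          exact absurd hQk hhalt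
      · rintro τ' ⟨N, e1, e2, e3, e4, e5, e6, e7, e8⟩
        simp only [wp_assign, val_add, val_var, val_one, wp_nil_iff, e2]
        have hass : (P ++ [u]) ++ (R ++ N) = P ++ u :: (R ++ N) := by simp
        refine ⟨m - 1, ?_, P ++ [u], R ++ N, ?_, hass ▸ hS _ _ _ _ (by simp) e1, by simp,
          ?_, hass ▸ e3, hass ▸ e4, hass ▸ e5, hass ▸ e6, ?_, ?_⟩
        · simp only [List.length_append, List.length_cons] at g7
          omega
        · simp only [List.length_append, List.length_cons, List.length_nil] at g7 ⊢
          omega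
        · intro w hw
          have := g3 hw
          simp only [List.mem_append, List.mem_cons] at this ⊢
          tauto
        · rw [hass]
          intro hQk' w hw x hx
          rcases List.mem_append.1 hw with hw | hw
          · refine (g8 hQk w hw x hx).imp id fun h => ?_
            simp only [List.mem_append, List.mem_cons] at h ⊢
            tauto
          · rw [List.mem_singleton.1 hw] at hx
            exact e7 hQk' x hx
        · rw [List.length_append, List.length_singleton, Nat.succ_mul P.length B]
          simp only [St.set_time]
          omega
    -- evaluation of the search
    · rintro m τ ⟨P, R, hm, g1, g2, g3, g4, g5, g6, g7, g8, g9⟩ htest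
      have hkτ : τ.reg .k = k := by rw [g1.1 _ (by simp), hk]
      have hq := g1.2.1.q
      simp only [test_and, test_lt, val_var, g2, hq, hkτ] at htest
      have hPB : P.length * B ≤ k * B := Nat.mul_le_mul_right _ (by omega)
      have hBk : k * (7 * k + 20) = k * B + 7 * k := by
        rw [hB]
        ring
      have hne : I.toFinset.Nonempty := hc.1
      simp only [wp_branch, test_lt, val_var, St.tick_reg, hq, hkτ]
      by_cases hQk : (P ++ R).length < k
      · have hR : R = [] := by
          rw [List.length_append] at hQk htest
          exact List.eq_nil_of_length_eq_zero (by omega)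
        subst hR
        rw [List.append_nil] at *
        simp only [hQk, if_true, List.cons_append, List.nil_append, wp_assign, val_one]
        refine wp_post (wp_clearSeen (Q := P) (σ := σ) ?_ g4) ?_
        · exact g1.2.1.congr rfl (by simp)
        · rintro ρ ⟨r1, r2, r3, r4, r5⟩
          have hk1 : Keep [.q, .p, .u, .a, .w, .res] σ (τ.tick.tick.set .res 1) := by
            simpa using g1.1
          refine ⟨hk1.trans (r1.mono (by simp)), r2, r3, r4.trans g1.2.2, .inr ⟨?_, ?_⟩, ?_⟩
          · rw [r1 _ (by simp)]; simp
          -- All vertices found have been scanned to the end, so `P` is closed in `X.erase z`, and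
          -- its size decides.
          · rw [rich_iff (C := P.toFinset) hne ?_ ?_ g6 ?_, List.toFinset_card_of_nodup g4]
            · omega
            · intro v hv
              exact List.mem_toFinset.2 (g3 (List.mem_toFinset.1 hv))
            · intro v hv
              exact g5 v (List.mem_toFinset.1 hv)
            · intro a ha b hb hab
              obtain ⟨hbz, hbX⟩ := Finset.mem_erase.1 hb
              exact List.mem_toFinset.2 ((g8 hQk a (List.mem_toFinset.1 ha) b
                (mem_arcs.2 ⟨hbX, hab⟩)).resolve_left hbz)
          · simp only [St.set_time, St.tick_time] at r5
            omega
      · simp only [hQk, if_false, List.cons_append, List.nil_append, wp_assign, val_zero]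
        refine wp_post (wp_clearSeen (Q := P ++ R) (σ := σ) ?_ g4) ?_
        · exact g1.2.1.congr rfl (by simp)
        · rintro ρ ⟨r1, r2, r3, r4, r5⟩
          have hk1 : Keep [.q, .p, .u, .a, .w, .res] σ (τ.tick.tick.set .res 0) := by
            simpa using g1.1
          refine ⟨hk1.trans (r1.mono (by simp)), r2, r3, r4.trans g1.2.2, .inl ⟨?_, ?_⟩, ?_⟩
          · rw [r1 _ (by simp)]; simp
          · exact hInv _ g3 g5 (by omega) g4 g6
          · simp only [St.set_time, St.tick_time] at r5
            omega

end Mandatory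

end Graphlet


namespace Graphlet

set_option linter.unusedSimpArgs false

section Branching

variable {n : ℕ} {G : SimpleGraph (Fin n)} {A : AdjLists G} {X : Finset (Fin n)}
  {I J : List (Fin n)} {D k : ℕ} {σ τ : St}

local notation "wpG" => wp (arrLen n (numEdges G))

/-! ### Changes of `In` -/

theorem wp_push {r : Var} {v : Fin n} (hM : MRep A X I σ.mem) (hnd : (I ++ [v]).Nodup)
    (hs : σ.reg .s = I.length) (hr : σ.reg r = v) :
    wpG D (push (.var r)) (fun τ => Keep [.s] σ τ ∧ τ.reg .s = I.length + 1 ∧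
      KeepMem [.ins, .isIn] σ τ ∧ MRep A X (I ++ [v]) τ.mem ∧ τ.out = σ.out ∧
      τ.time = σ.time + 3) σ := by
  have hlen := length_le_of_nodup hnd
  rw [List.length_append, List.length_singleton] at hlen
  have hlt : I.length < n := by omega
  simp only [push, wp_store, wp_assign, val_var, val_one, val_add, hs, hr, arrLen_ins,
    arrLen_isIn, hlt, v.isLt, if_true, St.put_reg, wp_nil_iff]
  refine ⟨by simp [Keep.refl], by simp, by simp [KeepMem.refl], ?_, rfl, rfl⟩
  constructor
  · intro i hi
    rw [List.length_append, List.length_singleton] at hi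
    simp only [St.set_mem, St.put_mem, reduceCtorEq, if_false, if_true, Function.update_apply]
    split_ifs with h
    · simp [h]
    · rw [hM.ins i (by omega), List.getElem_append_left]
  · intro w
    simp only [St.set_mem, St.put_mem, reduceCtorEq, if_false, if_true, Function.update_apply,
      hM.isIn, List.mem_append, List.mem_singleton, Fin.val_inj]
    by_cases h : w = v <;> simp [h]
  · simpa using hM.seen
  · simpa using hM.disc
  · simpa using hM.dst
  · simpa using hM.twin
  · simpa using hM.linked

theorem MRep.pop {mem mem' : Arr → ℕ → ℕ} {v : Fin n} (hM : MRep A X (I ++ [v]) mem)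
    (hv : v ∉ I) (h1 : mem' .isIn = Function.update (mem .isIn) v 0)
    (h2 : ∀ t, t ≠ .isIn → mem' t = mem t) : MRep A X I mem' where
  ins := fun i hi => by
    rw [h2 _ (by simp), hM.ins i (by simp; omega), List.getElem_append_left]
  isIn := fun w => by
    have := hM.isIn w
    simp only [h1, Function.update_apply, Fin.val_inj]
    by_cases h : w = v <;> simp_all
  seen := by rw [h2 _ (by simp)]; exact hM.seen
  disc := by rw [h2 _ (by simp)]; exact hM.disc
  dst := by rw [h2 _ (by simp)]; exact hM.dst
  twin := by rw [h2 _ (by simp)]; exact hM.twin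
  linked := by rw [h2 .nxt (by simp), h2 .prv (by simp)]; exact hM.linked

theorem wp_popTo (hM : MRep A X (I ++ J) σ.mem) (hnd : (I ++ J).Nodup)
    (hs : σ.reg .s = (I ++ J).length) (hs₀ : σ.reg .s₀ = I.length) :
    wpG D popTo (fun τ => MRep A X I τ.mem ∧ KeepMem [.isIn] σ τ ∧ τ.out = σ.out ∧
      τ.time ≤ σ.time + 3 * J.length + 1) σ := by
  refine wp_loop (fun m τ => ∃ J', J'.length = m ∧ m ≤ J.length ∧ MRep A X (I ++ J') τ.mem ∧
    (I ++ J').Nodup ∧ τ.reg .s = (I ++ J').length ∧ τ.reg .s₀ = I.length ∧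
    KeepMem [.isIn] σ τ ∧ τ.out = σ.out ∧ τ.time + 3 * m ≤ σ.time + 3 * J.length)
    (m := J.length) ⟨J, rfl, le_rfl, hM, hnd, hs, hs₀, KeepMem.refl, rfl, le_rfl⟩ ?_ ?_
  · rintro m τ ⟨J', rfl, h1, h2, h3, h4, h5, h6, h7, h8⟩ htest
    simp only [test_lt, val_var, h4, h5, List.length_append] at htest
    rcases List.eq_nil_or_concat J' with rfl | ⟨J', v, rfl⟩
    · simp at htest
    · simp only [List.concat_eq_append, ← List.append_assoc, List.length_append,
        List.length_singleton] at h1 h2 h3 h4 h8 ⊢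
      have hvn : v ∉ I ++ J' := fun hv => (List.nodup_append.1 h3).2.2 v hv v (by simp) rfl
      have hlen := length_le_of_nodup h3
      simp only [List.length_append, List.length_singleton] at hlen
      have hlt : I.length + J'.length < n := by omega
      have hload := h2.ins (I.length + J'.length) (by simp)
      simp only [List.getElem_append, List.length_append, lt_self_iff_false, dite_false,
        Nat.sub_self, List.getElem_singleton] at hload
      simp only [wp_assign, wp_store, wp_nil_iff, val_sub, val_load, val_var, val_one, val_zero,
        St.tick_reg, St.set_reg, if_true, St.set_mem, St.tick_mem, h4, Nat.add_sub_cancel,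
        arrLen_ins, arrLen_isIn, hlt, hload, v.isLt]
      refine ⟨J'.length, by omega, J', rfl, by omega,
        h2.pop hvn (by simp) (fun t ht => by simp [ht]), (List.nodup_append.1 h3).1, by simp,
        by simp [h5], by simpa using h6, by simpa using h7, by simp; omega⟩
  · rintro m τ ⟨J', rfl, h1, h2, h3, h4, h5, h6, h7, h8⟩ htest
    simp only [test_lt, val_var, h4, h5, List.length_append] at htest
    have : J' = [] := List.eq_nil_of_length_eq_zero (by omega)
    subst this
    rw [wp_nil_iff]
    refine ⟨by simpa using h2, h6, h7, ?_⟩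
    simp only [List.length_nil] at h8
    simp only [St.tick_time]
    omega

/-! ### Output -/

theorem Lists.append {o₁ o₂ : List ℕ} {F₁ F₂ : Finset (Finset (Fin n))}
    (h₁ : Lists o₁ (F₁ : Set (Finset (Fin n)))) (h₂ : Lists o₂ (F₂ : Set (Finset (Fin n))))
    (hd : Disjoint F₁ F₂) : Lists (o₁ ++ o₂) ((F₁ ∪ F₂ : Finset _) : Set (Finset (Fin n))) := by
  obtain ⟨L₁, a1, a2, a3, a4⟩ := h₁
  obtain ⟨L₂, b1, b2, b3, b4⟩ := h₂
  refine ⟨L₁ ++ L₂, by simp [a1, b1], ?_, ?_, ?_⟩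
  · intro l hl
    exact (List.mem_append.1 hl).elim (a2 l) (b2 l)
  · rw [List.map_append, List.nodup_append]
    refine ⟨a3, b3, fun S hS T hT => ?_⟩
    rintro rfl
    exact Finset.disjoint_left.1 hd ((a4 S).1 hS) ((b4 S).1 hT)
  · intro S
    rw [List.map_append, List.mem_append, a4, b4]
    simp

theorem Lists.singleton (hnd : I.Nodup) :
    Lists (I.map Fin.val) (({I.toFinset} : Finset (Finset (Fin n))) : Set (Finset (Fin n))) :=
  ⟨[I], by simp, by simpa using hnd, by simp, by simp⟩

theorem toFinset_append_singleton (I : List (Fin n)) (z : Fin n) :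
    (I ++ [z]).toFinset = insert z I.toFinset := by
  ext v
  simp [or_comm]

/-- The vertices of `Q` are distinct and outside `I`, so distinct ones give distinct sets. The
cardinality is what the time of the output is charged to. -/
theorem lists_extensions {Q : List (Fin n)} (hnd : I.Nodup) (hIX : ∀ v ∈ I, v ∈ X)
    (hc : Conn G I.toFinset) (hk : I.length + 1 = k) (hQ : Q.Nodup)
    (hmem : ∀ w, w ∈ Q ↔ IsNbr G X I w) :
    Lists ((Q.map fun w => I ++ [w]).flatten.map Fin.val)
      (fam G k X I.toFinset : Set (Finset (Fin n))) ∧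
    (fam G k X I.toFinset).card = Q.length := by
  have hset : (Q.map fun w => I ++ [w]).map List.toFinset = Q.map fun w => insert w I.toFinset := by
    rw [List.map_map]
    refine List.map_congr_left fun w _ => ?_
    exact toFinset_append_singleton I w
  have hnotin : ∀ w ∈ Q, w ∉ I := fun w hw => ((hmem w).1 hw).2.1
  have hinj : (Q.map fun w => insert w I.toFinset).Nodup := by
    refine List.Nodup.map_on (fun v hv w hw h => ?_) hQ
    have : v ∈ insert w I.toFinset := h ▸ Finset.mem_insert_self _ _
    rcases Finset.mem_insert.1 this with h | h
    · exact h
    · exact absurd (List.mem_toFinset.1 h) (hnotin v hv)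
  have hS : ∀ S, S ∈ (Q.map fun w => insert w I.toFinset) ↔ S ∈ fam G k X I.toFinset := by
    intro S
    rw [mem_fam_of_card_succ hc (fun v hv => hIX v (List.mem_toFinset.1 hv))
      (by rw [List.toFinset_card_of_nodup hnd, hk]), List.mem_map]
    simp only [hmem, IsNbr, List.mem_toFinset]
    constructor
    · rintro ⟨w, ⟨h1, h2, h3⟩, h4⟩
      exact ⟨w, h1, h2, h3, h4⟩
    · rintro ⟨w, h1, h2, h3, h4⟩
      exact ⟨w, ⟨h1, h2, h3⟩, h4⟩
  refine ⟨⟨Q.map fun w => I ++ [w], rfl, ?_, hset ▸ hinj, fun S => ?_⟩, ?_⟩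
  · intro l hl
    obtain ⟨w, hw, rfl⟩ := List.mem_map.1 hl
    rw [List.nodup_append]
    refine ⟨hnd, by simp, fun a ha b hb => ?_⟩
    rintro rfl
    exact hnotin w hw (List.mem_singleton.1 hb ▸ ha)
  · rw [hset]
    exact hS S
  · have : (Q.map fun w => insert w I.toFinset).toFinset = fam G k X I.toFinset := by
      ext S
      rw [List.mem_toFinset, hS]
    rw [← this, List.toFinset_card_of_nodup hinj, List.length_map]

/-! ### Specification of the enumeration procedures and of the branching. -/

/-- The effect of an enumeration procedure. -/
structure EnumPost (A : AdjLists G) (k : ℕ) (X : Finset (Fin n)) (I : List (Fin n)) (B : ℕ)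
    (σ τ : St) : Prop where
  mrep : MRep A X I τ.mem
  nxt : τ.mem .nxt = σ.mem .nxt
  prv : τ.mem .prv = σ.mem .prv
  out : ∃ o, τ.out = σ.out ++ o ∧ Lists o (fam G k X I.toFinset : Set (Finset (Fin n)))
  time : τ.time ≤ σ.time + B

theorem nodup_append_singleton {z : Fin n} (h : I.Nodup) (hz : z ∉ I) : (I ++ [z]).Nodup := by
  rw [List.nodup_append]
  refine ⟨h, by simp, fun a ha b hb => ?_⟩
  rintro rfl
  exact hz (List.mem_singleton.1 hb ▸ ha)

/-- Shared by both procedures, hence abstract in `f` and in the bounds of the two calls. The degree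
of `z` is counted in the alive graph, once for deletion and once for restoration at five steps per
arc. The links that the second call hands back are those left by the deletion, so the deletion can
be undone. -/
theorem wp_branchOn {f : Proc} {z : Fin n} {B₁ B₂ : ℕ} (hM : MRep A X I σ.mem) (hnd : I.Nodup)
    (hs : σ.reg .s = I.length) (hz : σ.reg .z = z) (hzI : z ∉ I) (hzX : z ∈ X)
    (h₁ : ∀ σ' : St, MRep A X (I ++ [z]) σ'.mem → σ'.reg .s = I.length + 1 →
      σ'.reg .k = σ.reg .k → wpG D (body f) (EnumPost A k X (I ++ [z]) B₁ σ') σ')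
    (h₂ : ∀ σ' : St, MRep A (X.erase z) I σ'.mem → σ'.reg .s = I.length →
      σ'.reg .k = σ.reg .k → wpG D (body f) (EnumPost A k (X.erase z) I B₂ σ') σ') :
    wpG (D + 1) (branchOn f) (fun τ =>
      EnumPost A k X I (B₁ + B₂ + 10 * (arcs A X z).length + 13) σ τ ∧
      Keep [.a, .b, .res] σ τ) σ := by
  simp only [branchOn, List.append_assoc]
  refine wp_seq (wp_push hM (nodup_append_singleton hnd hzI) hs hz) ?_
  rintro σ₁ ⟨k1, s1, m1, M1, o1, t1⟩
  simp only [List.cons_append, List.nil_append]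
  refine wp_call (h₁ σ₁.tick M1 s1 (k1 _ (by simp))) ?_
  rintro σ₂ ⟨M2, nx2, pv2, ⟨out₁, o2, L2⟩, t2⟩
  have hz1 : σ₁.reg .z = z := by rw [k1 _ (by simp), hz]
  simp only [wp_assign, wp_store, val_sub, val_var, val_one, val_zero, St.ret_reg, reduceCtorEq,
    if_false, s1, Nat.add_sub_cancel, St.set_reg, hz1, arrLen_isIn, z.isLt, if_true]
  obtain ⟨σ₃, hσ₃⟩ : ∃ σ₃, σ₃ = ((σ₁.ret σ₂).set .s I.length).put .isIn z 0 := ⟨_, rfl⟩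
  rw [← hσ₃]
  have M3 : MRep A X I σ₃.mem := M2.pop hzI (by simp [hσ₃]) fun t ht => by simp [hσ₃, ht]
  have s3 : σ₃.reg .s = I.length := by simp [hσ₃]
  have k3 : Keep [.res] σ σ₃ := by
    intro r hr
    simp only [List.mem_singleton] at hr
    by_cases hrs : r = .s
    · rw [hrs, s3, hs]
    · simp [hσ₃, hr, hrs, k1 r (by simpa using hrs)]
  have nx3 : σ₃.mem .nxt = σ.mem .nxt := by
    simp [hσ₃, nx2, m1 .nxt]
  have pv3 : σ₃.mem .prv = σ.mem .prv := by
    simp [hσ₃, pv2, m1 .prv]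
  have z3 : σ₃.reg .z = z := by rw [k3 _ (by simp), hz]
  have o3 : σ₃.out = σ.out ++ out₁ := by simp [hσ₃, o2, o1]
  have t3 : σ₃.time ≤ σ.time + B₁ + 7 := by
    simp only [St.tick_time] at t2
    simp only [hσ₃, St.put_time, St.set_time, St.ret_time]
    omega
  clear hσ₃
  refine wp_seq (wp_deleteVertex M3.linked hzX M3.twin z3) ?_
  rintro σ₄ ⟨e4, U4, t4⟩
  have M4 : MRep A (X.erase z) I σ₄.mem := by
    constructor
    · rw [e4.mem _ (by simp) (by simp)]; exact M3.ins
    · rw [e4.mem _ (by simp) (by simp)]; exact M3.isIn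
    · rw [e4.mem _ (by simp) (by simp)]; exact M3.seen
    · rw [e4.mem _ (by simp) (by simp)]; exact M3.disc
    · rw [e4.mem _ (by simp) (by simp)]; exact M3.dst
    · rw [e4.mem _ (by simp) (by simp)]; exact M3.twin
    · exact M3.linked.erase hzX U4
  refine wp_call (h₂ σ₄.tick M4 ?_ ?_) ?_
  · rw [St.tick_reg, e4.reg _ (by simp) (by simp), s3]
  · rw [St.tick_reg, e4.reg _ (by simp) (by simp), k3 _ (by simp)]
  rintro σ₅ ⟨M5, nx5, pv5, ⟨out₂, o5, L5⟩, t5⟩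
  have z5 : (σ₄.ret σ₅).reg .z = z := by simp [e4.reg, z3]
  rw [St.tick_mem] at nx5 pv5
  refine wp_post (wp_restoreVertex (σ := σ₄.ret σ₅) M3.linked hzX ?_ M5.twin z5) ?_
  · simpa [nx5, pv5] using U4
  rintro τ ⟨e6, nx6, pv6, t6⟩
  refine ⟨⟨?_, nx6.trans nx3, pv6.trans pv3, ⟨out₁ ++ out₂, ?_, ?_⟩, ?_⟩, ?_⟩
  · constructor
    · rw [e6.mem _ (by simp) (by simp)]; exact M5.ins
    · rw [e6.mem _ (by simp) (by simp)]; exact M5.isIn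
    · rw [e6.mem _ (by simp) (by simp)]; exact M5.seen
    · rw [e6.mem _ (by simp) (by simp)]; exact M5.disc
    · rw [e6.mem _ (by simp) (by simp)]; exact M5.dst
    · rw [e6.mem _ (by simp) (by simp)]; exact M5.twin
    · rw [nx6, pv6]; exact M3.linked
  · rw [e6.out, St.ret_out, o5, St.tick_out, e4.out, o3, List.append_assoc]
  · rw [toFinset_append_singleton] at L2
    have := L2.append L5 fam_disjoint
    rwa [← fam_split] at this
  · simp only [St.ret_time, St.tick_time] at t6 t5
    omega
  · intro r hr
    simp only [List.mem_cons, List.not_mem_nil, or_false, not_or] at hr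
    rw [e6.reg r hr.1 hr.2.1, St.ret_reg, if_neg hr.2.2, e4.reg r hr.1 hr.2.1,
      k3 r (by simpa using hr.2.2)]

end Branching

end Graphlet


namespace Graphlet

set_option linter.unusedSimpArgs false

section DepthFirstSearch

variable {n : ℕ} {G : SimpleGraph (Fin n)} {A : AdjLists G} {X : Finset (Fin n)}
  {I : List (Fin n)} {D k : ℕ} {σ τ : St}

local notation "wpG" => wp (arrLen n (numEdges G))

/-! ### Depth-first search -/

/-- The state of a depth-first search with root `r` that has visited the vertices in `Q`, in this
order, of which those in `P` are active: a finished vertex `u` is recorded with the number of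
vertices that it separates from the root. -/
structure DfsInv (G : SimpleGraph (Fin n)) (X : Finset (Fin n)) (r : Fin n) (Q : List (Fin n))
    (P : Finset (Fin n)) (mem : Arr → ℕ → ℕ) : Prop where
  nodup : Q.Nodup
  active : ∀ p ∈ P, p ∈ Q
  queue : ∀ i (h : i < Q.length), mem .queue i = Q[i]
  disc : ∀ v : Fin n, mem .disc v = if v ∈ Q then Q.idxOf v + 1 else 0
  closed : ∀ u ∈ Q, u ∉ P → ∀ w ∈ X, G.Adj u w → w ∈ Q
  cut : ∀ u ∈ Q, u ∉ P → u ≠ r → ∃ Z : Finset (Fin n), u ∈ Z ∧ r ∉ Z ∧ Z ⊆ Q.toFinset ∧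
    Disjoint Z P ∧ Conn G (Q.toFinset \ Z) ∧ Closed G (X.erase u) (Z.erase u) ∧
    Z.card = mem .cut u

/-- The vertices in `Z ⊆ E` are those found so far, after the visit of `Q` and then `E`, that `u`
separates from `Q`. -/
structure CutSet (G : SimpleGraph (Fin n)) (X : Finset (Fin n)) (Q E : List (Fin n)) (u : Fin n)
    (Z : Finset (Fin n)) : Prop where
  mem : u ∈ Z
  sub : Z ⊆ E.toFinset
  conn : Conn G ((Q ++ E).toFinset \ Z)
  closed : Closed G (X.erase u) (Z.erase u)

/-- The low-point of `w` is the least discovery number in the set `E` of its descendants and in the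
neighbourhood of `E`. -/
def IsLow (G : SimpleGraph (Fin n)) (X : Finset (Fin n)) (Q E : List (Fin n)) (l : ℕ) : Prop :=
  (∃ y ∈ Q, (y ∈ E ∨ ∃ x ∈ E, G.Adj x y) ∧ l = Q.idxOf y + 1) ∧
  ∀ x ∈ E, ∀ y ∈ X, G.Adj x y → l ≤ Q.idxOf y + 1

theorem sdiff_insert_eq {α : Type*} [DecidableEq α] {S T Z : Finset α} (h : Disjoint T Z) :
    (S ∪ T) \ Z = (S \ Z) ∪ T := by
  rw [Finset.union_sdiff_distrib, Finset.sdiff_eq_self_of_disjoint h]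

theorem idxOf_append_left {Q E : List (Fin n)} {v : Fin n} (h : v ∈ Q) :
    (Q ++ E).idxOf v = Q.idxOf v := List.idxOf_append_of_mem h

variable {r : Fin n} {Q : List (Fin n)} {P : Finset (Fin n)} {mem mem' : Arr → ℕ → ℕ}

/-- Only the connectedness of `Q \ Z` needs an argument for the larger visited set: the new vertex
hangs on an active vertex, and the sets `Z` contain no active vertices. -/
theorem DfsInv.start {u : Fin n} (h : DfsInv G X r Q P mem) (hu : u ∉ Q)
    (hadj : Q = [] ∧ u = r ∨ r ∈ Q ∧ Conn G Q.toFinset ∧ ∃ p ∈ P, G.Adj p u)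
    (hq : mem' .queue = Function.update (mem .queue) Q.length u)
    (hd : mem' .disc = Function.update (mem .disc) u (Q.length + 1))
    (hc : ∀ v ∈ Q, mem' .cut v = mem .cut v) :
    DfsInv G X r (Q ++ [u]) (insert u P) mem' where
  nodup := nodup_append_singleton h.nodup hu
  active := fun p hp => by
    rcases Finset.mem_insert.1 hp with rfl | hp
    · simp
    · simp [h.active p hp]
  queue := fun i hi => by
    rw [List.length_append, List.length_singleton] at hi
    rw [hq, Function.update_apply]
    split_ifs with hi'
    · simp [hi']
    · rw [h.queue i (by omega), List.getElem_append_left]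
  disc := fun v => by
    rw [hd, Function.update_apply]
    by_cases hv : v = u
    · subst hv
      simp [List.idxOf_append_of_notMem hu]
    · have hv' : (v : ℕ) ≠ u := fun e => hv (Fin.ext e)
      rw [if_neg hv', h.disc]
      by_cases hvQ : v ∈ Q
      · simp [hvQ, idxOf_append_left hvQ]
      · simp [hvQ, hv]
  closed := fun v hv hvP w hw hvw => by
    rw [Finset.mem_insert, not_or] at hvP
    have hvQ : v ∈ Q := by simpa [hvP.1] using hv
    exact List.mem_append_left _ (h.closed v hvQ hvP.2 w hw hvw)
  cut := fun v hv hvP hvr => by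
    rw [Finset.mem_insert, not_or] at hvP
    have hvQ : v ∈ Q := by simpa [hvP.1] using hv
    obtain ⟨Z, a1, a2, a3, a4, a5, a6, a7⟩ := h.cut v hvQ hvP.2 hvr
    have huZ : u ∉ Z := fun h => hu (List.mem_toFinset.1 (a3 h))
    refine ⟨Z, a1, a2, a3.trans ?_, ?_, ?_, a6, a7.trans (hc v hvQ).symm⟩
    · rw [toFinset_append_singleton]
      exact Finset.subset_insert _ _
    · rw [Finset.disjoint_insert_right]
      exact ⟨huZ, a4⟩
    · rw [toFinset_append_singleton, Finset.insert_sdiff_of_notMem _ huZ]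
      rcases hadj with ⟨rfl, -⟩ | ⟨-, -, p, hp, hpu⟩
      · simp at hvQ
      · exact a5.insert_adj (Finset.mem_sdiff.2 ⟨List.mem_toFinset.2 (h.active p hp),
          fun hpZ => Finset.disjoint_left.1 a4 hpZ hp⟩) hpu

theorem DfsInv.congr {u : Fin n} (h : DfsInv G X r Q P mem) (hu : u ∈ P)
    (hm : ∀ t, t ≠ .low → t ≠ .cut → mem' t = mem t)
    (hc : ∀ v : Fin n, v ≠ u → mem' .cut v = mem .cut v) : DfsInv G X r Q P mem' where
  nodup := h.nodup
  active := h.active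
  queue := hm .queue (by simp) (by simp) ▸ h.queue
  disc := hm .disc (by simp) (by simp) ▸ h.disc
  closed := h.closed
  cut := fun v hv hvP hvr => by
    rw [hc v fun e => hvP (e ▸ hu)]
    exact h.cut v hv hvP hvr

/-- When `u` becomes inactive, all its neighbours have been visited, and the set `Z` collected
during its scan becomes its record. That set consists of vertices discovered since `u`, so it avoids
the root and the active ancestors. -/
theorem DfsInv.finish {u : Fin n} {E : List (Fin n)} (h : DfsInv G X r (Q ++ E) (insert u P) mem)
    (hPQ : ∀ p ∈ P, p ∈ Q) (hrQ : u ≠ r → r ∈ Q)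
    (hu : ∀ w ∈ X, G.Adj u w → w ∈ Q ++ E)
    (hZ : u ≠ r → ∃ Z, CutSet G X Q E u Z ∧ Z.card = mem .cut u) :
    DfsInv G X r (Q ++ E) P mem where
  nodup := h.nodup
  active := fun p hp => h.active p (Finset.mem_insert_of_mem hp)
  queue := h.queue
  disc := h.disc
  closed := fun v hv hvP w hw hvw => by
    by_cases hvu : v = u
    · exact hu w hw (hvu ▸ hvw)
    · exact h.closed v hv (by simp [hvu, hvP]) w hw hvw
  cut := fun v hv hvP hvr => by
    by_cases hvu : v = u
    · subst hvu
      obtain ⟨Z, hZ, hcard⟩ := hZ hvr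
      have hQZ : ∀ x ∈ Q, x ∉ Z := fun x hx hxZ =>
        (List.nodup_append.1 h.nodup).2.2 x hx x (List.mem_toFinset.1 (hZ.sub hxZ)) rfl
      refine ⟨Z, hZ.mem, hQZ r (hrQ hvr), hZ.sub.trans ?_, ?_, hZ.conn, hZ.closed, hcard⟩
      · rw [List.toFinset_append]
        exact Finset.subset_union_right
      · rw [Finset.disjoint_left]
        exact fun x hxZ hxP => hQZ x (hPQ x hxP) hxZ
    · obtain ⟨Z, a1, a2, a3, a4, a5, a6, a7⟩ := h.cut v hv (by simp [hvu, hvP]) hvr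
      exact ⟨Z, a1, a2, a3, a4.mono_right (Finset.subset_insert _ _), a5, a6, a7⟩

theorem CutSet.start {u : Fin n} (hQ : Conn G Q.toFinset) (hu : u ∉ Q) :
    CutSet G X Q [u] u {u} where
  mem := by simp
  sub := by simp
  conn := by
    rw [toFinset_append_singleton, ← Finset.erase_eq, Finset.erase_insert (by simpa using hu)]
    exact hQ
  closed := by simp [Closed]

/-- A child with a back edge. -/
theorem CutSet.append_of_low {u v : Fin n} {E E' : List (Fin n)} {Z : Finset (Fin n)} {l : ℕ}
    (h : CutSet G X Q E u Z) (hnd : (Q ++ E ++ v :: E').Nodup)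
    (hconn : Conn G (v :: E').toFinset) (hlow : IsLow G X (Q ++ E ++ v :: E') (v :: E') l)
    (hl : l < Q.length + 1) : CutSet G X Q (E ++ v :: E') u Z where
  mem := h.mem
  sub := h.sub.trans (by rw [List.toFinset_append]; exact Finset.subset_union_left)
  conn := by
    obtain ⟨⟨y, hy, hy', rfl⟩, -⟩ := hlow
    -- A discovery number of at most `Q.length` means that `y` was visited before `u`. The subtree
    -- of the child has an edge to `y`, and `y` is not in `Z`, so the whole subtree joins the part
    -- not separated by `u`.
    have hyQ : y ∈ Q := by
      by_contra hyQ
      rw [List.append_assoc, List.idxOf_append_of_notMem hyQ] at hl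
      omega
    have hdis : Disjoint (v :: E').toFinset Z := by
      rw [Finset.disjoint_left]
      intro x hx hxZ
      refine (List.nodup_append.1 hnd).2.2 x ?_ x (List.mem_toFinset.1 hx) rfl
      exact List.mem_append_right _ (List.mem_toFinset.1 (h.sub hxZ))
    have hyE : y ∉ v :: E' := fun h =>
      (List.nodup_append.1 hnd).2.2 y (List.mem_append_left _ hyQ) y h rfl
    obtain ⟨x, hx, hxy⟩ := hy'.resolve_left hyE
    rw [← List.append_assoc, List.toFinset_append, sdiff_insert_eq hdis]
    refine h.conn.union_adj hconn (Finset.mem_sdiff.2 ⟨by simp [hyQ], fun hyZ => ?_⟩)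
      (List.mem_toFinset.2 hx) hxy.symm
    exact (List.nodup_append.1 (List.nodup_append.1 hnd).1).2.2 y hyQ y
      (List.mem_toFinset.1 (h.sub hyZ)) rfl
  closed := h.closed

/-- A child without a back edge. -/
theorem CutSet.append_of_not_low {u v : Fin n} {E E' : List (Fin n)} {Z : Finset (Fin n)} {l : ℕ}
    (h : CutSet G X Q (u :: E) u Z)
    (hD : DfsInv G X r (Q ++ u :: E ++ v :: E') (insert u P) mem)
    (hold : ∀ x ∈ Q ++ u :: E, x ∉ insert u P → ∀ w ∈ X, G.Adj x w → w ∈ Q ++ u :: E)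
    (hPQ : ∀ p ∈ P, p ∈ Q)
    (hEX : ∀ x ∈ v :: E', x ∈ X)
    (hlow : IsLow G X (Q ++ u :: E ++ v :: E') (v :: E') l)
    (hl : Q.length + 1 ≤ l) :
    CutSet G X Q (u :: E ++ v :: E') u (Z ∪ (v :: E').toFinset) ∧
    (Z ∪ (v :: E').toFinset).card = Z.card + (v :: E').length := by
  have hnd := hD.nodup
  have hdis : Disjoint Z (v :: E').toFinset := by
    rw [Finset.disjoint_left]
    intro x hxZ hx
    refine (List.nodup_append.1 hnd).2.2 x ?_ x (List.mem_toFinset.1 hx) rfl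
    exact List.mem_append_right _ (List.mem_toFinset.1 (h.sub hxZ))
  have hout : ∀ x ∈ v :: E', x ∉ Q ++ u :: E := fun x hx hx' =>
    (List.nodup_append.1 hnd).2.2 x hx' x hx rfl
  refine ⟨⟨Finset.mem_union_left _ h.mem, ?_, ?_, ?_⟩, ?_⟩
  · rw [List.toFinset_append]
    exact Finset.union_subset_union h.sub (Finset.Subset.refl _)
  · have : (Q ++ (u :: E ++ v :: E')).toFinset \ (Z ∪ (v :: E').toFinset) =
        (Q ++ u :: E).toFinset \ Z := by
      rw [← List.append_assoc, List.toFinset_append]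
      ext x
      simp only [Finset.mem_sdiff, Finset.mem_union, List.mem_toFinset, not_or]
      constructor
      · tauto
      · rintro ⟨h1, h2⟩
        exact ⟨.inl h1, h2, fun h3 => hout x h3 h1⟩
    rw [this]
    exact h.conn
  · intro a ha b hb hab
    obtain ⟨hbu, hbX⟩ := Finset.mem_erase.1 hb
    obtain ⟨hau, ha⟩ := Finset.mem_erase.1 ha
    refine Finset.mem_erase.2 ⟨hbu, ?_⟩
    rcases Finset.mem_union.1 ha with ha | ha
    · exact Finset.mem_union_left _ (Finset.mem_of_mem_erase
        (h.closed a (Finset.mem_erase.2 ⟨hau, ha⟩) b hb hab))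
    · rw [List.mem_toFinset] at ha
      have haP : a ∉ insert u P := fun haP => by
        rcases Finset.mem_insert.1 haP with h | h
        · exact hau h
        · exact hout a ha (List.mem_append_left _ (hPQ a h))
      -- A neighbour `b ≠ u` of the subtree has been visited. It cannot be an active ancestor, as
      -- the low-point would then be below that of `u`. It cannot have been finished before the
      -- child was found, as `a` would then have been visited earlier. So it is in the subtree.
      have hbQ := hD.closed a (List.mem_append_right _ ha) haP b hbX hab
      rcases List.mem_append.1 hbQ with hbQ | hbE
      · by_cases hbP : b ∈ insert u P
        · have hbP : b ∈ P := (Finset.mem_insert.1 hbP).resolve_left hbu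
          have := hlow.2 a ha b hbX hab
          rw [List.append_assoc, idxOf_append_left (hPQ b hbP)] at this
          have := List.idxOf_lt_length_iff.2 (hPQ b hbP)
          omega
        · exact absurd (hold b hbQ hbP a (hEX a ha) hab.symm) (hout a ha)
      · exact Finset.mem_union_right _ (List.mem_toFinset.2 hbE)
  · rw [Finset.card_union_of_disjoint hdis,
      List.toFinset_card_of_nodup (List.nodup_append.1 hnd).2.1]

/-- The partial computation of the low-point of `u`, whose neighbours in `l` and whose proper
descendants `N` have been treated. -/
def PartLow (G : SimpleGraph (Fin n)) (X : Finset (Fin n)) (Q : List (Fin n)) (u : Fin n)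
    (N l : List (Fin n)) (b : ℕ) : Prop :=
  (∃ y ∈ Q, (y ∈ u :: N ∨ ∃ x ∈ u :: N, G.Adj x y) ∧ b = Q.idxOf y + 1) ∧
  (∀ y ∈ l, b ≤ Q.idxOf y + 1) ∧ ∀ x ∈ N, ∀ y ∈ X, G.Adj x y → b ≤ Q.idxOf y + 1

theorem PartLow.visited {u v : Fin n} {N l : List (Fin n)} {b : ℕ} (h : PartLow G X Q u N l b)
    (hv : v ∈ Q) (huv : G.Adj u v) : PartLow G X Q u N (l ++ [v]) (min b (Q.idxOf v + 1)) := by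
  refine ⟨?_, fun y hy => ?_, fun x hx y hy hxy => (min_le_left _ _).trans (h.2.2 x hx y hy hxy)⟩
  · rcases min_choice b (Q.idxOf v + 1) with he | he
    · rw [he]
      exact h.1
    · exact ⟨v, hv, .inr ⟨u, by simp, huv⟩, he⟩
  · rcases List.mem_append.1 hy with hy | hy
    · exact (min_le_left _ _).trans (h.2.1 y hy)
    · rw [List.mem_singleton.1 hy]
      exact min_le_right _ _

/-- Appending the subtree of the child leaves the positions of older vertices in the visiting order
unchanged, so the old minimum and the minimum of the child combine. -/
theorem PartLow.child {u v : Fin n} {N N' l : List (Fin n)} {b b' : ℕ}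
    (h : PartLow G X Q u N l b) (hl : ∀ y ∈ l, y ∈ Q)
    (hN : ∀ x ∈ N, ∀ y ∈ X, G.Adj x y → y ∈ Q) (huX : u ∈ X) (huQ : u ∈ Q) (huv : G.Adj u v)
    (hv : v ∉ Q) (h' : IsLow G X (Q ++ v :: N') (v :: N') b') :
    PartLow G X (Q ++ v :: N') u (N ++ v :: N') (l ++ [v]) (min b b') := by
  refine ⟨?_, fun y hy => ?_, fun x hx y hy hxy => ?_⟩
  · rcases min_choice b b' with he | he
    · obtain ⟨y, hy, hy', e⟩ := h.1
      refine ⟨y, List.mem_append_left _ hy, ?_, by rw [he, idxOf_append_left hy, e]⟩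
      rcases hy' with hy' | ⟨x, hx, hxy⟩
      · exact .inl (List.mem_append_left (as := u :: N) _ hy')
      · exact .inr ⟨x, List.mem_append_left (as := u :: N) _ hx, hxy⟩
    · obtain ⟨y, hy, hy', e⟩ := h'.1
      refine ⟨y, hy, ?_, by rw [he, e]⟩
      rcases hy' with hy' | ⟨x, hx, hxy⟩
      · exact .inl (List.mem_append_right (u :: N) hy')
      · exact .inr ⟨x, List.mem_append_right (u :: N) hx, hxy⟩
  · rcases List.mem_append.1 hy with hy | hy
    · rw [idxOf_append_left (hl y hy)]
      exact (min_le_left _ _).trans (h.2.1 y hy)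
    · rw [List.mem_singleton.1 hy]
      -- The tree edge back to `u` counts in the low-point of the child, which is therefore at most
      -- the discovery number of `u`. The strict comparison in the program keeps this edge from
      -- counting as a back edge past `u`.
      have h1 := h'.2 v (by simp) u huX huv.symm
      rw [idxOf_append_left huQ] at h1
      have h2 := List.idxOf_lt_length_iff.2 huQ
      rw [List.idxOf_append_of_notMem hv]
      exact (min_le_right _ _).trans (by omega)
  · rcases List.mem_append.1 hx with hx | hx
    · rw [idxOf_append_left (hN x hx y hy hxy)]
      exact (min_le_left _ _).trans (h.2.2 x hx y hy hxy)
    · exact (min_le_right _ _).trans (h'.2 x hx y hy hxy)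

/-- The outcome of the search from `w`. -/
def DfsPost (G : SimpleGraph (Fin n)) (X C : Finset (Fin n)) (r : Fin n) (Q : List (Fin n))
    (P : Finset (Fin n)) (w : Fin n) (K : ℕ) (σ τ : St) : Prop :=
  ∃ N : List (Fin n), τ.reg .res = (Q ++ w :: N).length ∧
    DfsInv G X r (Q ++ w :: N) P τ.mem ∧ (∀ v ∈ N, v ∈ C) ∧ Conn G (w :: N).toFinset ∧
    IsLow G X (Q ++ w :: N) (w :: N) (τ.mem .low w) ∧
    (∀ v ∈ Q, τ.mem .low v = σ.mem .low v ∧ τ.mem .cut v = σ.mem .cut v) ∧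
    KeepMem [.queue, .disc, .low, .cut] σ τ ∧ τ.out = σ.out ∧
    τ.time ≤ σ.time + (N.length + 1) * K

theorem wp_cons {len : Arr → ℕ} {c : Cmd} {cs : List Cmd} {R S : St → Prop}
    (h : wp len D [c] R σ) (hS : ∀ τ, R τ → wp len D cs S τ) : wp len D (c :: cs) S σ :=
  wp_seq h hS

theorem wp_lowerLow {e : Expr} {u : Fin n} (hu : σ.reg .u = u) :
    wpG D [.branch (.lt e (.load .low (.var .u))) [.store .low (.var .u) e] []]
      (fun τ => τ.reg = σ.reg ∧ KeepMem [.low] σ τ ∧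
        (∀ v : Fin n, v ≠ u → τ.mem .low v = σ.mem .low v) ∧
        τ.mem .low u = min (σ.mem .low u) (σ.val (arrLen n (numEdges G)) e) ∧
        τ.out = σ.out ∧ τ.time ≤ σ.time + 2) σ := by
  simp only [wp_branch, test_lt, val_load, val_var, hu, arrLen_low, u.isLt, if_true]
  split_ifs with h
  · have he : σ.tick.val (arrLen n (numEdges G)) e = σ.val (arrLen n (numEdges G)) e := rfl
    simp only [List.append_nil, wp_store, val_var, St.tick_reg, hu, arrLen_low, u.isLt, if_true,
      wp_nil_iff, he]
    refine ⟨rfl, by simp [KeepMem.refl], fun v hv => ?_, ?_, rfl, by simp⟩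
    · have hv' : (v : ℕ) ≠ u := fun e => hv (Fin.ext e)
      simp [hv']
    · simp only [St.put_mem, if_true, Function.update_self]
      omega
  · rw [List.append_nil, wp_nil_iff]
    refine ⟨rfl, KeepMem.refl, fun v hv => rfl, ?_, rfl, by simp⟩
    rw [St.tick_mem]
    omega

/-- Induction on the stack depth still available, which is enough since each nested call has visited
at least one more vertex. Every visited vertex pays `K` for its own list of at most `Δ` arcs; `C`
confines the search to the small component. Old vertices keep their `low` and `cut`, so the partial
values of the caller survive a nested call. -/
theorem wp_dfs {C : Finset (Fin n)} {Δ : ℕ} (hC : Closed G X C) (hCX : C ⊆ X)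
    (hCΔ : C.card ≤ Δ) (D : ℕ) (σ : St) (Q : List (Fin n)) (P : Finset (Fin n)) (u : Fin n)
    (hD : n ≤ Q.length + D) (hinv : DfsInv G X r Q P σ.mem) (hQC : ∀ v ∈ Q, v ∈ C)
    (huC : u ∈ C) (huQ : u ∉ Q)
    (hadj : Q = [] ∧ u = r ∨ r ∈ Q ∧ Conn G Q.toFinset ∧ ∃ p ∈ P, G.Adj p u)
    (hL : Linked A X (σ.mem .nxt) (σ.mem .prv)) (hdst : σ.mem .dst = A.dst)
    (hw : σ.reg .w = u) (hres : σ.reg .res = Q.length) :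
    wpG D (body .dfs) (DfsPost G X C r Q P u (11 * Δ + 8) σ) σ := by
  induction D generalizing σ Q P u with
  | zero =>
    have := length_le_of_nodup (nodup_append_singleton hinv.nodup huQ)
    simp at this
    omega
  | succ D ih =>
    have hQn := length_le_of_nodup (nodup_append_singleton hinv.nodup huQ)
    rw [List.length_append, List.length_singleton] at hQn
    have hlt : Q.length < n := by omega
    have huX : u ∈ X := hCX huC
    obtain ⟨K, hK⟩ : ∃ K, K = 11 * Δ + 8 := ⟨_, rfl⟩
    rw [← hK] at ih ⊢
    have hne : ∀ v ∈ Q, (v : ℕ) ≠ u := fun v hv e => huQ (Fin.ext e ▸ hv)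
    have hrQ : u ≠ r → r ∈ Q ∧ Conn G Q.toFinset := fun hur =>
      (hadj.resolve_left fun h => hur h.2).imp id fun h => h.1
    simp only [body, dfsBody, List.cons_append, List.nil_append, wp_assign, wp_store, val_var,
      val_add, val_one, hw, hres, St.set_reg, arrLen_queue, hlt, if_true, reduceCtorEq, if_false,
      St.put_reg, arrLen_disc, arrLen_low, arrLen_cut, u.isLt]
    obtain ⟨σ₁, hσ₁⟩ : ∃ σ₁, σ₁ = (((((σ.set .u u).put .queue Q.length u).set .res
      (Q.length + 1)).put .disc u (Q.length + 1)).put .low u (Q.length + 1)).put .cut u 1 :=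
      ⟨_, rfl⟩
    rw [← hσ₁]
    have hk1 : KeepMem [.queue, .disc, .low, .cut] σ σ₁ := by simp [hσ₁, KeepMem.refl]
    have ho1 : σ₁.out = σ.out := by simp [hσ₁]
    have ht1 : σ₁.time = σ.time + 6 := by simp [hσ₁]
    have hu1 : σ₁.reg .u = u := by simp [hσ₁]
    have hr1 : σ₁.reg .res = Q.length + 1 := by simp [hσ₁]
    have hlow1 : σ₁.mem .low u = Q.length + 1 := by simp [hσ₁]
    have hcut1 : σ₁.mem .cut u = 1 := by simp [hσ₁]
    have hframe1 : ∀ v ∈ Q, σ₁.mem .low v = σ.mem .low v ∧ σ₁.mem .cut v = σ.mem .cut v := by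
      intro v hv
      simp [hσ₁, hne v hv]
    have hinv1 : DfsInv G X r (Q ++ [u]) (insert u P) σ₁.mem :=
      hinv.start huQ hadj (by simp [hσ₁]) (by simp [hσ₁]) fun v hv => (hframe1 v hv).2
    clear hσ₁
    refine wp_forArcs (A := A) (X := X) (u := u)
      (by rw [hk1 .nxt (by simp), hk1 .prv (by simp)]; exact hL)
      (by rw [hk1 .dst (by simp)]; exact hdst) huX hu1
      (fun l τ => ∃ N, τ.reg .res = (Q ++ u :: N).length ∧
        DfsInv G X r (Q ++ u :: N) (insert u P) τ.mem ∧ (∀ v ∈ N, v ∈ C) ∧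
        Conn G (u :: N).toFinset ∧ PartLow G X (Q ++ u :: N) u N l (τ.mem .low u) ∧
        (∀ y ∈ l, y ∈ Q ++ u :: N) ∧
        (u ≠ r → ∃ Z, CutSet G X Q (u :: N) u Z ∧ Z.card = τ.mem .cut u) ∧
        (∀ v ∈ Q, τ.mem .low v = σ.mem .low v ∧ τ.mem .cut v = σ.mem .cut v) ∧
        KeepMem [.queue, .disc, .low, .cut] σ τ ∧ τ.out = σ.out ∧
        τ.time ≤ σ.time + 11 * l.length + 7 + N.length * K) ?_ ?_ ?_
    · refine ⟨[], by simp [hr1], hinv1, by simp, by simpa using conn_singleton u, ?_, by simp,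
        fun hur => ⟨{u}, .start (hrQ hur).2 huQ, by simp [hcut1]⟩, hframe1, hk1, ho1,
        by simp [ht1]⟩
      refine ⟨⟨u, by simp, by simp, ?_⟩, by simp, by simp⟩
      rw [List.idxOf_append_of_notMem huQ]
      simp [hlow1]
    · rintro l v l' τ hl ⟨N, i1, i2, i3, i4, i5, i6, i7, i8, i9, i10, i11⟩ - hu'
      have hv : v ∈ arcs A X u := by simp [hl]
      obtain ⟨hvX, huv⟩ := mem_arcs.1 hv
      have hdisc := i2.disc v
      have huQ' : u ∈ Q ++ u :: N := by simp
      have hdst' : τ.mem .dst = A.dst := by rw [i9 _ (by simp), hdst]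
      simp only [wp_branch, test_eq, val_load, val_var, val_zero, St.set_reg, St.tick_reg,
        St.set_mem, St.tick_mem, if_true, arrLen_disc, v.isLt, hdisc]
      by_cases hvQ : v ∈ Q ++ u :: N
      -- a visited neighbour
      · simp only [hvQ, if_true, Nat.add_one_ne_zero, if_false, List.append_nil]
        refine wp_post (wp_lowerLow (u := u) (by simp [hu'])) ?_
        rintro τ' ⟨a1, a2, a3, a4, a5, a6⟩
        have hm : ∀ t, t ≠ .low → τ'.mem t = τ.mem t := fun t ht => by
          rw [a2 t (by simpa using ht)]; rfl
        simp only [St.tick_mem, St.set_mem, val_load, val_var, St.tick_reg, St.set_reg, if_true,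
          arrLen_disc, v.isLt, hdisc, hvQ] at a3 a4
        refine ⟨by simp [a1, hu'], by simp [a1], hm _ (by simp), (hm _ (by simp)).trans hdst', N,
          by simp [a1, i1], i2.congr (Finset.mem_insert_self u P) (fun t h1 h2 => hm t h1)
            (fun x _ => by rw [hm .cut (by simp)]), i3, i4, ?_, ?_, ?_, ?_, ?_,
          by simpa [a5] using i10, ?_⟩
        · rw [a4]
          exact i5.visited hvQ huv
        · intro y hy
          rcases List.mem_append.1 hy with hy | hy
          · exact i6 y hy
          · exact List.mem_singleton.1 hy ▸ hvQ
        · rw [hm .cut (by simp)]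
          exact i7
        · intro x hx
          rw [hm .cut (by simp), a3 x fun e => huQ (e ▸ hx)]
          exact i8 x hx
        · intro t ht
          rw [St.set_mem, hm t (by rintro rfl; simp at ht), i9 t ht]
        · simp only [St.set_time, St.tick_time] at a6
          simp only [St.set_time, List.length_append, List.length_singleton]
          omega
      -- a new child
      · simp only [hvQ, if_false, if_true, List.append_nil, wp_assign, val_var, St.tick_reg,
          St.set_reg, reduceCtorEq, i1]
        have hQCN : ∀ x ∈ Q ++ u :: N, x ∈ C := by
          intro x hx
          rcases List.mem_append.1 hx with hx | hx
          · exact hQC x hx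
          · rcases List.mem_cons.1 hx with rfl | hx
            · exact huC
            · exact i3 x hx
        have hvC : v ∈ C := hC u huC v hvX huv
        -- The older vertices and those found since `u` are joined by the edge from an active vertex
        -- to `u`; at the root there are no older vertices.
        have hconn : Conn G (Q ++ u :: N).toFinset := by
          rcases hadj with ⟨rfl, -⟩ | ⟨-, h1, p, hp, hpu⟩
          · exact i4
          · rw [List.toFinset_append]
            exact h1.union_adj i4 (List.mem_toFinset.2 (hinv.active p hp)) (by simp) hpu
        have hr' : r ∈ Q ++ u :: N := by
          rcases hadj with ⟨-, rfl⟩ | ⟨h1, -⟩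
          · simp
          · simp [h1]
        refine wp_call (ih _ (Q ++ u :: N) (insert u P) v ?_ i2 hQCN hvC hvQ
          (.inr ⟨hr', hconn, u, Finset.mem_insert_self u P, huv⟩) ?_ ?_ ?_ ?_) ?_
        · simp only [List.length_append, List.length_cons]
          omega
        · simp only [St.tick_mem, St.set_mem]
          rw [i9 .nxt (by simp), i9 .prv (by simp)]
          exact hL
        · simpa using hdst'
        · simp
        · simp [i1]
        rintro ρ ⟨N', j1, j2, j3, j4, j5, j6, j7, j8, j9⟩
        have hm1 : ∀ t, t ∉ [Arr.queue, .disc, .low, .cut] → ρ.mem t = τ.mem t := fun t ht => by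
          rw [j7 t ht]; rfl
        simp only [St.tick_mem, St.set_mem, St.tick_out, St.set_out] at j6 j8
        simp only [St.tick_time, St.set_time] at j9
        obtain ⟨ρ', hρ'⟩ : ∃ ρ', ρ' = ((τ.tick.set .w v).tick.set .b (Q ++ u :: N).length).ret ρ :=
          ⟨_, rfl⟩
        rw [← hρ']
        have hu'' : ρ'.reg .u = u := by simp [hρ', hu']
        have hw'' : ρ'.reg .w = v := by simp [hρ']
        have ha'' : ρ'.reg .a = τ.reg .a := by simp [hρ']
        have hb'' : ρ'.reg .b = (Q ++ u :: N).length := by simp [hρ']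
        have hres'' : ρ'.reg .res = (Q ++ u :: N ++ v :: N').length := by simp [hρ', j1]
        have hmem'' : ρ'.mem = ρ.mem := by simp [hρ']
        have hout'' : ρ'.out = σ.out := by simp [hρ', j8, i10]
        have ht'' : ρ'.time = ρ.time + 1 := by simp [hρ']
        clear hρ'
        refine wp_cons (wp_lowerLow (u := u) hu'') ?_
        rintro τ' ⟨a1, a2, a3, a4, a5, a6⟩
        rw [hmem''] at a3 a4
        have hm2 : ∀ t, t ≠ .low → τ'.mem t = ρ.mem t := fun t ht => by
          rw [a2 t (by simpa using ht), hmem'']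
        have hvlow : τ'.mem .low v = ρ.mem .low v := a3 v fun e => hvQ (e ▸ huQ')
        have hudisc : τ'.mem .disc u = Q.length + 1 := by
          rw [hm2 _ (by simp), j2.disc, if_pos (List.mem_append_left _ huQ'),
            idxOf_append_left huQ', List.idxOf_append_of_notMem huQ]
          simp
        have hucut : τ'.mem .cut u = τ.mem .cut u := by
          rw [hm2 _ (by simp), (j6 u huQ').2]
        have hulow : ρ.mem .low u = τ.mem .low u := (j6 u huQ').1
        simp only [val_load, val_var, hw'', arrLen_low, v.isLt, if_true, hmem'', hulow] at a4
        have hass : Q ++ u :: N ++ v :: N' = Q ++ u :: (N ++ v :: N') := by simp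
        rw [hass] at j1 j2 hres''
        -- what does not depend on the second test
        suffices hmain : ∀ (c : ℕ) (τ'' : St), τ''.reg = τ'.reg →
            (∀ t, t ≠ .cut → τ''.mem t = τ'.mem t) →
            (∀ x : Fin n, x ≠ u → τ''.mem .cut x = τ'.mem .cut x) →
            (u ≠ r → ∃ Z, CutSet G X Q (u :: (N ++ v :: N')) u Z ∧ Z.card = τ''.mem .cut u) →
            τ''.out = τ'.out → τ''.time ≤ τ'.time + 2 →
            (τ''.reg .u = u ∧ τ''.reg .a = τ.reg .a ∧ τ''.mem .nxt = τ.mem .nxt ∧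
              τ''.mem .dst = A.dst ∧ ∃ N, (τ''.set .a c).reg .res = (Q ++ u :: N).length ∧
              DfsInv G X r (Q ++ u :: N) (insert u P) (τ''.set .a c).mem ∧ (∀ v ∈ N, v ∈ C) ∧
              Conn G (u :: N).toFinset ∧
              PartLow G X (Q ++ u :: N) u N (l ++ [v]) ((τ''.set .a c).mem .low u) ∧
              (∀ y ∈ l ++ [v], y ∈ Q ++ u :: N) ∧
              (u ≠ r → ∃ Z, CutSet G X Q (u :: N) u Z ∧ Z.card = (τ''.set .a c).mem .cut u) ∧
              (∀ v ∈ Q, (τ''.set .a c).mem .low v = σ.mem .low v ∧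
                (τ''.set .a c).mem .cut v = σ.mem .cut v) ∧
              KeepMem [.queue, .disc, .low, .cut] σ (τ''.set .a c) ∧
              (τ''.set .a c).out = σ.out ∧ (τ''.set .a c).time ≤
                σ.time + 11 * (l ++ [v]).length + 7 + N.length * K) by
          simp only [wp_branch, test_lt, val_load, val_var, a1, hw'', hu'', arrLen_low,
            arrLen_disc, v.isLt, u.isLt, if_true, hvlow, hudisc]
          by_cases hback : ρ.mem .low v < Q.length + 1
          · simp only [hback, if_true, List.nil_append, wp_nil_iff]
            refine hmain _ τ'.tick rfl (fun _ _ => rfl) (fun _ _ => rfl) (fun hur => ?_) rfl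
              (by simp)
            obtain ⟨Z, hZ, hcard⟩ := i7 hur
            exact ⟨Z, hZ.append_of_low (by rw [hass]; exact j2.nodup) j4 j5 hback,
              by rw [hcard, St.tick_mem, hucut]⟩
          · have hres3 : τ'.reg .res = (Q ++ u :: (N ++ v :: N')).length := by rw [a1, hres'']
            simp only [hback, if_false, List.append_nil, wp_store, wp_nil_iff, val_load, val_var,
              val_add, val_sub, St.tick_reg, a1, hu'', hres'', hb'', arrLen_cut, u.isLt, if_true,
              St.tick_mem, hucut]
            refine hmain _ _ rfl (fun t ht => by simp [ht]) (fun x hx => ?_) (fun hur => ?_) rfl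
              (by simp)
            · have hx' : (x : ℕ) ≠ u := fun e => hx (Fin.ext e)
              simp [hx']
            · obtain ⟨Z, hZ, hcard⟩ := i7 hur
              have hEX : ∀ x ∈ v :: N', x ∈ X := by
                intro x hx
                rcases List.mem_cons.1 hx with rfl | hx
                · exact hvX
                · exact hCX (j3 x hx)
              obtain ⟨h1, h2⟩ := hZ.append_of_not_low (E' := N') (r := r) (P := P) (mem := ρ.mem)
                (by rw [hass]; exact j2) i2.closed hinv.active hEX j5 (by omega)
              refine ⟨_, h1, ?_⟩
              rw [h2, hcard]
              simp
              omega
        intro c τ'' b1 b2 b3 b4 b5 b6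
        have hm3 : ∀ t, t ∉ [Arr.queue, .disc, .low, .cut] → τ''.mem t = τ.mem t := by
          intro t ht
          have ht' := ht
          simp only [List.mem_cons, not_or] at ht'
          rw [b2 t ht'.2.2.2.1, hm2 t ht'.2.2.1, hm1 t ht]
        refine ⟨by rw [b1, a1, hu''], by rw [b1, a1, ha''], hm3 _ (by simp),
          (hm3 _ (by simp)).trans hdst', N ++ v :: N', by simp [b1, a1, hres''], ?_, ?_, ?_, ?_,
          ?_, b4, ?_, ?_, ?_, ?_⟩
        · refine j2.congr (Finset.mem_insert_self u P) (fun t h1 h2 => ?_) fun x hx => ?_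
          · rw [St.set_mem, b2 t h2, hm2 t h1]
          · rw [St.set_mem, b3 x hx, hm2 _ (by simp)]
        · intro x hx
          rcases List.mem_append.1 hx with hx | hx
          · exact i3 x hx
          · rcases List.mem_cons.1 hx with rfl | hx
            · exact hvC
            · exact j3 x hx
        · have : (u :: (N ++ v :: N')).toFinset = (u :: N).toFinset ∪ (v :: N').toFinset := by
            rw [← List.toFinset_append, List.cons_append]
          rw [this]
          exact i4.union_adj j4 (by simp) (by simp) huv
        · rw [St.set_mem, b2 _ (by simp), a4, ← hass]
          refine i5.child i6 (fun x hx y hy hxy => ?_) huX huQ' huv hvQ j5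
          refine i2.closed x (by simp [hx]) ?_ y hy hxy
          intro hxP
          have hnd := i2.nodup
          rcases Finset.mem_insert.1 hxP with rfl | hxP
          · exact (List.nodup_cons.1 (List.nodup_append.1 hnd).2.1).1 hx
          · exact (List.nodup_append.1 hnd).2.2 x (hinv.active x hxP) x (by simp [hx]) rfl
        · intro y hy
          rcases List.mem_append.1 hy with hy | hy
          · rw [← hass]
            exact List.mem_append_left _ (i6 y hy)
          · simp [List.mem_singleton.1 hy]
        · intro x hx
          have hxu : x ≠ u := fun e => huQ (e ▸ hx)
          have hx' : x ∈ Q ++ u :: N := List.mem_append_left _ hx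
          rw [St.set_mem, b2 _ (by simp), a3 x hxu, (j6 x hx').1, b3 x hxu, hm2 _ (by simp),
            (j6 x hx').2]
          exact i8 x hx
        · intro t ht
          rw [St.set_mem, hm3 t ht, i9 t ht]
        · rw [St.set_out, b5, a5, hout'']
        · simp only [St.set_time, List.length_append, List.length_singleton, List.length_cons]
          rw [Nat.add_mul]
          omega
    · rintro l l' τ hl ⟨N, i1, i2, i3, i4, i5, i6, i7, i8, i9, i10, i11⟩ hhalt -
      have : l' = [] := by simpa using hhalt
      subst this
      rw [List.append_nil] at hl
      -- All neighbours of `u` lie in the closed set `C`, which bounds the degree.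
      have hlen : l.length ≤ Δ := by
        rw [← List.toFinset_card_of_nodup (hl ▸ nodup_arcs A X u)]
        refine (Finset.card_le_card fun w hw => ?_).trans hCΔ
        rw [List.mem_toFinset, ← hl, mem_arcs] at hw
        exact hC u huC w hw.1 hw.2
      refine ⟨N, i1, i2.finish hinv.active (fun hur => (hrQ hur).1) (fun w hw huw => ?_) i7, i3,
        i4, ⟨i5.1, fun x hx y hy hxy => ?_⟩, i8, i9, i10, ?_⟩
      · exact i6 w (hl ▸ mem_arcs.2 ⟨hw, huw⟩)
      · rcases List.mem_cons.1 hx with rfl | hx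
        · exact i5.2.1 y (hl ▸ mem_arcs.2 ⟨hy, hxy⟩)
        · exact i5.2.2 x hx y hy hxy
      · rw [St.tick_time, Nat.add_mul, Nat.one_mul]
        omega

end DepthFirstSearch

end Graphlet


namespace Graphlet

set_option linter.unusedSimpArgs false

section MandatoryVertices

variable {n : ℕ} {G : SimpleGraph (Fin n)} {A : AdjLists G} {X C : Finset (Fin n)}
  {I : List (Fin n)} {D k Δ : ℕ} {σ τ : St}

local notation "wpG" => wp (arrLen n (numEdges G))

/-! ### The mandatory vertices -/

/-- After a complete search the visited set is the component of the root, and removing `Z` from it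
leaves the component of `In` without `w`. So `w` is mandatory iff fewer than `k` vertices remain.
Instead of adjacency to `I`, a connected `S` containing `I` and `w` is assumed, because `w` may
become a neighbour only after `In` has grown. -/
theorem DfsInv.rich_iff_cut {r w : Fin n} {N : List (Fin n)} {mem : Arr → ℕ → ℕ} {S : Finset (Fin n)}
    (h : DfsInv G X r (r :: N) ∅ mem) (hNX : ∀ v ∈ r :: N, v ∈ X) (hI : Conn G I.toFinset)
    (hIX : ∀ v ∈ I, v ∈ X) (hr : r ∈ I) (hS : Conn G S) (hIS : I.toFinset ⊆ S) (hSX : S ⊆ X)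
    (hwS : w ∈ S) (hwI : w ∉ I) :
    (r :: N).length < mem .cut w + k ↔ ¬ Rich G k (X.erase w) I.toFinset := by
  have hcl : Closed G X (r :: N).toFinset := fun a ha b hb hab =>
    List.mem_toFinset.2 (h.closed a (List.mem_toFinset.1 ha) (by simp) b hb hab)
  have hrS : r ∈ S := hIS (List.mem_toFinset.2 hr)
  have hwV : w ∈ r :: N := List.mem_toFinset.1
    (hcl.subset (I := {r}) ⟨r, by simp⟩ (by simp) hS (by simpa using hrS) hSX hwS)
  have hwr : w ≠ r := fun e => hwI (e ▸ hr)
  obtain ⟨Z, z1, z2, z3, -, z4, z5, z6⟩ := h.cut w hwV (by simp) hwr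
  -- The vertices of `Z` other than `w` have no edges out of `Z` except to `w`, so by symmetry
  -- nothing enters `Z` from the complement either.
  have hcl' : Closed G (X.erase w) ((r :: N).toFinset \ Z) := by
    intro a ha b hb hab
    obtain ⟨haV, haZ⟩ := Finset.mem_sdiff.1 ha
    refine Finset.mem_sdiff.2 ⟨hcl a haV b (Finset.mem_of_mem_erase hb) hab, fun hbZ => haZ ?_⟩
    have haw : a ≠ w := fun e => haZ (e ▸ z1)
    exact Finset.mem_of_mem_erase (z5 b (Finset.mem_erase.2 ⟨(Finset.mem_erase.1 hb).1, hbZ⟩) a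
      (Finset.mem_erase.2 ⟨haw, hNX a (List.mem_toFinset.1 haV)⟩) hab.symm)
  have hrZ : r ∈ (r :: N).toFinset \ Z := Finset.mem_sdiff.2 ⟨by simp, z2⟩
  have hIsub : I.toFinset ⊆ (r :: N).toFinset \ Z := by
    refine hcl'.subset (I := {r}) ⟨r, by simp⟩ (by simpa using z2) hI (by simpa using hr) ?_
    intro v hv
    rw [List.mem_toFinset] at hv
    exact Finset.mem_erase.2 ⟨fun e => hwI (e ▸ hv), hIX v hv⟩
  rw [rich_iff hI.1 hIsub ?_ z4 hcl', Finset.card_sdiff_of_subset z3,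
    List.toFinset_card_of_nodup h.nodup, z6]
  · have := Finset.card_le_card z3
    rw [List.toFinset_card_of_nodup h.nodup, z6] at this
    omega
  · intro v hv
    obtain ⟨hvV, hvZ⟩ := Finset.mem_sdiff.1 hv
    exact Finset.mem_erase.2 ⟨fun e => hvZ (e ▸ z1), hNX v (List.mem_toFinset.1 hvV)⟩

theorem wp_clearDisc {Q : List (Fin n)} (hnd : Q.Nodup)
    (hq : ∀ i (h : i < Q.length), σ.mem .queue i = Q[i])
    (hd : ∀ v : Fin n, v ∉ Q → σ.mem .disc v = 0) (hr : σ.reg .res = Q.length) :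
    wpG D [.loop (.lt 0 (.var .res)) [.assign .res (.sub (.var .res) 1),
      .store .disc (.load .queue (.var .res)) 0]]
      (fun τ => Keep [.res] σ τ ∧ KeepMem [.disc] σ τ ∧ (∀ v : Fin n, τ.mem .disc v = 0) ∧
        τ.out = σ.out ∧ τ.time ≤ σ.time + 3 * Q.length + 1) σ := by
  have hn := length_le_of_nodup hnd
  refine wp_loop (fun m τ => m ≤ Q.length ∧ τ.reg .res = m ∧ Keep [.res] σ τ ∧
    KeepMem [.disc] σ τ ∧ (∀ v : Fin n, v ∉ Q.take m → τ.mem .disc v = 0) ∧ τ.out = σ.out ∧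
    τ.time + 3 * m ≤ σ.time + 3 * Q.length) (m := Q.length)
    ⟨le_rfl, hr, Keep.refl, KeepMem.refl, by simpa using hd, rfl, le_rfl⟩ ?_ ?_
  · rintro m τ ⟨h0, h1, h2, h3, h4, h5, h6⟩ htest
    simp only [test_lt, val_zero, val_var, h1] at htest
    obtain ⟨m, rfl⟩ := Nat.exists_eq_add_one.2 htest
    have hlt : m < n := by omega
    have hload : τ.mem .queue m = Q[m] := by rw [h3 _ (by simp), hq m (by omega)]
    simp only [wp_assign, wp_store, val_sub, val_var, val_one, val_zero, val_load, St.tick_reg, h1,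
      Nat.add_sub_cancel, St.set_reg, if_true, arrLen_queue, arrLen_disc, hlt, St.set_mem,
      St.tick_mem, hload, (Q[m]).isLt, wp_nil_iff]
    refine ⟨m, by omega, by omega, by simp, by simpa using h2, by simpa using h3, fun v hv => ?_,
      by simpa using h5, by simp; omega⟩
    simp only [St.put_mem, if_true, Function.update_apply, St.set_mem, St.tick_mem, Fin.val_inj]
    split_ifs with hvm
    · rfl
    · refine h4 v ?_
      rw [List.take_add_one, List.getElem?_eq_getElem (by omega)]
      simp only [List.mem_append, Option.toList_some, List.mem_singleton]
      tauto
  · rintro m τ ⟨h0, h1, h2, h3, h4, h5, h6⟩ htest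
    simp only [test_lt, val_zero, val_var, h1] at htest
    have : m = 0 := by omega
    subst this
    rw [wp_nil_iff]
    exact ⟨h2, h3, by simpa using h4, h5, by simp; omega⟩

/-- The search starts with no visited and no active vertices, at the first vertex of `In`. Only
`disc` has to be cleared afterwards: `low`, `cut` and `queue` are written before they are used. -/
theorem wp_findMandatory (hM : MRep A X I σ.mem) (hne : I ≠ []) (hI : Conn G I.toFinset)
    (hIX : ∀ v ∈ I, v ∈ X) (hC : Closed G X C) (hCX : C ⊆ X) (hIC : ∀ v ∈ I, v ∈ C)
    (hCΔ : C.card ≤ Δ) (hD : n + 1 ≤ D) :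
    wpG D findMandatory (fun τ => Keep [.res, .w, .comp] σ τ ∧
      KeepMem [.queue, .disc, .low, .cut] σ τ ∧ (∀ v : Fin n, τ.mem .disc v = 0) ∧
      τ.out = σ.out ∧ (∀ S, Conn G S → I.toFinset ⊆ S → S ⊆ X → ∀ w ∈ S, w ∉ I →
        (τ.reg .comp < τ.mem .cut w + k ↔ ¬ Rich G k (X.erase w) I.toFinset)) ∧
      τ.time ≤ σ.time + Δ * (11 * Δ + 11) + 6) σ := by
  obtain ⟨r, I', rfl⟩ := List.exists_cons_of_ne_nil hne
  obtain ⟨D, rfl⟩ := Nat.exists_eq_add_one.2 (by omega : 0 < D)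
  have hr0 := hM.ins 0 (by simp)
  have hn0 : 0 < n := by have := r.isLt; omega
  simp only [findMandatory, wp_assign, val_zero, val_load, St.set_mem, arrLen_ins, hn0, if_true,
    hr0, List.getElem_cons_zero]
  refine wp_call (wp_dfs (A := A) (r := r) hC hCX hCΔ D _ [] ∅ r (by simp; omega) ?_ (by simp)
    (hIC r (by simp)) (by simp) (.inl ⟨rfl, rfl⟩) (by simpa using hM.linked)
    (by simpa using hM.dst) (by simp) (by simp)) ?_
  · exact ⟨by simp, by simp, by simp, by simpa using hM.disc, by simp, by simp⟩
  rintro ρ ⟨N, j1, j2, j3, -, -, -, j7, j8, j9⟩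
  rw [List.nil_append] at j1 j2
  simp only [St.tick_out, St.set_out, St.tick_time, St.set_time] at j8 j9
  have hNC : ∀ v ∈ r :: N, v ∈ C := by
    intro v hv
    rcases List.mem_cons.1 hv with rfl | hv
    · exact hIC v (by simp)
    · exact j3 v hv
  have hlen : (r :: N).length ≤ Δ := by
    rw [← List.toFinset_card_of_nodup j2.nodup]
    exact (Finset.card_le_card fun v hv => hNC v (List.mem_toFinset.1 hv)).trans hCΔ
  simp only [wp_assign, val_var, St.ret_reg, if_true, j1]
  refine wp_post (wp_clearDisc (Q := r :: N) j2.nodup ?_ ?_ ?_) ?_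
  · simpa using j2.queue
  · intro v hv
    simp [j2.disc v, hv]
  · simp [j1]
  rintro τ ⟨h1, h2, h3, h4, h5⟩
  refine ⟨fun x hx => ?_, fun t ht => ?_, h3, ?_, ?_, ?_⟩
  · simp only [List.mem_cons, List.not_mem_nil, or_false, not_or] at hx
    rw [h1 x (by simp [hx])]
    simp [hx]
  · rw [h2 t (by simp only [List.mem_cons, not_or] at ht ⊢; simp [ht]), St.set_mem, St.ret_mem,
      j7 t ht]
    rfl
  · rw [h4, St.set_out, St.ret_out, j8]
  · intro S hS hIS hSX w hw hwI
    rw [h1 .comp (by simp), h2 .cut (by simp)]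
    simp only [St.set_reg, if_true, St.set_mem, St.ret_mem]
    exact j2.rich_iff_cut (fun v hv => hCX (hNC v hv)) hI hIX (by simp) hS hIS hSX hw hwI
  · simp only [St.set_time, St.ret_time] at h5
    have e1 : (N.length + 1) * (11 * Δ + 8) ≤ Δ * (11 * Δ + 8) :=
      Nat.mul_le_mul_right _ (by simpa using hlen)
    have e2 : Δ * (11 * Δ + 11) = Δ * (11 * Δ + 8) + 3 * Δ := by ring
    omega

/-- The values of `cut` were computed for the old `In`, but the set of mandatory vertices is the
same for the enlarged one, so one pass suffices. Added vertices go to the end of the list and are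
scanned later in the same loop. -/
theorem wp_addMandatory (hM : MRep A X I σ.mem) (hnd : I.Nodup) (hI : Conn G I.toFinset)
    (hC : Closed G X C) (hCX : C ⊆ X) (hIC : ∀ v ∈ I, v ∈ C) (hCΔ : C.card ≤ Δ)
    (hs : σ.reg .s = I.length) (hk : σ.reg .k = k) (hIk : I.length ≤ k)
    (hmand : ∀ S, Conn G S → I.toFinset ⊆ S → S ⊆ X → ∀ w ∈ S, w ∉ I →
      (σ.reg .comp < σ.mem .cut w + k ↔ ¬ Rich G k (X.erase w) I.toFinset)) :
    wpG D addMandatory (fun τ => Keep [.i, .u, .a, .w, .s] σ τ ∧ KeepMem [.ins, .isIn] σ τ ∧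
      τ.out = σ.out ∧ (∃ J, MRep A X (I ++ J) τ.mem ∧ τ.reg .s = (I ++ J).length ∧
        (I ++ J).Nodup ∧ (∀ v ∈ I ++ J, v ∈ C) ∧ Conn G (I ++ J).toFinset ∧
        (I ++ J).length ≤ k ∧ fam G k X (I ++ J).toFinset = fam G k X I.toFinset ∧
        ((I ++ J).length < k → ∀ w, IsNbr G X (I ++ J) w →
          Rich G k (X.erase w) (I ++ J).toFinset)) ∧
      τ.time ≤ σ.time + k * (7 * Δ + 5) + 2) σ := by
  obtain ⟨B, hB⟩ : ∃ B, B = 7 * Δ + 5 := ⟨_, rfl⟩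
  rw [← hB]
  -- This predicate refers to the initial memory only, so what is known about scanned vertices
  -- remains valid while `In` grows.
  let mand : Fin n → Prop := fun w => σ.reg .comp < σ.mem .cut w + k
  let S : St → List (Fin n) → Prop := fun τ L =>
    Keep [.i, .u, .a, .w, .s] σ τ ∧ KeepMem [.ins, .isIn] σ τ ∧ τ.out = σ.out ∧
    MRep A X L τ.mem ∧ τ.reg .s = L.length ∧ L.Nodup ∧ (∀ v ∈ L, v ∈ C) ∧
    Conn G L.toFinset ∧ L.length ≤ k ∧ fam G k X L.toFinset = fam G k X I.toFinset ∧
    ∃ J, L = I ++ J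
  have hS : ∀ τ L r v, r ∈ [Var.i, .u, .a, .w] → S τ L → S (τ.set r v) L := by
    rintro τ L r v hr ⟨h1, h2, h3, h4, h5, h6⟩
    have hr' : Var.s ≠ r := by rintro rfl; simp at hr
    refine ⟨?_, h2, h3, h4, by simp [hr', h5], h6⟩
    rw [keep_set]
    · exact h1
    · simp only [List.mem_cons, List.not_mem_nil] at hr ⊢
      tauto
  have hSt : ∀ τ L, S τ L → S τ.tick L := fun τ L ⟨h1, h2, h3, h4, h5, h6⟩ =>
    ⟨by simpa using h1, h2, h3, h4, h5, h6⟩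
  simp only [addMandatory, wp_assign, val_zero]
  refine wp_loop (fun m τ => ∃ P R, m + P.length = k ∧ S τ (P ++ R) ∧ τ.reg .i = P.length ∧
    ((P ++ R).length < k → ∀ u ∈ P, ∀ w ∈ arcs A X u, w ∈ P ++ R ∨ ¬ mand w) ∧
    τ.time ≤ σ.time + P.length * B + 1) (m := k) ?_ ?_ ?_
  · refine ⟨[], I, by simp, hS _ _ _ _ (by simp) ⟨Keep.refl, KeepMem.refl, rfl, hM, hs, hnd, hIC, hI,
      hIk, rfl, [], by simp⟩, by simp, by simp, by simp⟩
  · rintro m τ ⟨P, R, hm, g1, g2, g3, g4⟩ htest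
    have hkτ : τ.reg .k = k := by rw [g1.1 _ (by simp), hk]
    have hsτ := g1.2.2.2.2.1
    simp only [test_and, test_lt, val_var, g2, hsτ, hkτ] at htest
    obtain ⟨hlt, hLk⟩ := htest
    obtain _ | ⟨u, R⟩ := R
    · simp at hlt
    have huC : u ∈ C := g1.2.2.2.2.2.2.1 u (by simp)
    have hPn : P.length < n := by
      have := length_le_of_nodup g1.2.2.2.2.2.1
      simp only [List.length_append, List.length_cons] at this
      omega
    have hload : τ.mem .ins P.length = u := by
      rw [g1.2.2.2.1.ins _ (by simp)]
      simp
    simp only [List.cons_append, wp_assign, val_load, val_var, St.tick_reg, g2, arrLen_ins,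
      hPn, if_true, St.tick_mem, hload]
    refine wp_seq (P := fun τ' => ∃ N, S τ' (P ++ u :: (R ++ N)) ∧ τ'.reg .i = P.length ∧
      ((P ++ u :: (R ++ N)).length < k → ∀ w ∈ arcs A X u,
        w ∈ P ++ u :: (R ++ N) ∨ ¬ mand w) ∧ τ'.time ≤ τ.time + B - 1)
      (wp_forArcs (A := A) (X := X) (u := u)
        (by simpa using g1.2.2.2.1.linked) (by simpa using g1.2.2.2.1.dst) (hCX huC) (by simp)
        (fun l τ' => ∃ N, S τ' (P ++ u :: (R ++ N)) ∧ τ'.reg .i = P.length ∧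
          (∀ w ∈ l, w ∈ P ++ u :: (R ++ N) ∨ ¬ mand w) ∧
          τ'.mem .nxt = σ.mem .nxt ∧
          τ'.time ≤ τ.time + 7 * l.length + 3) ?_ ?_ ?_) ?_
    · refine ⟨[], ?_, by simp [g2], by simp, by simpa using g1.2.1 .nxt (by simp), by simp⟩
      rw [List.append_nil]
      exact hS _ _ _ _ (by simp) (hS _ _ _ _ (by simp) (hSt _ _ g1))
    · rintro l v l' τ' hl ⟨N, e1, e2, e3, e4, e5⟩ hgo hu'
      have hv : v ∈ arcs A X u := by simp [hl]
      have hv' := mem_arcs.1 hv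
      have hisIn := e1.2.2.2.1.isIn v
      have hcut : τ'.mem .cut = σ.mem .cut := e1.2.1 _ (by simp)
      have hcomp : τ'.reg .comp = σ.reg .comp := e1.1 _ (by simp)
      have hkτ' : τ'.reg .k = k := by rw [e1.1 _ (by simp), hk]
      simp only [test_lt, val_var, e1.2.2.2.2.1, hkτ'] at hgo
      simp only [wp_branch, test_and, test_lt, test_eq, val_load, val_var, val_zero, val_add,
        St.set_reg, St.set_mem, St.tick_mem, St.tick_reg, if_true, arrLen_isIn, arrLen_cut, v.isLt,
        hisIn, reduceCtorEq, if_false, hkτ', hcomp, hcut]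
      by_cases hvL : v ∈ P ++ u :: (R ++ N) ∨ ¬ mand v
      · have hcond : ¬ ((if v ∈ P ++ u :: (R ++ N) then 1 else 0) = 0 ∧
            σ.reg .comp < σ.mem .cut v + k) := by
          rcases hvL with h | h
          · simp only [h, if_true]; simp
          · exact fun h' => h h'.2
        simp only [hcond, if_false, List.nil_append, wp_nil_iff]
        refine ⟨by simp [hu'], by simp, rfl, by simpa using e1.2.2.2.1.dst, N, ?_, by simp [e2], ?_,
          e4, by simp; omega⟩
        · exact hS _ _ _ _ (by simp) (hSt _ _ (hS _ _ _ _ (by simp) (hSt _ _ e1)))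
        · intro w hw
          rcases List.mem_append.1 hw with hw | hw
          · exact e3 w hw
          · exact List.mem_singleton.1 hw ▸ hvL
      · push Not at hvL
        have hvm : σ.reg .comp < σ.mem .cut v + k := hvL.2
        have hass : P ++ u :: (R ++ (N ++ [v])) = P ++ u :: (R ++ N) ++ [v] := by simp
        obtain ⟨f1, f2, f3, f4, f5, f6, f7, f8, f9, f10, J, f11⟩ := e1
        have hnd' := nodup_append_singleton f6 hvL.1
        have hconn' : Conn G (P ++ u :: (R ++ N) ++ [v]).toFinset := by
          rw [toFinset_append_singleton]
          exact f8.insert_adj (a := u) (by simp) hv'.2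
        have hvC : v ∈ C := hC u huC v hv'.1 hv'.2
        simp only [hvL.1, if_false, hvm, and_self, if_true, List.append_nil]
        refine wp_post (wp_push (A := A) (X := X) (v := v) (I := P ++ u :: (R ++ N)) ?_ hnd' ?_ ?_) ?_
        · simpa using f4
        · simpa using f5
        · simp
        rintro ρ ⟨r1, r2, r3, r4, r5, r6⟩
        refine ⟨?_, ?_, ?_, ?_, N ++ [v], ?_, ?_, ?_, ?_, ?_⟩
        · simp [r1 .u, hu']
        · simp [r1 .a]
        · simp [r3 .nxt]
        · simpa using r4.dst
        · rw [hass]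
          refine ⟨?_, ?_, ?_, r4, ?_, hnd', ?_, hconn', ?_, ?_, J ++ [v], ?_⟩
          · have : Keep [.i, .u, .a, .w, .s] σ ρ := by
              refine Keep.trans ?_ (r1.mono (by simp))
              simpa using f1
            simpa using this
          · exact KeepMem.trans (by simpa using f2) r3
          · simp [r5, f3]
          · simp [r2]; omega
          · intro w hw
            rcases List.mem_append.1 hw with hw | hw
            · exact f7 w hw
            · exact List.mem_singleton.1 hw ▸ hvC
          · rw [List.length_append, List.length_singleton]
            omega
          · rw [toFinset_append_singleton, ← f10]
            -- If `v` were not mandatory for the enlarged list, it would not be mandatory for `I`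
            -- either, contrary to the stored counts.
            refine fam_insert_of_mandatory fun hrich => ?_
            have hIL : I.toFinset ⊆ (P ++ u :: (R ++ N)).toFinset := by
              rw [f11, List.toFinset_append]
              exact Finset.subset_union_left
            have hvI : v ∉ I := fun h => hvL.1 (by rw [f11]; exact List.mem_append_left _ h)
            refine (hmand _ hconn' (hIL.trans ?_) ?_ v ?_ hvI).1 hvm (hrich.of_superset hIL)
            · rw [toFinset_append_singleton]
              exact Finset.subset_insert _ _
            · rw [toFinset_append_singleton]
              exact Finset.insert_subset hv'.1 fun w hw => hCX (f7 w (List.mem_toFinset.1 hw))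
            · simp
          · rw [f11, List.append_assoc]
        · simp [r1 .i, e2]
        · rw [hass]
          intro w hw
          rcases List.mem_append.1 hw with hw | hw
          · exact (e3 w hw).imp (fun h => List.mem_append_left _ h) id
          · exact .inl (List.mem_append_right _ hw)
        · simp [r3 .nxt, e4]
        · simp only [St.tick_time, St.set_time] at r6
          simp only [St.set_time, List.length_append, List.length_singleton]
          omega
    · rintro l l' τ' hl ⟨N, e1, e2, e3, e4, e5⟩ hhalt -
      have hkτ' : τ'.reg .k = k := by rw [e1.1 _ (by simp), hk]
      have hlen : l.length ≤ Δ := by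
        rw [← List.toFinset_card_of_nodup (append_nodup_left (nodup_arcs A X u) hl)]
        refine (Finset.card_le_card fun w hw => ?_).trans hCΔ
        have hw' : w ∈ arcs A X u := by rw [hl]; simp [List.mem_toFinset.1 hw]
        rw [mem_arcs] at hw'
        exact hC u huC w hw'.1 hw'.2
      refine ⟨N, hSt _ _ e1, e2, fun hQk => ?_, by simp only [St.tick_time]; omega⟩
      rcases hhalt with rfl | hhalt
      · rw [hl, List.append_nil]
        exact e3
      · simp only [test_lt, val_var, e1.2.2.2.2.1, hkτ'] at hhalt
        exact absurd hQk hhalt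
    · rintro τ' ⟨N, e1, e2, e3, e4⟩
      simp only [wp_assign, val_add, val_var, val_one, wp_nil_iff, e2]
      have hass : (P ++ [u]) ++ (R ++ N) = P ++ u :: (R ++ N) := by simp
      refine ⟨m - 1, ?_, P ++ [u], R ++ N, ?_, hass ▸ hS _ _ _ _ (by simp) e1, by simp, ?_, ?_⟩
      · simp only [List.length_append, List.length_cons] at hLk
        omega
      · simp only [List.length_append, List.length_cons, List.length_nil] at hLk ⊢
        omega
      · rw [hass]
        intro hQk' w hw x hx
        rcases List.mem_append.1 hw with hw | hw
        · refine (g3 hLk w hw x hx).imp (fun h => ?_) id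
          simp only [List.mem_append, List.mem_cons] at h ⊢
          tauto
        · rw [List.mem_singleton.1 hw] at hx
          exact e3 hQk' x hx
      · rw [List.length_append, List.length_singleton, Nat.succ_mul P.length B]
        simp only [St.set_time]
        omega
  · rintro m τ ⟨P, R, hm, g1, g2, g3, g4⟩ htest
    have hkτ : τ.reg .k = k := by rw [g1.1 _ (by simp), hk]
    simp only [test_and, test_lt, val_var, g2, g1.2.2.2.2.1, hkτ] at htest
    rw [wp_nil_iff]
    obtain ⟨f1, f2, f3, f4, f5, f6, f7, f8, f9, f10, J, f11⟩ := g1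
    have hPB : P.length * B ≤ k * B := Nat.mul_le_mul_right _ (by omega)
    refine ⟨f1, f2, f3, ⟨J, ?_⟩, by simp only [St.tick_time]; omega⟩
    rw [← f11]
    refine ⟨f4, f5, f6, f7, f8, f9, f10, fun hlt w hw => ?_⟩
    have hR : R = [] := by
      rw [List.length_append] at hlt htest
      exact List.eq_nil_of_length_eq_zero (by omega)
    subst hR
    rw [List.append_nil] at *
    obtain ⟨hwX, hwP, a, ha, haw⟩ := hw
    have hnm := (g3 hlt a ha w (mem_arcs.2 ⟨hwX, haw⟩)).resolve_left hwP
    have hIP : I.toFinset ⊆ P.toFinset := by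
      rw [f11, List.toFinset_append]
      exact Finset.subset_union_left
    have hPX : P.toFinset ⊆ X := fun v hv => hCX (f7 v (List.mem_toFinset.1 hv))
    have hiff := hmand (insert w P.toFinset) (f8.insert_adj (List.mem_toFinset.2 ha) haw)
      (hIP.trans (Finset.subset_insert _ _)) (Finset.insert_subset hwX hPX) w
      (Finset.mem_insert_self _ _) (fun h => hwP (by rw [f11]; exact List.mem_append_left _ h))
    have hrich : Rich G k (X.erase w) I.toFinset := by
      by_contra h
      exact hnm (hiff.2 h)
    -- The converse transfer: richness of `I` without `w` passes to the enlarged list, which is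
    -- connected and avoids `w`.
    refine hrich.superset hI.1 hIP f8 fun v hv => Finset.mem_erase.2 ⟨?_, hPX hv⟩
    rintro rfl
    exact hwP (List.mem_toFinset.1 hv)

end MandatoryVertices

end Graphlet


namespace Graphlet

set_option linter.unusedSimpArgs false

section Enumeration

variable {n : ℕ} {G : SimpleGraph (Fin n)} {A : AdjLists G} {X C : Finset (Fin n)}
  {I J : List (Fin n)} {D k : ℕ} {σ τ : St}

local notation "wpG" => wp (arrLen n (numEdges G))

/-! ### The enumeration procedures -/

theorem EnumPost.of_before {σ₁ : St} {b B B' : ℕ} (h : EnumPost A k X I B σ₁ τ)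
    (hn : σ₁.mem .nxt = σ.mem .nxt) (hp : σ₁.mem .prv = σ.mem .prv) (ho : σ₁.out = σ.out)
    (ht : σ₁.time ≤ σ.time + b) (hB : b + B ≤ B') : EnumPost A k X I B' σ τ where
  mrep := h.mrep
  nxt := h.nxt.trans hn
  prv := h.prv.trans hp
  out := by rw [← ho]; exact h.out
  time := by have := h.time; omega

theorem wp_emitIn_enumPost (hM : MRep A X I σ.mem) (hnd : I.Nodup) (hI : Conn G I.toFinset)
    (hIX : ∀ v ∈ I, v ∈ X) (hs : σ.reg .s = I.length) (hk : I.length = k) :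
    wpG D emitIn (fun τ => EnumPost A k X I (3 * k + 2) σ τ ∧ Keep [.j] σ τ) σ := by
  refine wp_post (wp_emitIn hM.ins (length_le_of_nodup hnd) hs) ?_
  rintro τ ⟨h1, h2, h3, h4⟩
  refine ⟨⟨h2 ▸ hM, by rw [h2], by rw [h2], ⟨_, h3, ?_⟩, by omega⟩, h1⟩
  rw [fam_of_card_eq hI (fun v hv => hIX v (List.mem_toFinset.1 hv))
    (by rw [List.toFinset_card_of_nodup hnd, hk])]
  exact Lists.singleton hnd

theorem wp_popTo_enumPost {B : ℕ} (hP : EnumPost A k X (I ++ J) B σ τ) (hnd : (I ++ J).Nodup)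
    (hs : τ.reg .s = (I ++ J).length) (hs₀ : τ.reg .s₀ = I.length) (hJ : J.length ≤ k)
    (hfam : fam G k X (I ++ J).toFinset = fam G k X I.toFinset) :
    wpG D popTo (EnumPost A k X I (B + 3 * k + 1) σ) τ := by
  refine wp_post (wp_popTo hP.mrep hnd hs hs₀) ?_
  rintro ρ ⟨h1, h2, h3, h4⟩
  have := hP.time
  refine ⟨h1, (h2 .nxt (by simp)).trans hP.nxt, (h2 .prv (by simp)).trans hP.prv, ?_, by omega⟩
  obtain ⟨o, ho, hL⟩ := hP.out
  exact ⟨o, h3.trans ho, hfam ▸ hL⟩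

theorem card_fam_split (X : Finset (Fin n)) (I : List (Fin n)) (z : Fin n) :
    (fam G k X I.toFinset).card = (fam G k X (I ++ [z]).toFinset).card +
      (fam G k (X.erase z) I.toFinset).card := by
  rw [toFinset_append_singleton, fam_split (z := z), Finset.card_union_of_disjoint fam_disjoint]

theorem card_fam_pos (hnd : I.Nodup) (hI : Conn G I.toFinset) (hk : I.length ≤ k)
    (h : Rich G k X I.toFinset) : 0 < (fam G k X I.toFinset).card :=
  Finset.card_pos.2 (fam_nonempty hI (by rwa [List.toFinset_card_of_nodup hnd]) h)

theorem exists_isNbr (hnd : I.Nodup) (hI : Conn G I.toFinset) (hk : I.length < k)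
    (h : Rich G k X I.toFinset) : ∃ w, IsNbr G X I w := by
  obtain ⟨S, h1, h2, h3, h4⟩ := h
  obtain ⟨a, ha, b, hb, hbI, hab⟩ := h3.exists_adj hI.1 h1
    (by rw [List.toFinset_card_of_nodup hnd]; omega)
  exact ⟨b, h2 hb, fun h => hbI (List.mem_toFinset.2 h), a, List.mem_toFinset.1 ha, hab⟩

theorem IsNbr.conn {z : Fin n} (h : IsNbr G X I z) (hI : Conn G I.toFinset) :
    Conn G (I ++ [z]).toFinset := by
  obtain ⟨-, -, a, ha, haz⟩ := h
  rw [toFinset_append_singleton]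
  exact hI.insert_adj (List.mem_toFinset.2 ha) haz

theorem IsNbr.rich {z : Fin n} (h : IsNbr G X I z) (hI : Conn G I.toFinset)
    (hIX : ∀ v ∈ I, v ∈ X) (hR : Rich G k X I.toFinset) : Rich G k X (I ++ [z]).toFinset := by
  refine hR.superset hI.1 ?_ (h.conn hI) ?_
  · rw [toFinset_append_singleton]
    exact Finset.subset_insert _ _
  · rw [toFinset_append_singleton]
    exact Finset.insert_subset h.1 fun v hv => hIX v (List.mem_toFinset.1 hv)

/-- With `N` graphlets there are `2 N - 1` nodes in a binary tree with nonempty branches, and each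
costs at most `200 k²` because the component lies in `C` with at most `2 k` vertices. The quantity
`n + 1 + X.card - I.length` bounds the depth: it drops in both calls and always leaves room for the
depth-first search. -/
theorem wp_linEnumV (D : ℕ) : ∀ (X C : Finset (Fin n)) (I : List (Fin n)) (σ : St),
    MRep A X I σ.mem → I.Nodup → Conn G I.toFinset → (∀ v ∈ I, v ∈ C) → C ⊆ X → Closed G X C →
    C.card ≤ 2 * k → Rich G k X I.toFinset → I.length ≤ k → σ.reg .s = I.length →
    σ.reg .k = k → n + 1 + X.card ≤ D + I.length →
    wpG D (body .linEnumV)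
      (EnumPost A k X I (200 * k ^ 2 * (2 * (fam G k X I.toFinset).card - 1)) σ) σ := by
  induction D with
  | zero =>
    intro X C I σ hM hnd hI hIC hCX hC hCk hR hIk hs hk hD
    have := length_le_of_nodup hnd
    omega
  | succ D ih =>
    intro X C I σ hM hnd hI hIC hCX hC hCk hR hIk hs hk hD
    have hIX : ∀ v ∈ I, v ∈ X := fun v hv => hCX (hIC v hv)
    have hne : I ≠ [] := by
      rintro rfl
      simpa using hI.1
    have hpos : 0 < I.length := List.length_pos_iff.2 hne
    have hcard : I.length ≤ X.card := by
      rw [← List.toFinset_card_of_nodup hnd]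
      exact Finset.card_le_card fun v hv => hIX v (List.mem_toFinset.1 hv)
    obtain ⟨N, hN⟩ : ∃ N, (fam G k X I.toFinset).card = N + 1 :=
      ⟨_, (Nat.succ_pred_eq_of_pos (card_fam_pos hnd hI hIk hR)).symm⟩
    have hkk : k ≤ k ^ 2 := Nat.le_self_pow (by simp) k
    have h1k : 1 ≤ k := by omega
    have hbase : 200 * k ^ 2 ≤ 200 * k ^ 2 * (2 * (N + 1) - 1) :=
      Nat.le_mul_of_pos_right _ (by omega)
    rw [hN]
    simp only [body, linEnumVBody, wp_branch, test_eq, val_var, hs, hk]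
    by_cases hIk' : I.length = k
    · simp only [hIk', if_true, List.append_nil]
      refine wp_post (wp_emitIn_enumPost (σ := σ.tick) hM hnd hI hIX hs hIk') ?_
      rintro τ ⟨h, -⟩
      exact h.of_before rfl rfl rfl (b := 1) le_rfl (by omega)
    simp only [hIk', if_false, List.append_nil, List.append_assoc, List.cons_append,
      List.nil_append, wp_assign, val_var, St.tick_reg, hs]
    refine wp_seq (wp_findMandatory (k := k) (Δ := 2 * k) (by simpa using hM) hne hI hIX hC hCX hIC
      hCk (by omega)) ?_
    rintro σ₁ ⟨k1, m1, d1, o1, p1, t1⟩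
    simp only [St.set_time, St.tick_time] at t1
    have M1 : MRep A X I σ₁.mem := by
      refine hM.of_keepMem (τ := σ₁) (σ := σ) (KeepMem.mono m1 ?_) ?_ d1
      · simp
      · intro v
        rw [m1 _ (by simp)]
        exact hM.seen v
    refine wp_seq (wp_addMandatory M1 hnd hI hC hCX hIC hCk (by rw [k1 _ (by simp)]; simp [hs])
      (by rw [k1 _ (by simp)]; simp [hk]) hIk p1) ?_
    rintro σ₂ ⟨k2, m2, o2, ⟨J, M2, s2, nd2, c2, cn2, l2, f2, r2⟩, t2⟩
    have s₀2 : σ₂.reg .s₀ = I.length := by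
      rw [k2 _ (by simp), k1 _ (by simp)]; simp
    have kk2 : σ₂.reg .k = k := by
      rw [k2 _ (by simp), k1 _ (by simp)]; simp [hk]
    have nx2 : σ₂.mem .nxt = σ.mem .nxt := by
      rw [m2 _ (by simp), m1 _ (by simp)]; rfl
    have pv2 : σ₂.mem .prv = σ.mem .prv := by
      rw [m2 _ (by simp), m1 _ (by simp)]; rfl
    have hX2 : ∀ v ∈ I ++ J, v ∈ X := fun v hv => hCX (c2 v hv)
    have hJk : J.length ≤ k := by
      rw [List.length_append] at l2
      omega
    have t2' : σ₂.time ≤ σ.time + 2 + (2 * k * (11 * (2 * k) + 11) + 6) +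
      (k * (7 * (2 * k) + 5) + 2) := by omega
    have e2 : 2 + (2 * k * (11 * (2 * k) + 11) + 6) + (k * (7 * (2 * k) + 5) + 2) =
      58 * k ^ 2 + 27 * k + 10 := by ring
    have o2' : σ₂.out = σ.out := by rw [o2, o1]; rfl
    simp only [wp_branch, test_eq, val_var, s2, kk2]
    by_cases hfull : (I ++ J).length = k
    · simp only [hfull, if_true]
      refine wp_seq (wp_emitIn_enumPost (σ := σ₂.tick) M2 nd2 cn2 hX2 s2 hfull) ?_
      rintro τ ⟨h, hK⟩
      refine wp_post (wp_popTo_enumPost (h.of_before (σ := σ) (B' := 65 * k ^ 2 + 30 * k + 15)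
        (b := 58 * k ^ 2 + 27 * k + 11) nx2 pv2 o2' (by simp only [St.tick_time]; omega) (by omega))
        nd2 (by rw [hK _ (by simp)]; exact s2)
        (by rw [hK _ (by simp)]; exact s₀2) hJk f2) ?_
      intro ρ hρ
      exact hρ.of_before rfl rfl rfl (b := 0) (by omega) (by nlinarith)
    simp only [hfull, if_false, List.cons_append, List.append_assoc, wp_assign, val_zero]
    have hlt : (I ++ J).length < k := by omega
    refine wp_seq (wp_findTwo (i₀ := 0) (by simpa using M2) nd2 hX2 (by simp [s2])
      (by simp) (by omega) (by simp)) ?_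
    rintro σ₃ ⟨k3, m3, o3, F3, t3⟩
    simp only [St.set_time, St.tick_time, St.set_mem, St.tick_mem, St.set_out, St.tick_out,
      Nat.sub_zero] at t3 m3 o3
    have R2 : Rich G k X (I ++ J).toFinset := by
      refine hR.superset hI.1 ?_ cn2 fun v hv => hX2 v (List.mem_toFinset.1 hv)
      rw [List.toFinset_append]
      exact Finset.subset_union_left
    obtain ⟨z, hz, hzN⟩ : ∃ z : Fin n, σ₃.reg .x = z ∧ IsNbr G X (I ++ J) z := by
      rcases F3 with ⟨-, h⟩ | ⟨x, -, h1, h2, -⟩ | ⟨x, y, -, -, h1, -, h2, -⟩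
      · obtain ⟨w, hw⟩ := exists_isNbr nd2 cn2 hlt R2
        exact absurd hw (h w)
      · exact ⟨x, h1, h2⟩
      · exact ⟨x, h1, h2⟩
    have hzC : z ∈ C := by
      obtain ⟨hzX, -, a, ha, haz⟩ := hzN
      exact hC a (c2 a ha) z hzX haz
    have hRz := r2 hlt z hzN
    have ndz := nodup_append_singleton nd2 hzN.2.1
    have hcons := card_fam_split (G := G) (k := k) X (I ++ J) z
    rw [f2, hN] at hcons
    -- Both branches have graphlets: the first because `z` is a neighbour of a rich set, the second
    -- because no neighbour is mandatory any more.
    obtain ⟨p, hp⟩ : ∃ p, (fam G k X (I ++ J ++ [z]).toFinset).card = p + 1 :=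
      ⟨_, (Nat.succ_pred_eq_of_pos (card_fam_pos ndz (hzN.conn cn2)
        (by rw [List.length_append, List.length_singleton]; omega) (hzN.rich cn2 hX2 R2))).symm⟩
    obtain ⟨q, hq⟩ : ∃ q, (fam G k (X.erase z) (I ++ J).toFinset).card = q + 1 :=
      ⟨_, (Nat.succ_pred_eq_of_pos (card_fam_pos nd2 cn2 l2 hRz)).symm⟩
    -- The pivot lies in `C`, so here its deletion costs `O(k)` and needs no amortisation.
    have harcs : (arcs A X z).length ≤ 2 * k := by
      rw [← List.toFinset_card_of_nodup (nodup_arcs A X z)]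
      refine (Finset.card_le_card fun w hw => ?_).trans hCk
      rw [List.mem_toFinset, mem_arcs] at hw
      exact hC z hzC w hw.1 hw.2
    have hIJ : I.length ≤ (I ++ J).length := by simp
    have kk3 : σ₃.reg .k = k := by rw [k3 _ (by simp)]; simp [kk2]
    have s3 : σ₃.reg .s = (I ++ J).length := by rw [k3 _ (by simp)]; simp [s2]
    simp only [wp_assign, val_var, hz]
    refine wp_seq (wp_branchOn (k := k) (X := X) (I := I ++ J) (z := z) (A := A)
      (B₁ := 200 * k ^ 2 * (2 * (p + 1) - 1)) (B₂ := 200 * k ^ 2 * (2 * (q + 1) - 1))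
      (by simpa [m3] using M2) nd2 (by simp [s3]) (by simp) hzN.2.1 hzN.1 ?_ ?_) ?_
    · intro σ' hM' hs' hk'
      rw [← hp]
      refine ih X C _ σ' hM' ndz (hzN.conn cn2) ?_ hCX hC hCk (hzN.rich cn2 hX2 R2) ?_ ?_ ?_ ?_
      · intro v hv
        rcases List.mem_append.1 hv with hv | hv
        · exact c2 v hv
        · exact List.mem_singleton.1 hv ▸ hzC
      · rw [List.length_append, List.length_singleton]; omega
      · rw [hs', List.length_append (bs := [z]), List.length_singleton]
      · rw [hk']; simp [kk3]
      · rw [List.length_append (bs := [z]), List.length_singleton]; omega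
    · intro σ' hM' hs' hk'
      rw [← hq]
      have hcl : Closed G (X.erase z) (C.erase z) := fun a ha b hb hab =>
        Finset.mem_erase.2 ⟨(Finset.mem_erase.1 hb).1,
          hC a (Finset.mem_of_mem_erase ha) b (Finset.mem_of_mem_erase hb) hab⟩
      refine ih (X.erase z) (C.erase z) _ σ' hM' nd2 cn2 ?_ (Finset.erase_subset_erase _ hCX) hcl
        ((Finset.card_le_card (Finset.erase_subset _ _)).trans hCk) hRz l2 hs' ?_ ?_
      · intro v hv
        exact Finset.mem_erase.2 ⟨fun h => hzN.2.1 (h ▸ hv), c2 v hv⟩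
      · rw [hk']; simp [kk3]
      · rw [Finset.card_erase_of_mem hzN.1]; omega
    rintro σ₄ ⟨P4, k4⟩
    have e3 : (I ++ J).length * (8 * (I ++ J).length + 21) ≤ k * (8 * k + 21) :=
      Nat.mul_le_mul l2 (by omega)
    have e4 : k * (8 * k + 21) = 8 * k ^ 2 + 21 * k := by ring
    refine wp_post (wp_popTo_enumPost (P4.of_before (σ := σ) (b := 66 * k ^ 2 + 48 * k + 20)
      (by simp [m3, nx2]) (by simp [m3, pv2]) (by simp [o3, o2'])
      (by simp only [St.set_time]; omega) le_rfl) nd2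
      (by rw [k4 _ (by simp)]; simp [s3]) ?_ hJk f2) ?_
    · rw [k4 _ (by simp), St.set_reg, if_neg (by simp), k3 _ (by simp)]
      simp [s₀2]
    · intro ρ hρ
      refine hρ.of_before rfl rfl rfl (b := 0) (by omega) ?_
      -- The branches have `p + 1` and `q + 1` graphlets. The node counts add up to one less than
      -- that of the parent, which leaves `200 k²` for its own work.
      obtain rfl : N = p + q + 1 := by omega
      have e5 : 2 * (p + 1) - 1 = 2 * p + 1 := by omega
      have e6 : 2 * (q + 1) - 1 = 2 * q + 1 := by omega
      have e7 : 2 * (p + q + 1 + 1) - 1 = (2 * p + 1) + (2 * q + 1) + 1 := by omega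
      have e8 : 200 * k ^ 2 * (2 * p + 1 + (2 * q + 1) + 1) = 200 * k ^ 2 * (2 * p + 1) +
        200 * k ^ 2 * (2 * q + 1) + 200 * k ^ 2 := by ring
      rw [e5, e6, e7, e8]
      generalize 200 * k ^ 2 * (2 * p + 1) = x
      generalize 200 * k ^ 2 * (2 * q + 1) = y
      omega

/-- The loop of ENUM-V that adds the only neighbour to `In`. -/
def followChain : List Cmd :=
  [.loop (.and (.eq (.var .cnt) 1) (.lt (.add (.var .s) 1) (.var .k)))
    (.assign .i (.var .s) :: push (.var .x) ++ findTwo)]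

/-- The loop stops at `I.length + 1 = k` or when the neighbour is no longer unique. The family is
unchanged by `fam_insert_of_unique`. -/
theorem wp_followChain (hM : MRep A X I σ.mem) (hnd : I.Nodup) (hI : Conn G I.toFinset)
    (hIX : ∀ v ∈ I, v ∈ X) (hs : σ.reg .s = I.length) (hk : σ.reg .k = k) (hIk : I.length + 1 ≤ k)
    (hF : FoundTwo G X I σ) :
    wpG D followChain (fun τ => Keep [.cnt, .i, .u, .a, .w, .x, .y, .s] σ τ ∧
      KeepMem [.ins, .isIn] σ τ ∧ τ.out = σ.out ∧ (∃ J, MRep A X (I ++ J) τ.mem ∧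
        (I ++ J).Nodup ∧ Conn G (I ++ J).toFinset ∧ (∀ v ∈ I ++ J, v ∈ X) ∧
        τ.reg .s = (I ++ J).length ∧ (I ++ J).length + 1 ≤ k ∧
        fam G k X (I ++ J).toFinset = fam G k X I.toFinset ∧ FoundTwo G X (I ++ J) τ ∧
        (τ.reg .cnt = 1 → (I ++ J).length + 1 = k)) ∧
      τ.time ≤ σ.time + k * (8 * k + 27) + 1) σ := by
  obtain ⟨B, hB⟩ : ∃ B, B = 8 * k + 27 := ⟨_, rfl⟩
  rw [← hB]
  refine wp_loop (fun m τ => ∃ J, m + J.length = k ∧ Keep [.cnt, .i, .u, .a, .w, .x, .y, .s] σ τ ∧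
    KeepMem [.ins, .isIn] σ τ ∧ τ.out = σ.out ∧ MRep A X (I ++ J) τ.mem ∧
    (I ++ J).Nodup ∧ Conn G (I ++ J).toFinset ∧ (∀ v ∈ I ++ J, v ∈ X) ∧
    τ.reg .s = (I ++ J).length ∧ (I ++ J).length + 1 ≤ k ∧
    fam G k X (I ++ J).toFinset = fam G k X I.toFinset ∧ FoundTwo G X (I ++ J) τ ∧
    τ.time ≤ σ.time + J.length * B) (m := k) ?_ ?_ ?_
  · exact ⟨[], by simp, Keep.refl, KeepMem.refl, rfl, by simpa using hM, by simpa using hnd,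
      by simpa using hI, by simpa using hIX, by simpa using hs, by simpa using hIk, by simp,
      by simpa using hF, by simp⟩
  · rintro m τ ⟨J, hm, h1, h2, h3, h4, h5, h6, h7, h8, h9, h10, h11, h12⟩ htest
    have hkτ : τ.reg .k = k := by rw [h1 _ (by simp), hk]
    simp only [test_and, test_eq, test_lt, val_var, val_add, val_one, h8, hkτ] at htest
    obtain ⟨hcnt, hlt⟩ := htest
    obtain ⟨x, hx, hxN, huniq⟩ : ∃ x : Fin n, τ.reg .x = x ∧ IsNbr G X (I ++ J) x ∧
        ∀ w, IsNbr G X (I ++ J) w → w = x := by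
      rcases h11 with ⟨h, -⟩ | ⟨x, -, ha, hb, hc⟩ | ⟨x, y, -, h, -⟩
      · omega
      · exact ⟨x, ha, hb, hc⟩
      · omega
    have hnd' := nodup_append_singleton h5 hxN.2.1
    have hX' : ∀ v ∈ I ++ J ++ [x], v ∈ X := by
      intro v hv
      rcases List.mem_append.1 hv with hv | hv
      · exact h7 v hv
      · exact List.mem_singleton.1 hv ▸ hxN.1
    simp only [wp_assign, List.cons_append, val_var]
    refine wp_seq (wp_push (A := A) (X := X) (v := x) (I := I ++ J) (by simpa using h4) hnd'
      (by simp [h8]) (by simp [hx])) ?_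
    rintro σ₁ ⟨k1, s1, m1, M1, o1, t1⟩
    refine wp_post (wp_findTwo (i₀ := (I ++ J).length) M1 hnd' hX' (by simp [s1]; omega)
      (by rw [k1 _ (by simp)]; simp [h8]) (by simp) ?_) ?_
    -- The added vertex was the only neighbour, so the older vertices have no neighbours left
    -- outside, and the search resumes at the new vertex.
    · intro j hj hlt' w hw
      rw [List.getElem_append_left hlt', mem_arcs] at hw
      by_cases hwI : w ∈ I ++ J
      · exact List.mem_append_left _ hwI
      · rw [huniq w ⟨hw.1, hwI, _, List.getElem_mem hlt', hw.2⟩]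
        simp
    rintro ρ ⟨k2, m2, o2, F2, t2⟩
    refine ⟨m - 1, ?_, J ++ [x], ?_, ?_, ?_, ?_, ?_⟩
    · rw [List.length_append] at hlt
      omega
    · rw [List.length_append] at hlt
      rw [List.length_append, List.length_singleton]
      omega
    · refine (h1.trans ?_).trans (k2.mono (by simp))
      intro r hr
      rw [k1 r (by simp only [List.mem_cons, not_or] at hr ⊢; simp [hr])]
      simp only [List.mem_cons, not_or] at hr
      simp [hr]
    · intro t ht
      rw [m2, m1 t ht, ← h2 t ht]
      rfl
    · rw [o2, o1, ← h3]
      rfl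
    · rw [← List.append_assoc, m2]
      refine ⟨M1, hnd', hxN.conn h6, hX', ?_, ?_, ?_, F2, ?_⟩
      · rw [k2 _ (by simp), s1, List.length_append (bs := [x]), List.length_singleton]
      · rw [List.length_append (bs := [x]), List.length_singleton]
        omega
      · rw [← h10, toFinset_append_singleton]
        refine fam_insert_of_unique h6.1 (by rw [List.toFinset_card_of_nodup h5]; omega) ?_
        intro a ha b hb hbI hab
        exact huniq b ⟨hb, fun h => hbI (List.mem_toFinset.2 h), a, List.mem_toFinset.1 ha, hab⟩
      · simp only [St.set_time, St.tick_time] at t1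
        rw [List.length_append (bs := [x]), List.length_singleton, Nat.add_sub_cancel_left,
          Nat.one_mul] at t2
        rw [List.length_append, List.length_singleton, Nat.succ_mul J.length B]
        omega
  · rintro m τ ⟨J, hm, h1, h2, h3, h4, h5, h6, h7, h8, h9, h10, h11, h12⟩ htest
    have hkτ : τ.reg .k = k := by rw [h1 _ (by simp), hk]
    simp only [test_and, test_eq, test_lt, val_var, val_add, val_one, h8, hkτ] at htest
    rw [wp_nil_iff]
    have hJB : J.length * B ≤ k * B := Nat.mul_le_mul_right _ (by omega)
    refine ⟨h1, h2, h3, ⟨J, h4, h5, h6, h7, h8, h9, h10, h11, fun hc => ?_⟩,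
      by simp only [St.tick_time]; omega⟩
    by_contra h
    exact htest ⟨hc, by omega⟩

/-- The choice of the pivot in ENUM-V. -/
def choosePivot : List Cmd :=
  .assign .z (.var .x) :: testMandatory ++
    [.branch (.eq (.var .res) 1) (.assign .z (.var .y) :: testMandatory) []]

theorem wp_choosePivot {x y : Fin n} (hM : MRep A X I σ.mem) (hnd : I.Nodup)
    (hI : Conn G I.toFinset) (hIX : ∀ v ∈ I, v ∈ X) (hs : σ.reg .s = I.length)
    (hk : σ.reg .k = k) (hIk : I.length ≤ k) (hkn : k ≤ n) (hx : σ.reg .x = x) (hy : σ.reg .y = y)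
    (hxI : x ∉ I) (hyI : y ∉ I) :
    wpG D choosePivot (fun τ => Keep [.z, .q, .p, .u, .a, .w, .res] σ τ ∧
      KeepMem [.seen, .queue] σ τ ∧ (∀ v : Fin n, τ.mem .seen v = 0) ∧ τ.out = σ.out ∧
      ((τ.reg .res = 0 ∧ ∃ z, (z = x ∨ z = y) ∧ τ.reg .z = z ∧ Rich G k (X.erase z) I.toFinset) ∨
        τ.reg .res = 1 ∧ ¬ Rich G k (X.erase x) I.toFinset ∧ ¬ Rich G k (X.erase y) I.toFinset) ∧
      τ.time ≤ σ.time + 2 * (k * (7 * k + 20)) + 21) σ := by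
  simp only [choosePivot, List.cons_append, wp_assign, val_var, hx]
  refine wp_seq (wp_testMandatory (z := x) (A := A) (by simpa using hM) hnd hIX hI (by simpa using hs)
    (by simpa using hk) hIk hkn (by simp) hxI) ?_
  rintro σ₁ ⟨k1, m1, d1, o1, R1, t1⟩
  simp only [St.set_time] at t1
  have k1' : Keep [.z, .q, .p, .u, .a, .w, .res] σ σ₁ := by
    refine Keep.trans ?_ (k1.mono (by simp))
    simp [Keep.refl]
  simp only [wp_branch, test_eq, val_var, val_one]
  rcases R1 with ⟨hr, hR⟩ | ⟨hr, hR⟩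
  · simp only [hr, zero_ne_one, if_false, List.nil_append, wp_nil_iff]
    refine ⟨by simpa using k1', m1, d1, o1, .inl ⟨hr, x, .inl rfl, ?_, hR⟩, ?_⟩
    · rw [St.tick_reg, k1 _ (by simp)]
      simp
    · simp only [St.tick_time]
      omega
  · have M1 : MRep A X I σ₁.mem := by
      refine hM.of_keepMem (τ := σ₁) (σ := σ) (KeepMem.mono m1 (by simp)) d1 fun v => ?_
      rw [m1 _ (by simp)]
      exact hM.disc v
    have y1 : σ₁.reg .y = y := by rw [k1' _ (by simp), hy]
    simp only [hr, if_true, List.cons_append, List.append_nil, wp_assign, val_var, St.tick_reg, y1]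
    refine wp_post (wp_testMandatory (z := y) (A := A) (by simpa using M1) hnd hIX hI ?_
      ?_ hIk hkn (by simp) hyI) ?_
    · simp [k1' .s, hs]
    · simp [k1' .k, hk]
    rintro σ₂ ⟨k2, m2, d2, o2, R2, t2⟩
    simp only [St.set_time, St.tick_time] at t2
    refine ⟨?_, m1.trans m2, d2, o2.trans o1, ?_, by omega⟩
    · refine k1'.trans (Keep.trans ?_ (k2.mono (by simp)))
      simp [Keep.refl]
    · rcases R2 with ⟨hr2, hR2⟩ | ⟨hr2, hR2⟩
      · refine .inl ⟨hr2, y, .inr rfl, ?_, hR2⟩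
        rw [k2 _ (by simp)]
        simp
      · exact .inr ⟨hr2, hR, hR2⟩

end Enumeration

end Graphlet


namespace Graphlet

set_option linter.unusedSimpArgs false

/-! ### The procedure ENUM-V and its amortised time. -/

section EnumV

variable {n : ℕ} {G : SimpleGraph (Fin n)} {A : AdjLists G} {X : Finset (Fin n)}
  {I : List (Fin n)} {D k : ℕ} {σ : St}

local notation "wpG" => wp (arrLen n (numEdges G))

/-- Regroups the program so that the chain and the choice of the pivot are blocks with
specifications of their own. -/
theorem enumVBody_eq : body .enumV = .assign .s₀ (.var .s) :: .assign .i 0 :: (findTwo ++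
    (followChain ++ (.branch (.eq (.add (.var .s) 1) (.var .k)) emitExtensions
      (choosePivot ++ [.branch (.eq (.var .res) 0) (branchOn .enumV) [.call .linEnumV]]) ::
      popTo))) := by
  simp [body, enumVBody, followChain, choosePivot]

/-- The time of ENUM-V for `N` graphlets when `l` further vertices are to be found. -/
def enumVTime (k l N : ℕ) : ℕ := 500 * k ^ 2 * (2 * N - 1) + 10 * k * l * N

theorem enumVTime_mono {l l' N : ℕ} (h : l ≤ l') : enumVTime k l N ≤ enumVTime k l' N :=
  Nat.add_le_add_left (Nat.mul_le_mul_right _ (Nat.mul_le_mul_left _ h)) _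

theorem wp_emitExtensions_enumPost (hM : MRep A X I σ.mem) (hnd : I.Nodup)
    (hI : Conn G I.toFinset) (hIX : ∀ v ∈ I, v ∈ X) (hs : σ.reg .s = I.length)
    (hk : I.length + 1 = k) (hR : Rich G k X I.toFinset) :
    wpG D emitExtensions (fun τ =>
      EnumPost A k X I (30 * k ^ 2 * (fam G k X I.toFinset).card) σ τ ∧
      Keep [.q, .i, .u, .a, .w, .j] σ τ) σ := by
  refine wp_post (wp_emitExtensions hM hnd hIX hs) ?_
  rintro τ ⟨h1, h2, h3, Q, h4, h5, h6, h7⟩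
  obtain ⟨hL, hN⟩ := lists_extensions hnd hIX hI hk h4 h5
  have hpos := card_fam_pos hnd hI (by omega) hR
  refine ⟨⟨hM.of_keepMem (KeepMem.mono h2 (by simp)) h3 fun v => ?_, h2 _ (by simp), h2 _ (by simp),
    ⟨_, h6, hL⟩, h7.trans ?_⟩, h1⟩
  · rw [h2 _ (by simp)]
    exact hM.disc v
  · rw [hN] at hpos ⊢
    obtain ⟨q, hq⟩ := Nat.exists_eq_add_one.2 hpos
    rw [hq]
    subst hk
    nlinarith [Nat.zero_le (I.length * q), Nat.zero_le (I.length ^ 2 * q),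
      Nat.zero_le (I.length ^ 2)]

/-- Bounds the deletion cost by the output of the first branch only, which is where `enumVTime` has
credit for it. -/
theorem length_arcs_le {z : Fin n} (hnd : (I ++ [z]).Nodup) (hI : Conn G (I ++ [z]).toFinset)
    (hIX : ∀ v ∈ I ++ [z], v ∈ X) (hk : I.length + 1 < k) (hR : Rich G k X (I ++ [z]).toFinset) :
    (arcs A X z).length ≤ k + k * (fam G k X (I ++ [z]).toFinset).card := by
  rw [← List.toFinset_card_of_nodup (nodup_arcs A X z)]
  refine card_adj_le (z := z) (by simp) hI (fun v hv => hIX v (List.mem_toFinset.1 hv)) ?_ hR ?_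
  · rw [List.toFinset_card_of_nodup hnd]
    simpa using hk
  · intro w hw
    exact mem_arcs.1 (List.mem_toFinset.1 hw)

/-- The first term of `enumVTime` gains `500 k²` at a branching, which pays for `W` and for the part
`10 k` of the deletion. The other part `10 k p` is paid by the second term, whose parameter `l`
drops by one in the first branch, the one with `p` graphlets. -/
theorem enumVTime_split {l p q W d : ℕ} (hp : 0 < p) (hq : 0 < q) (hd : d ≤ k + k * p)
    (hW : W + 10 * k + 13 ≤ 500 * k ^ 2) :
    W + (enumVTime k l p + enumVTime k (l + 1) q + 10 * d + 13) ≤ enumVTime k (l + 1) (p + q) := by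
  obtain ⟨p, rfl⟩ := Nat.exists_eq_add_one.2 hp
  obtain ⟨q, rfl⟩ := Nat.exists_eq_add_one.2 hq
  have e1 : 2 * (p + 1) - 1 = 2 * p + 1 := by omega
  have e2 : 2 * (q + 1) - 1 = 2 * q + 1 := by omega
  have e3 : 2 * (p + 1 + (q + 1)) - 1 = 2 * p + 2 * q + 3 := by omega
  simp only [enumVTime, e1, e2, e3]
  nlinarith

/-- Covers the calls without branching: output of the extensions, and the hand-over to LIN-ENUM-V,
whose rate of `200 k²` leaves room for the preceding tests. -/
theorem le_enumVTime {l N B : ℕ} (hk : 2 ≤ k) (hB : B ≤ 200 * k ^ 2 * (2 * N + 1)) :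
    30 * k ^ 2 + 91 * k + 31 + B ≤ enumVTime k l (N + 1) := by
  have h1 : 2 * k ≤ k ^ 2 := by rw [pow_two]; exact Nat.mul_le_mul_right k hk
  have e1 : 2 * (N + 1) - 1 = 2 * N + 1 := by omega
  have e2 : 200 * k ^ 2 * (2 * N + 1) = 400 * (k ^ 2 * N) + 200 * k ^ 2 := by ring
  have e3 : 500 * k ^ 2 * (2 * N + 1) = 1000 * (k ^ 2 * N) + 500 * k ^ 2 := by ring
  rw [enumVTime, e1, e3]
  rw [e2] at hB
  omega

-- The chain and the search for a pivot cost `O(k²)`. What follows is a leaf, a call of LIN-ENUM-V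
-- or a branching on a pivot that is not mandatory, so that both branches stay rich. The depth bound
-- has one unit more than that of `wp_linEnumV`, for the call that switches to it.
set_option maxHeartbeats 1000000 in
theorem wp_enumV (hk2 : 2 ≤ k) (hkn : k ≤ n) (D : ℕ) :
    ∀ (X : Finset (Fin n)) (I : List (Fin n)) (σ : St),
    MRep A X I σ.mem → I.Nodup → Conn G I.toFinset → (∀ v ∈ I, v ∈ X) → Rich G k X I.toFinset →
    I.length + 1 ≤ k → σ.reg .s = I.length → σ.reg .k = k → n + 2 + X.card ≤ D + I.length →
    wpG D (body .enumV)
      (EnumPost A k X I (enumVTime k (k - I.length) (fam G k X I.toFinset).card) σ) σ := by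
  induction D with
  | zero =>
    intro X I σ hM hnd hI hIX hR hIk hs hk hD
    have := length_le_of_nodup hnd
    omega
  | succ D ih =>
    intro X I σ hM hnd hI hIX hR hIk hs hk hD
    rw [enumVBody_eq]
    simp only [wp_assign, val_var, val_zero, hs]
    refine wp_seq (wp_findTwo (i₀ := 0) (by simpa using hM) hnd hIX (by simp [hs])
      (by simp) (by omega) (by simp)) ?_
    rintro σ₁ ⟨k1, m1, o1, F1, t1⟩
    simp only [St.set_time, St.set_mem, St.set_out, Nat.sub_zero] at t1 m1 o1
    have s1 : σ₁.reg .s = I.length := by rw [k1 _ (by simp)]; simp [hs]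
    have kk1 : σ₁.reg .k = k := by rw [k1 _ (by simp)]; simp [hk]
    have s₀1 : σ₁.reg .s₀ = I.length := by rw [k1 _ (by simp)]; simp
    have et1 : I.length * (8 * I.length + 21) ≤ k * (8 * k + 21) :=
      Nat.mul_le_mul (by omega) (by omega)
    refine wp_seq (wp_followChain (by rw [m1]; exact hM) hnd hI hIX s1 kk1 hIk F1) ?_
    rintro σ₂ ⟨k2, m2, o2, ⟨J, M2, nd2, c2, X2, s2, l2, f2, F2, hc2⟩, t2⟩
    have kk2 : σ₂.reg .k = k := by rw [k2 _ (by simp), kk1]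
    have s₀2 : σ₂.reg .s₀ = I.length := by rw [k2 _ (by simp), s₀1]
    have nx2 : σ₂.mem .nxt = σ.mem .nxt := by rw [m2 _ (by simp), m1]
    have pv2 : σ₂.mem .prv = σ.mem .prv := by rw [m2 _ (by simp), m1]
    have o2' : σ₂.out = σ.out := by rw [o2, o1]
    have hJk : J.length ≤ k := by
      rw [List.length_append] at l2
      omega
    have R2 : Rich G k X (I ++ J).toFinset := by
      refine hR.superset hI.1 ?_ c2 fun v hv => X2 v (List.mem_toFinset.1 hv)
      rw [List.toFinset_append]
      exact Finset.subset_union_left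
    have et2 : k * (8 * k + 21) + k * (8 * k + 27) = 16 * k ^ 2 + 48 * k := by ring
    have t2' : σ₂.time ≤ σ.time + (16 * k ^ 2 + 48 * k + 5) := by omega
    have hNpos := card_fam_pos hnd hI (by omega) hR
    have hIJ : I.length ≤ (I ++ J).length := by simp
    obtain ⟨N, hN⟩ : ∃ N, (fam G k X I.toFinset).card = N + 1 :=
      ⟨_, (Nat.succ_pred_eq_of_pos hNpos).symm⟩
    have eN : 2 * (N + 1) - 1 = 2 * N + 1 := by omega
    -- Splits off the common beginning and the final `popTo`. Each of the three cases then supplies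
    -- its own bound `B`.
    suffices h : ∃ B, wpG (D + 1) (if (I ++ J).length + 1 = k then emitExtensions else
        choosePivot ++ [.branch (.eq (.var .res) 0) (branchOn .enumV) [.call .linEnumV]])
        (fun τ => EnumPost A k X (I ++ J) B σ₂.tick τ ∧ τ.reg .s = (I ++ J).length ∧
          τ.reg .s₀ = I.length) σ₂.tick ∧
        16 * k ^ 2 + 51 * k + 7 + B ≤ enumVTime k (k - I.length) (N + 1) by
      obtain ⟨B, hB, hBt⟩ := h
      simp only [wp_branch, test_eq, val_add, val_var, val_one, s2, kk2]
      refine wp_seq hB ?_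
      rintro τ ⟨hP, hs', hs₀'⟩
      refine wp_post (wp_popTo_enumPost (hP.of_before (σ := σ) (b := 16 * k ^ 2 + 48 * k + 6)
        nx2 pv2 o2' (by simp only [St.tick_time]; omega) le_rfl) nd2 hs' hs₀' hJk f2) ?_
      intro ρ hρ
      rw [hN]
      exact hρ.of_before rfl rfl rfl (b := 0) (by omega) (by omega)
    by_cases hfull : (I ++ J).length + 1 = k
    · refine ⟨30 * k ^ 2 * (fam G k X (I ++ J).toFinset).card, ?_, ?_⟩
      · rw [if_pos hfull]
        refine wp_post (wp_emitExtensions_enumPost (σ := σ₂.tick) M2 nd2 c2 X2 s2 hfull R2) ?_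
        rintro τ ⟨h1, h2⟩
        exact ⟨h1, by rw [h2 _ (by simp)]; exact s2, by rw [h2 _ (by simp)]; exact s₀2⟩
      · rw [f2, hN]
        have e3 : 30 * k ^ 2 * (N + 1) = 30 * (k ^ 2 * N) + 30 * k ^ 2 := by ring
        have e4 : 200 * k ^ 2 * (2 * N + 1) = 400 * (k ^ 2 * N) + 200 * k ^ 2 := by ring
        have := le_enumVTime (l := k - I.length) (N := N) (B := 30 * k ^ 2 * (N + 1)) hk2 (by omega)
        omega
    have hlt : (I ++ J).length + 1 < k := by omega
    obtain ⟨x, y, hxy, hx, hy, hxN, hyN⟩ : ∃ x y : Fin n, x ≠ y ∧ σ₂.reg .x = x ∧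
        σ₂.reg .y = y ∧ IsNbr G X (I ++ J) x ∧ IsNbr G X (I ++ J) y := by
      rcases F2 with ⟨-, h⟩ | ⟨x, h, -⟩ | ⟨x, y, h1, -, h2⟩
      · obtain ⟨w, hw⟩ := exists_isNbr nd2 c2 (by omega) R2
        exact absurd hw (h w)
      · exact absurd (hc2 h) hfull
      · exact ⟨x, y, h1, h2⟩
    have et3 : 2 * (k * (7 * k + 20)) = 14 * k ^ 2 + 40 * k := by ring
    have hpiv := wp_choosePivot (D := D + 1) (σ := σ₂.tick) M2 nd2 c2 X2 s2 kk2 (by omega) hkn hx hy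
      hxN.2.1 hyN.2.1
    rw [et3] at hpiv
    simp only [hfull, if_false]
    by_cases hboth : ¬ Rich G k (X.erase x) (I ++ J).toFinset ∧
        ¬ Rich G k (X.erase y) (I ++ J).toFinset
    · obtain ⟨C, hIC, hCX, hC, hCk⟩ := exists_small_closed c2
        (fun v hv => X2 v (List.mem_toFinset.1 hv)) hxy (by simpa using hxN.2.1)
        (by simpa using hyN.2.1) hxN.1 hyN.1 (by simpa using hxN.2.2) (by simpa using hyN.2.2)
        hboth.1 hboth.2
      refine ⟨14 * k ^ 2 + 40 * k + 24 + 200 * k ^ 2 * (2 * (N + 1) - 1), wp_seq hpiv ?_, ?_⟩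
      · rintro σ₃ ⟨k3, m3, d3, o3, R3, t3⟩
        have hres : σ₃.reg .res ≠ 0 := by
          rcases R3 with ⟨-, z, rfl | rfl, -, h⟩ | ⟨h, -⟩
          · exact absurd h hboth.1
          · exact absurd h hboth.2
          · omega
        have M3 : MRep A X (I ++ J) σ₃.mem := by
          refine M2.of_keepMem (τ := σ₃) (σ := σ₂) (KeepMem.mono m3 (by simp)) d3 fun v => ?_
          rw [m3 _ (by simp)]
          exact M2.disc v
        simp only [wp_branch, test_eq, val_var, val_zero, hres, if_false, List.cons_append,
          List.nil_append]
        refine wp_call (wp_linEnumV D X C (I ++ J) σ₃.tick.tick M3 nd2 c2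
          (fun v hv => hIC (List.mem_toFinset.2 hv)) hCX hC hCk R2 (by omega)
          (by simp [k3 .s, s2]) (by simp [k3 .k, kk2]) (by omega)) ?_
        rintro τ hP
        rw [f2, hN] at hP
        have := hP.time
        rw [wp_nil_iff]
        simp only [St.tick_time] at this t3
        refine ⟨⟨hP.mrep, hP.nxt.trans (m3 _ (by simp)), hP.prv.trans (m3 _ (by simp)), ?_, ?_⟩,
          by simp [k3 .s, s2], by simp [k3 .s₀, s₀2]⟩
        · obtain ⟨o, ho, hL⟩ := hP.out
          exact ⟨o, ho.trans (by rw [St.tick_out, St.tick_out, o3]), f2 ▸ hL⟩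
        · simp only [St.ret_time, St.tick_time]
          omega
      · have := le_enumVTime (l := k - I.length) (N := N) (B := _) hk2 le_rfl
        rw [eN]
        omega
    -- In the branching case `B` is taken to be all the time that is left; `enumVTime_split` shows
    -- that it suffices.
    · obtain ⟨B, hB⟩ : ∃ B, enumVTime k (k - I.length) (N + 1) = 16 * k ^ 2 + 51 * k + 7 + B := by
        refine Nat.exists_eq_add_of_le ?_
        have := le_enumVTime (l := k - I.length) (N := N) hk2 (Nat.zero_le _)
        omega
      refine ⟨B, wp_seq hpiv ?_, hB.ge⟩
      rintro σ₃ ⟨k3, m3, d3, o3, R3, t3⟩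
      have M3 : MRep A X (I ++ J) σ₃.mem := by
        refine M2.of_keepMem (τ := σ₃) (σ := σ₂) (KeepMem.mono m3 (by simp)) d3 fun v => ?_
        rw [m3 _ (by simp)]
        exact M2.disc v
      obtain ⟨hres, z, hz, hzN, hRz⟩ : σ₃.reg .res = 0 ∧ ∃ z : Fin n, σ₃.reg .z = z ∧
          IsNbr G X (I ++ J) z ∧ Rich G k (X.erase z) (I ++ J).toFinset := by
        rcases R3 with ⟨h0, z, rfl | rfl, h1, h2⟩ | ⟨-, h⟩
        · exact ⟨h0, z, h1, hxN, h2⟩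
        · exact ⟨h0, z, h1, hyN, h2⟩
        · exact absurd h hboth
      have ndz := nodup_append_singleton nd2 hzN.2.1
      have cz := hzN.conn c2
      have Rz := hzN.rich c2 X2 R2
      have lz : (I ++ J ++ [z]).length = (I ++ J).length + 1 := by
        rw [List.length_append (bs := [z]), List.length_singleton]
      have Xz : ∀ v ∈ I ++ J ++ [z], v ∈ X := by
        intro v hv
        rcases List.mem_append.1 hv with hv | hv
        · exact X2 v hv
        · exact List.mem_singleton.1 hv ▸ hzN.1
      obtain ⟨l, hl⟩ : ∃ l, k - (I ++ J).length = l + 1 := Nat.exists_eq_add_one.2 (by omega)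
      have hl' : k - (I ++ J ++ [z]).length = l := by omega
      have hkk : 2 * k ≤ k ^ 2 := by rw [pow_two]; exact Nat.mul_le_mul_right k hk2
      have hsplit := enumVTime_split (l := l) (W := 30 * k ^ 2 + 91 * k + 30)
        (card_fam_pos ndz cz (by omega) Rz) (card_fam_pos nd2 c2 (by omega) hRz)
        (length_arcs_le (A := A) ndz cz Xz hlt Rz) (by omega)
      rw [← card_fam_split, f2, hN] at hsplit
      have hmono := enumVTime_mono (k := k) (N := N + 1) (by omega : l + 1 ≤ k - I.length)
      have hXpos : 0 < X.card := Finset.card_pos.2 ⟨z, hzN.1⟩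
      simp only [wp_branch, test_eq, val_var, val_zero, hres, if_true, List.append_nil]
      refine wp_post (wp_branchOn (k := k) (X := X) (I := I ++ J) (z := z) (A := A) (σ := σ₃.tick)
        M3 nd2 (by simp [k3 .s, s2]) hz hzN.2.1 hzN.1
        (fun σ' hM' hs' hk' => ih X _ σ' hM' ndz cz Xz Rz (by omega) (by rw [hs', lz])
          (by rw [hk']; simp [k3 .k, kk2]) (by omega))
        (fun σ' hM' hs' hk' => ih (X.erase z) _ σ' hM' nd2 c2 (fun v hv => Finset.mem_erase.2
          ⟨fun h => hzN.2.1 (h ▸ hv), X2 v hv⟩) hRz l2 hs' (by rw [hk']; simp [k3 .k, kk2])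
          (by rw [Finset.card_erase_of_mem hzN.1]; omega))) ?_
      rintro τ ⟨hP, hK⟩
      rw [hl, hl'] at hP
      refine ⟨hP.of_before (b := 14 * k ^ 2 + 40 * k + 22) (m3 _ (by simp)) (m3 _ (by simp)) o3
        (by simp only [St.tick_time] at t3 ⊢; omega) (by omega), ?_, ?_⟩
      · rw [hK _ (by simp)]
        simp [k3 .s, s2]
      · rw [hK _ (by simp)]
        simp [k3 .s₀, s₀2]

end EnumV

end Graphlet


namespace Graphlet

section Main

variable {n : ℕ} {G : SimpleGraph (Fin n)}

/-! ### The main program -/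

theorem sum_arrLen (n m : ℕ) : ∑ t : Arr, arrLen n m t = 11 * n + 8 * m := by
  have : ∑ t : Arr, arrLen n m t = (n + 2 * m) + ((n + 2 * m) + ((n + 2 * m) + ((n + 2 * m) +
    (n + (n + (n + (n + (n + (n + (n + 0)))))))))) := rfl
  omega

theorem card_var : Fintype.card Var = 17 := rfl

/-- At the first call `X` has `n` vertices and `In` has one, so depth `2 n + 2` suffices, and the
call itself adds one frame. -/
theorem wp_main (A : AdjLists G) (v : Fin n) {k : ℕ} (hk : 2 ≤ k)
    (hR : Rich G k Finset.univ {v}) :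
    wp (arrLen n (numEdges G)) (2 * n + 3) main (fun τ => Lists τ.out (graphletsAt G k v) ∧
        τ.time ≤ 1020 * ((graphletsAt G k v).ncard * k ^ 2))
      ⟨(start A v k).reg, (start A v k).mem, [], 0⟩ := by
  have hkn : k ≤ n := by
    obtain ⟨S, -, -, -, h⟩ := hR
    simpa using h.trans (Finset.card_le_univ S)
  have M0 : MRep A Finset.univ [] (start A v k).mem :=
    ⟨by simp, by simp [start], by simp [start], by simp [start], rfl, rfl, linked_univ A⟩
  simp only [main, List.cons_append, List.nil_append, wp_assign, val_zero]
  refine wp_seq (wp_push (v := v) (I := []) (by simpa using M0) (by simp) (by simp)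
    (by simp [start])) ?_
  rintro σ ⟨k1, s1, m1, M1, o1, t1⟩
  rw [List.nil_append] at M1
  refine wp_call (wp_enumV hk hkn (2 * n + 2) Finset.univ [v] σ.tick M1 (by simp)
    (by simpa using conn_singleton v) (by simp) (by simpa using hR) (by simpa using hk)
    (by simpa using s1) ?_ (by simp; omega)) ?_
  · rw [St.tick_reg, k1 _ (by simp)]
    simp [start]
  rintro τ ⟨-, -, -, ⟨o, ho, hL⟩, ht⟩
  have hpos := card_fam_pos (G := G) (k := k) (I := [v]) (by simp) (by simpa using conn_singleton v)
    (by simp; omega) (by simpa using hR)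
  have hset : ([v].toFinset : Finset (Fin n)) = {v} := by simp
  rw [hset] at hL ht hpos
  rw [wp_nil_iff, graphletsAt_eq_fam, Set.ncard_coe_finset]
  refine ⟨?_, ?_⟩
  · rw [St.ret_out, ho, St.tick_out, o1]
    simpa using hL
  · obtain ⟨N, hN⟩ := Nat.exists_eq_add_one.2 hpos
    rw [hN] at ht ⊢
    simp only [St.tick_time, St.set_time, List.length_singleton] at ht t1
    simp only [St.ret_time]
    have e1 : 10 * k * (k - 1) * (N + 1) ≤ 10 * k * k * (N + 1) :=
      Nat.mul_le_mul_right _ (Nat.mul_le_mul_left _ (by omega))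
    have e2 : 2 * (N + 1) - 1 = 2 * N + 1 := by omega
    rw [enumVTime, e2] at ht
    have e3 : 4 ≤ k ^ 2 := by nlinarith
    -- The second term of `enumVTime` is bounded with `l ≤ k`, so both terms together give `1010`
    -- per graphlet and `k²`. The rest up to `1020`, and the subtracted `500 k²`, absorb the few
    -- steps of the main program.
    have e4 : 500 * k ^ 2 * (2 * N + 1) + 10 * k * k * (N + 1) =
      1010 * ((N + 1) * k ^ 2) - 500 * k ^ 2 := by
      refine Nat.eq_sub_of_add_eq ?_
      ring
    have e5 : 1 * k ^ 2 ≤ (N + 1) * k ^ 2 := Nat.mul_le_mul_right _ (by omega)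
    omega

end Main

end Graphlet

/-! ### Transfer from the program logic to runs of the machine. -/

theorem mainTheorem5 :
    ∃ C : ℕ, ∀ (n : ℕ) (G : SimpleGraph (Fin n)) (A : Graphlet.AdjLists G) (v : Fin n) (k : ℕ),
      2 ≤ k →
      k ≤ (G.connectedComponentMk v).supp.ncard →
      (∃ T : ℕ,
        T ≤ C * ((Graphlet.graphletsAt G k v).ncard * k ^ 2) ∧
        (Graphlet.run A v k T).Halted ∧
        Graphlet.Lists (Graphlet.run A v k T).out (Graphlet.graphletsAt G k v)) ∧
      ∀ t : ℕ,
        (Graphlet.run A v k t).space (Graphlet.arrLen n (Graphlet.numEdges G)) ≤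
          C * (n + Graphlet.numEdges G) := by
  refine ⟨1020, fun n G A v k hk hcomp => ?_⟩
  obtain ⟨τ, T, ⟨hL, hT⟩, htime, h⟩ :=
    Graphlet.wp_main A v hk (Graphlet.rich_of_le_component hcomp)
  obtain ⟨hrun, hstack⟩ := h [] []
  have hrun' : Graphlet.run A v k T = τ.toConfig [] [] := hrun
  refine ⟨⟨T, ?_, ?_, ?_⟩, fun t => ?_⟩
  · simp only at htime
    omega
  · rw [hrun']
    exact ⟨rfl, rfl⟩
  · rw [hrun']
    exact hL
  · have hst : (Graphlet.run A v k t).stack.length ≤ 2 * n + 3 := by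
      rcases Nat.le_total t T with htT | htT
      · exact (hstack t htT).trans (by simp)
      -- After time `T` the machine has halted and its configuration is a fixed point of `step`,
      -- with empty stack.
      · obtain ⟨d, rfl⟩ := Nat.exists_eq_add_of_le' htT
        rw [Graphlet.run, Function.iterate_add_apply, ← Graphlet.run, hrun',
          Function.iterate_fixed rfl d]
        simp [Graphlet.St.toConfig]
    -- There is a vertex, so `n ≥ 1`, and the constant term of the space `11 n + 8 m + 18 (2 n + 4)`
    -- is absorbed by the multiple of `n`.
    have hn := v.isLt
    rw [Graphlet.Config.space, Graphlet.sum_arrLen, Graphlet.card_var]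
    omega
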